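/- A *rotational surface* of class $C^k$ in $\mathbb R^3$ is the immersed surface obtained, up to a rigid motion, by rotating about the $x$-axis a plane curve $\alpha(t)=(x(t),0,z(t))$, $t\in I$ ($I\subset\mathbb R$ an interval), parametrized by arc length, with $z\ge 0$ on $I$; one requires that $z>0$ exactly on the interior of $I$, that the rotation of $\alpha$ is a $C^k$ immersion there, and that at an end point of $I$ belonging to $I$ (a pole, where $z=0$) the surface is locally the graph of a $C^k$ function over a disc orthogonal to the axis. The surface is *complete* if its induced metric is complete, $A$ denotes its shape operator and $|A|^2=\operatorname{tr}(A^2)$, and it is *periodic* if $I=\mathbb R$ and there are $T>0$ and $d\neq 0$ with $x(t+T)=x(t)+d$ and $z(t+T)=z(t)$ for all $t$. Two rotational surfaces are *congruent* if they agree, as immersed surfaces, up to a rigid motion of $\mathbb R^3$. **Theorem.** There are a number $\lambda_0>1$ and two infinite families $\mathcal F_1$ and $\mathcal F_2$ of complete, non-embedded rotational surfaces in $\mathbb R^3$ with $|A|=1$, such that: 1. $\mathcal F_1=\{M_\lambda:\lambda>\lambda_0\}$ is a one-parameter family: the $M_\lambda$ are given by immersions depending continuously on $\lambda$, $M_\lambda$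 and $M_\mu$ are not congruent if $\lambda\ne\mu$, and $\lambda$ is the largest distance of a point of $M_\lambda$ to its axis of rotation. Each $M_\lambda$ is periodic and of class $C^\infty$. 2. The members of $\mathcal F_2$ are of class $C^3$, and the largest distance of a point of each of them to its axis is $\lambda_0$; infinitely many of them are pairwise non-congruent. 3. Every complete rotational surface of class $C^2$ with $|A|=1$ is a round sphere of radius $\sqrt2$, or a circular cylinder of radius $1$, or is congruent to a member of $\mathcal F_1$ or of $\mathcal F_2$. Here "non-embedded" means that the image of the surface in $\mathbb R^3$ is not an embedded $C^1$ surface. -/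

import Mathlib

open Set Filter Topology
open scoped ContDiff

noncomputable section

/-- Euclidean three-space. -/
abbrev E3 : Type := EuclideanSpace ℝ (Fin 3)

/-! ### The shape operator of a parametrized surface -/

/-- The `i`-th partial derivative of a map from the parameter plane to space. -/
def partialD (i : Fin 2) (F : ℝ × ℝ → E3) (p : ℝ × ℝ) : E3 :=
  fderiv ℝ F p (![(1, 0), (0, 1)] i)

/-- The matrix of the first fundamental form. -/
def firstForm (F : ℝ × ℝ → E3) (p : ℝ × ℝ) : Matrix (Fin 2) (Fin 2) ℝ :=
  Matrix.of fun i j => inner ℝ (partialD i F p) (partialD j F p)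

/-- The matrix of the second fundamental form with respect to the unit normal vector `n`. -/
def secondForm (F : ℝ × ℝ → E3) (p : ℝ × ℝ) (n : E3) : Matrix (Fin 2) (Fin 2) ℝ :=
  Matrix.of fun i j => inner ℝ n (partialD i (partialD j F) p)

/-- The matrix of the shape operator in the basis of the coordinate vector fields. -/
def shapeOperator (F : ℝ × ℝ → E3) (p : ℝ × ℝ) (n : E3) : Matrix (Fin 2) (Fin 2) ℝ :=
  (firstForm F p)⁻¹ * secondForm F p n

/-- `n` is a unit normal vector of the immersion `F` at the parameter `p`. -/
def IsUnitNormal (F : ℝ × ℝ → E3) (p : ℝ × ℝ) (n : E3) : Prop :=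
  ‖n‖ = 1 ∧ ∀ i, inner ℝ n (partialD i F p) = 0

/-- `A` is an embedded (regular) `C^1` surface in space: near each of its points it is a level set
of a `C^1` function whose differential does not vanish along it. -/
def IsEmbeddedSurface (A : Set E3) : Prop :=
  ∀ p ∈ A, ∃ (U : Set E3) (G : E3 → ℝ), IsOpen U ∧ p ∈ U ∧ ContDiffOn ℝ 1 G U ∧
    A ∩ U = {q ∈ U | G q = 0} ∧ ∀ q ∈ A ∩ U, fderiv ℝ G q ≠ 0

/-! ### Rotational surfaces -/

/-- The data of a rotational surface: a plane profile curve `t ↦ (x t, z t)` on the parameter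
interval `I`, rotated about the `x`-axis, followed by a rigid motion `g` that puts the axis into
its place. The values of `x` and `z` outside `I` play no role. -/
structure RotSurface where
  I : Set ℝ
  x : ℝ → ℝ
  z : ℝ → ℝ
  g : E3 ≃ᵃⁱ[ℝ] E3

namespace RotSurface

/-- The rotation map: the profile point of parameter `t`, placed at `(x t, 0, z t)` in the
`xz`-plane, is rotated by the angle `φ` about the `x`-axis. -/
def map (S : RotSurface) (p : ℝ × ℝ) : E3 :=
  S.g !₂[S.x p.1, S.z p.1 * Real.sin p.2, S.z p.1 * Real.cos p.2]

/-- The abstract surface: each profile parameter `t` carries the circle swept out by its profile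
point, which is a single point (a pole) if `z t = 0`. The immersion into space is the second
projection. It need not be injective: keeping `t` separates sheets that cross in space. -/
def points (S : RotSurface) : Set (ℝ × E3) :=
  {m | m.1 ∈ S.I ∧ ∃ φ : ℝ, m.2 = S.map (m.1, φ)}

/-- The underlying subset of space. -/
def carrier (S : RotSurface) : Set E3 := Prod.snd '' S.points

/-- `S` is an immersed rotational surface of class `C^k`, with profile curve parametrized by
arc length. The profile curve lies in the half plane `z > 0`, except for possible end points of
`I` that belong to `I`; these lie on the axis and are poles of the surface. Off the poles the
rotation map is a `C^k` immersion, and near a pole the surface is the graph of a `C^k` function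
over a disc orthogonal to the axis. -/
structure IsOfClass (S : RotSurface) (k : ℕ∞) : Prop where
  ordConnected : S.I.OrdConnected
  nonempty_interior : (interior S.I).Nonempty
  continuousOn_x : ContinuousOn S.x S.I
  continuousOn_z : ContinuousOn S.z S.I
  nonneg : ∀ t ∈ S.I, 0 ≤ S.z t
  pos_iff : ∀ t ∈ S.I, 0 < S.z t ↔ t ∈ interior S.I
  contDiffOn : ContDiffOn ℝ k S.map (interior S.I ×ˢ univ)
  immersion : ∀ p ∈ interior S.I ×ˢ (univ : Set ℝ), Function.Injective (fderiv ℝ S.map p)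
  unit_speed : ∀ t ∈ interior S.I, deriv S.x t ^ 2 + deriv S.z t ^ 2 = 1
  pole : ∀ t₀ ∈ S.I, S.z t₀ = 0 → ∃ h : ℝ × ℝ → ℝ, ContDiffAt ℝ k h (0, 0) ∧
    ∀ᶠ t in 𝓝[S.I] t₀, ∀ φ : ℝ, S.x t = h (S.z t * Real.sin φ, S.z t * Real.cos φ)

/-- Completeness of the induced Riemannian metric: every path on the surface that has finite
length in space converges to a point of the surface (equivalently, divergent paths have infinite
length). -/
def IsComplete (S : RotSurface) : Prop :=
  ∀ c : ℝ → ℝ × E3, ContinuousOn c (Ico 0 1) → MapsTo c (Ico 0 1) S.points →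
    eVariationOn (fun s => (c s).2) (Ico 0 1) ≠ ⊤ →
    ∃ m ∈ S.points, Tendsto c (𝓝[<] 1) (𝓝 m)

/-- `|A| = 1`, where `A` is the shape operator and `|A|² = trace (A²)`. The condition is written
off the poles; poles are isolated, and on a surface of class `C^2` it extends to them by
continuity. The two unit normals at a point differ by a sign, which does not affect `A²`. -/
def HasUnitShape (S : RotSurface) : Prop :=
  ∀ p ∈ interior S.I ×ˢ (univ : Set ℝ), ∀ n : E3, IsUnitNormal S.map p n →
    (shapeOperator S.map p n * shapeOperator S.map p n).trace = 1

/-- The profile curve is defined on the whole line, and after one period `T` it repeats itself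
up to a nonzero translation along the axis. -/
def IsPeriodic (S : RotSurface) : Prop :=
  S.I = univ ∧ ∃ T d : ℝ, 0 < T ∧ d ≠ 0 ∧ ∀ t, S.x (t + T) = S.x t + d ∧ S.z (t + T) = S.z t

/-- `r` is the largest distance from a point of the surface to the axis of rotation. -/
def HasMaxRadius (S : RotSurface) (r : ℝ) : Prop := IsGreatest (S.z '' S.I) r

/-- `S` and `S'` agree, as immersed surfaces, up to a rigid motion of space. -/
def Congruent (S S' : RotSurface) : Prop :=
  ∃ (R : E3 ≃ᵃⁱ[ℝ] E3) (h : S.points ≃ₜ S'.points), ∀ m : S.points, (h m).1.2 = R m.1.2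

/-- `S` is (injectively) a round sphere of radius `r`. -/
def IsRoundSphere (S : RotSurface) (r : ℝ) : Prop :=
  ∃ q : E3, BijOn Prod.snd S.points (Metric.sphere q r)

/-- `S` is (injectively) a circular cylinder of radius `r`: the set of points at distance `r`
from a line. -/
def IsCylinder (S : RotSurface) (r : ℝ) : Prop :=
  ∃ q v : E3, v ≠ 0 ∧
    BijOn Prod.snd S.points {p | Metric.infDist p (range fun s : ℝ => q + s • v) = r}

end RotSurface

end

/-!
Write the unit speed profile as `(x, z)` with tangent `(x', z') = (c, s)` and curvature `κ`. The
principal curvatures of the rotated surface are, up to sign, `κ` and `c / z`, so `|A| = 1` says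
`κ ^ 2 + (c / z) ^ 2 = 1` (`trace_shapeOperator_sq`, `UnitProfile`).

Where `κ < 0`, put `κ = -sin u` and `c / z = -cos u` with `u ∈ (0, π)`. Then
`z ^ 2 * (sin u + cos u) * exp (-u)` is constant (`firstIntegral`), and it scales with the square
of the surface. For a positive value `a ^ 2` both `z / a` and `c / a` are explicit functions of `u`
(`unitHeight`, `unitAxial`); the second one increases from `-∞` to `∞`, so that `u` is a function of
the direction of the tangent (`unitAngle`), and the profile is found by a quadrature (`arcTime`,
`tangentAngle`, `height`, `axial`).

* If `a > 1`, the tangent turns for ever. This gives a smooth periodic profile, which moves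
  backwards along the axis over each period, because at the same slope it is less curved near its
  bottom than near its top (`axial_halfPeriod_neg`); hence it
  crosses itself. Its largest height determines
  `a` (`scaleOf`), and is preserved by congruences, since these have to preserve the axis
  (`radius_le_of_mapsTo`).
* If `a = 1`, the curvature vanishes, to second order in the arc length, at the points where the
  profile touches the cylinder of radius `1`. It reaches these points in finite time, and may follow
  the cylinder for any time before the next hump. Here `κ` is only of class `C^1`, and the surface
  of class `C^3` (`UnitProfile.contDiff_three`). The number of humps is an invariant, which is seen
  as the number of largest circles (`ncard_circleCoords_humpSurface`).
* On a profile over the whole line nothing else is possible, unless `κ` vanishes identically: for a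
  first integral below `1` the profile would run into the axis in finite time
  (`UnitProfile.one_le_firstIntegral`, `UnitProfile.eq_model_of_curv_neg`).

If the profile is not defined on the whole line, completeness forces it to end at a pole
(`IsComplete.mem_of_segment`). There the first integral tends to `0`, so it vanishes; then the two
principal curvatures agree, and the surface is a sphere (`isRoundSphere_of_ne_univ`).
-/

/-! ### The height and the tangent direction as functions of the curvature angle -/

/-- The distance to the axis, at unit scale, as a function of the angle `u` for which the
principal curvatures are `-cos u` (parallels) and `-sin u` (profile). -/
noncomputable def unitHeight (u : ℝ) : ℝ := Real.exp (u / 2) / √(Real.sin u + Real.cos u)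

/-- The axial component of the unit tangent of the profile, at unit scale, as a function of the
curvature angle `u`. -/
noncomputable def unitAxial (u : ℝ) : ℝ := -(unitHeight u * Real.cos u)

/-- The interval of curvature angles; on it `sin u + cos u` is positive. -/
def angleRange : Set ℝ := Ioo (-(Real.pi / 4)) (3 * Real.pi / 4)

lemma sin_add_cos_eq (u : ℝ) : Real.sin u + Real.cos u = √2 * Real.sin (u + Real.pi / 4) := by
  rw [Real.sin_add, Real.cos_pi_div_four, Real.sin_pi_div_four]
  linear_combination (-(Real.sin u + Real.cos u) / 2) *
    Real.mul_self_sqrt (show (0 : ℝ) ≤ 2 by norm_num)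

lemma sin_add_cos_pos {u : ℝ} (hu : u ∈ angleRange) : 0 < Real.sin u + Real.cos u := by
  rw [sin_add_cos_eq]
  have := Real.sin_pos_of_pos_of_lt_pi (x := u + Real.pi / 4) (by linarith [hu.1])
    (by linarith [hu.2])
  positivity

lemma mem_angleRange_of_pos {u : ℝ} (h0 : 0 ≤ u) (hpi : u ≤ Real.pi)
    (h : 0 < Real.sin u + Real.cos u) : u ∈ angleRange := by
  refine ⟨by linarith [Real.pi_pos], ?_⟩
  by_contra! hu
  rw [sin_add_cos_eq] at h
  have h2 : 0 < Real.sin (u + Real.pi / 4) := by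
    by_contra! h3
    nlinarith [Real.sqrt_nonneg 2]
  have h3 : Real.sin (u + Real.pi / 4 - Real.pi) ≥ 0 :=
    Real.sin_nonneg_of_nonneg_of_le_pi (by linarith) (by linarith [Real.pi_pos])
  rw [Real.sin_sub_pi] at h3
  linarith

lemma unitHeight_pos {u : ℝ} (hu : u ∈ angleRange) : 0 < unitHeight u :=
  div_pos (Real.exp_pos _) (Real.sqrt_pos.2 (sin_add_cos_pos hu))

lemma unitHeight_sq {u : ℝ} (hu : u ∈ angleRange) :
    unitHeight u ^ 2 * (Real.sin u + Real.cos u) = Real.exp u := by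
  have h := sin_add_cos_pos hu
  rw [unitHeight, div_pow, Real.sq_sqrt h.le, ← Real.exp_nat_mul, div_mul_cancel₀ _ h.ne']
  congr 1
  push_cast
  ring

lemma hasDerivAt_unitHeight {u : ℝ} (hu : u ∈ angleRange) :
    HasDerivAt unitHeight (unitHeight u * Real.sin u / (Real.sin u + Real.cos u)) u := by
  have h := sin_add_cos_pos hu
  have h1 : HasDerivAt (fun u => Real.exp (u / 2)) (Real.exp (u / 2) * (1 / 2)) u :=
    ((hasDerivAt_id u).div_const 2).exp
  have h2 := ((Real.hasDerivAt_sin u).add (Real.hasDerivAt_cos u)).sqrt h.ne'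
  have h3 := h1.div h2 (Real.sqrt_pos.2 h).ne'
  refine h3.congr_deriv ?_
  simp only [Pi.add_apply]
  rw [unitHeight]
  have h4 := Real.sq_sqrt h.le
  have h5 := (Real.sqrt_pos.2 h).ne'
  set r := √(Real.sin u + Real.cos u)
  rw [← h4]
  field_simp
  rw [h4]; ring

lemma hasDerivAt_unitAxial {u : ℝ} (hu : u ∈ angleRange) :
    HasDerivAt unitAxial (unitHeight u * Real.sin u ^ 2 / (Real.sin u + Real.cos u)) u := by
  have h := sin_add_cos_pos hu
  refine ((hasDerivAt_unitHeight hu).mul (Real.hasDerivAt_cos u)).neg.congr_deriv ?_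
  field_simp
  ring

lemma unitHeight_zero : unitHeight 0 = 1 := by simp [unitHeight]

lemma unitAxial_zero : unitAxial 0 = -1 := by simp [unitAxial, unitHeight_zero]

lemma zero_mem_angleRange : (0 : ℝ) ∈ angleRange :=
  ⟨by linarith [Real.pi_pos], by linarith [Real.pi_pos]⟩

lemma continuousOn_unitAxial : ContinuousOn unitAxial angleRange := fun _ hu =>
  (hasDerivAt_unitAxial hu).continuousAt.continuousWithinAt

lemma continuousOn_unitHeight : ContinuousOn unitHeight angleRange := fun _ hu =>
  (hasDerivAt_unitHeight hu).continuousAt.continuousWithinAt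

lemma strictMonoOn_unitHeight : StrictMonoOn unitHeight (Ico 0 (3 * Real.pi / 4)) := by
  have hsub : Ico 0 (3 * Real.pi / 4) ⊆ angleRange := fun u hu =>
    ⟨by linarith [Real.pi_pos, hu.1], hu.2⟩
  refine strictMonoOn_of_deriv_pos (convex_Ico _ _) (continuousOn_unitHeight.mono hsub) ?_
  intro u hu
  rw [interior_Ico] at hu
  have hu' := hsub (Ioo_subset_Ico_self hu)
  rw [(hasDerivAt_unitHeight hu').deriv]
  have := Real.sin_pos_of_pos_of_lt_pi hu.1 (by linarith [hu.2, Real.pi_pos])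
  exact div_pos (mul_pos (unitHeight_pos hu') this) (sin_add_cos_pos hu')

/-- The derivative of `unitAxial` vanishes only at `0`, so that strict monotonicity follows by
treating the two sides of `0` separately. -/
lemma strictMonoOn_unitAxial : StrictMonoOn unitAxial angleRange := by
  have key : ∀ u ∈ angleRange, u ≠ 0 → 0 < deriv unitAxial u := by
    intro u hu h0
    rw [(hasDerivAt_unitAxial hu).deriv]
    have hs : Real.sin u ≠ 0 := by
      intro h
      rcases lt_or_gt_of_ne h0 with h1 | h1
      · have := Real.sin_neg_of_neg_of_neg_pi_lt h1 (by linarith [hu.1, Real.pi_pos])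
        linarith
      · have := Real.sin_pos_of_pos_of_lt_pi h1 (by linarith [hu.2, Real.pi_pos])
        linarith
    have := unitHeight_pos hu
    have := sin_add_cos_pos hu
    positivity
  have hpi := Real.pi_pos
  have h1 : StrictMonoOn unitAxial (Ioc (-(Real.pi / 4)) 0) := by
    refine strictMonoOn_of_deriv_pos (convex_Ioc _ _)
      (continuousOn_unitAxial.mono fun u hu => ⟨hu.1, by linarith [hu.2]⟩) ?_
    intro u hu
    rw [interior_Ioc] at hu
    exact key u ⟨hu.1, by linarith [hu.2]⟩ hu.2.ne
  have h2 : StrictMonoOn unitAxial (Ico 0 (3 * Real.pi / 4)) := by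
    refine strictMonoOn_of_deriv_pos (convex_Ico _ _)
      (continuousOn_unitAxial.mono fun u hu => ⟨by linarith [hu.1], hu.2⟩) ?_
    intro u hu
    rw [interior_Ico] at hu
    exact key u ⟨by linarith [hu.1], hu.2⟩ hu.1.ne'
  have h3 := h1.union h2 (isGreatest_Ioc (by linarith)) (isLeast_Ico (by linarith))
  rwa [Ioc_union_Ico_eq_Ioo (by linarith) (by linarith)] at h3

lemma tendsto_unitHeight_right :
    Tendsto unitHeight (𝓝[<] (3 * Real.pi / 4)) atTop := by
  have h1 : Tendsto (fun u => √(Real.sin u + Real.cos u)) (𝓝[<] (3 * Real.pi / 4)) (𝓝[>] 0) := by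
    refine tendsto_nhdsWithin_iff.2 ⟨?_, ?_⟩
    · have : Tendsto (fun u => √(Real.sin u + Real.cos u)) (𝓝 (3 * Real.pi / 4))
          (𝓝 (√(Real.sin (3 * Real.pi / 4) + Real.cos (3 * Real.pi / 4)))) :=
        (Real.continuous_sin.add Real.continuous_cos).sqrt.tendsto _
      rw [sin_add_cos_eq, show 3 * Real.pi / 4 + Real.pi / 4 = Real.pi by ring,
        Real.sin_pi, mul_zero, Real.sqrt_zero] at this
      exact this.mono_left nhdsWithin_le_nhds
    · filter_upwards [Ioo_mem_nhdsLT (show -(Real.pi / 4) < 3 * Real.pi / 4 by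
        linarith [Real.pi_pos])] with u hu
      exact Real.sqrt_pos.2 (sin_add_cos_pos hu)
  have h2 : Tendsto (fun u : ℝ => Real.exp (u / 2)) (𝓝[<] (3 * Real.pi / 4))
      (𝓝 (Real.exp (3 * Real.pi / 4 / 2))) :=
    ((by fun_prop : Continuous fun u : ℝ => Real.exp (u / 2)).tendsto _).mono_left
      nhdsWithin_le_nhds
  have := h2.pos_mul_atTop (Real.exp_pos _) h1.inv_tendsto_nhdsGT_zero
  exact this.congr fun u => rfl

lemma tendsto_unitHeight_left :
    Tendsto unitHeight (𝓝[>] (-(Real.pi / 4))) atTop := by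
  have h1 : Tendsto (fun u => √(Real.sin u + Real.cos u)) (𝓝[>] (-(Real.pi / 4))) (𝓝[>] 0) := by
    refine tendsto_nhdsWithin_iff.2 ⟨?_, ?_⟩
    · have : Tendsto (fun u => √(Real.sin u + Real.cos u)) (𝓝 (-(Real.pi / 4)))
          (𝓝 (√(Real.sin (-(Real.pi / 4)) + Real.cos (-(Real.pi / 4))))) :=
        (Real.continuous_sin.add Real.continuous_cos).sqrt.tendsto _
      rw [sin_add_cos_eq, neg_add_cancel, Real.sin_zero, mul_zero, Real.sqrt_zero] at this
      exact this.mono_left nhdsWithin_le_nhds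
    · filter_upwards [Ioo_mem_nhdsGT (show -(Real.pi / 4) < 3 * Real.pi / 4 by
        linarith [Real.pi_pos])] with u hu
      exact Real.sqrt_pos.2 (sin_add_cos_pos hu)
  have h2 : Tendsto (fun u : ℝ => Real.exp (u / 2)) (𝓝[>] (-(Real.pi / 4)))
      (𝓝 (Real.exp (-(Real.pi / 4) / 2))) :=
    ((by fun_prop : Continuous fun u : ℝ => Real.exp (u / 2)).tendsto _).mono_left
      nhdsWithin_le_nhds
  have := h2.pos_mul_atTop (Real.exp_pos _) h1.inv_tendsto_nhdsGT_zero
  exact this.congr fun u => rfl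

lemma tendsto_unitAxial_right :
    Tendsto unitAxial (𝓝[<] (3 * Real.pi / 4)) atTop := by
  have h2 : Tendsto (fun u : ℝ => -Real.cos u) (𝓝[<] (3 * Real.pi / 4))
      (𝓝 (-Real.cos (3 * Real.pi / 4))) :=
    (Real.continuous_cos.neg.tendsto _).mono_left nhdsWithin_le_nhds
  have h3 : 0 < -Real.cos (3 * Real.pi / 4) := by
    rw [show 3 * Real.pi / 4 = Real.pi - Real.pi / 4 by ring, Real.cos_pi_sub,
      Real.cos_pi_div_four]
    simp
  exact (tendsto_unitHeight_right.atTop_mul_pos h3 h2).congr fun u => by rw [unitAxial]; ring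

lemma tendsto_unitAxial_left :
    Tendsto unitAxial (𝓝[>] (-(Real.pi / 4))) atBot := by
  have h2 : Tendsto (fun u : ℝ => -Real.cos u) (𝓝[>] (-(Real.pi / 4)))
      (𝓝 (-Real.cos (-(Real.pi / 4)))) :=
    (Real.continuous_cos.neg.tendsto _).mono_left nhdsWithin_le_nhds
  have h3 : -Real.cos (-(Real.pi / 4)) < 0 := by
    rw [Real.cos_neg, Real.cos_pi_div_four]
    simp
  exact (tendsto_unitHeight_left.atTop_mul_neg h3 h2).congr fun u => by rw [unitAxial]; ring

lemma exists_unitAxial_eq (y : ℝ) : ∃ u ∈ angleRange, unitAxial u = y := by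
  have hlt : -(Real.pi / 4) < 3 * Real.pi / 4 := by linarith [Real.pi_pos]
  obtain ⟨p, hp, hpy⟩ := ((tendsto_unitAxial_left.eventually_le_atBot y).and
    (Ioo_mem_nhdsGT hlt)).exists
  obtain ⟨q, hq, hqy⟩ := ((tendsto_unitAxial_right.eventually_ge_atTop y).and
    (Ioo_mem_nhdsLT hlt)).exists
  have hconv : uIcc p q ⊆ angleRange := ordConnected_Ioo.uIcc_subset hpy hqy
  obtain ⟨u, hu, huy⟩ := intermediate_value_uIcc (continuousOn_unitAxial.mono hconv)
    (show y ∈ uIcc (unitAxial p) (unitAxial q) from ⟨inf_le_left.trans hp, hq.trans le_sup_right⟩)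
  exact ⟨u, hconv hu, huy⟩

/-- The curvature angle as a function of the axial component of the unit tangent, at unit scale:
the inverse function of `unitAxial` on `angleRange`. -/
noncomputable def unitAngle (y : ℝ) : ℝ := (exists_unitAxial_eq y).choose

lemma unitAngle_mem (y : ℝ) : unitAngle y ∈ angleRange := (exists_unitAxial_eq y).choose_spec.1

lemma unitAxial_unitAngle (y : ℝ) : unitAxial (unitAngle y) = y :=
  (exists_unitAxial_eq y).choose_spec.2

lemma unitAngle_unitAxial {u : ℝ} (hu : u ∈ angleRange) : unitAngle (unitAxial u) = u :=
  strictMonoOn_unitAxial.injOn (unitAngle_mem _) hu (unitAxial_unitAngle _)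

lemma strictMono_unitAngle : StrictMono unitAngle := fun y y' h => by
  rw [← strictMonoOn_unitAxial.lt_iff_lt (unitAngle_mem _) (unitAngle_mem _)]
  simpa only [unitAxial_unitAngle] using h

lemma continuous_unitAngle : Continuous unitAngle := by
  refine continuous_iff_continuousAt.2 fun y => ?_
  refine continuousAt_of_monotoneOn_of_image_mem_nhds
    (strictMono_unitAngle.monotone.monotoneOn univ) univ_mem ?_
  · have : unitAngle '' univ = angleRange := by
      ext u
      simp only [image_univ, mem_range]
      exact ⟨fun ⟨y, hy⟩ => hy ▸ unitAngle_mem y, fun hu => ⟨_, unitAngle_unitAxial hu⟩⟩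
    rw [this]
    exact isOpen_Ioo.mem_nhds (unitAngle_mem y)

lemma unitAngle_neg_one : unitAngle (-1) = 0 := by
  rw [← unitAxial_zero, unitAngle_unitAxial zero_mem_angleRange]

lemma unitAngle_nonneg {y : ℝ} (hy : -1 ≤ y) : 0 ≤ unitAngle y := by
  rw [← unitAngle_neg_one]; exact strictMono_unitAngle.monotone hy

lemma unitAngle_pos {y : ℝ} (hy : -1 < y) : 0 < unitAngle y := by
  rw [← unitAngle_neg_one]; exact strictMono_unitAngle hy

lemma sin_unitAngle_pos {y : ℝ} (hy : -1 < y) : 0 < Real.sin (unitAngle y) :=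
  Real.sin_pos_of_pos_of_lt_pi (unitAngle_pos hy)
    (by linarith [(unitAngle_mem y).2, Real.pi_pos])

lemma sin_unitAngle_nonneg {y : ℝ} (hy : -1 ≤ y) : 0 ≤ Real.sin (unitAngle y) :=
  Real.sin_nonneg_of_nonneg_of_le_pi (unitAngle_nonneg hy)
    (by linarith [(unitAngle_mem y).2, Real.pi_pos])

lemma sin_unitAngle_pos_iff {y : ℝ} : 0 < Real.sin (unitAngle y) ↔ -1 < y := by
  refine ⟨fun h => ?_, sin_unitAngle_pos⟩
  by_contra! hy
  have h1 : unitAngle y ≤ 0 := by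
    rw [← unitAngle_neg_one]; exact strictMono_unitAngle.monotone hy
  have := Real.sin_nonpos_of_nonpos_of_neg_pi_le h1
    (by linarith [(unitAngle_mem y).1, Real.pi_pos])
  linarith

lemma hasDerivAt_unitAngle {y : ℝ} (hy : -1 < y) :
    HasDerivAt unitAngle (unitHeight (unitAngle y) * Real.sin (unitAngle y) ^ 2 /
      (Real.sin (unitAngle y) + Real.cos (unitAngle y)))⁻¹ y := by
  have hm := unitAngle_mem y
  have h1 := unitHeight_pos hm
  have h2 := sin_add_cos_pos hm
  have h3 := sin_unitAngle_pos hy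
  exact HasDerivAt.of_local_left_inverse continuous_unitAngle.continuousAt
    (hasDerivAt_unitAxial hm) (by positivity) (Eventually.of_forall unitAxial_unitAngle)

/-- Along a profile the height `z` depends on the axial component `c` of the tangent through
`dz/dc = 1 / sin u`. -/
lemma hasDerivAt_unitHeight_unitAngle {y : ℝ} (hy : -1 < y) :
    HasDerivAt (fun y => unitHeight (unitAngle y)) (Real.sin (unitAngle y))⁻¹ y := by
  have hm := unitAngle_mem y
  have h1 := unitHeight_pos hm
  have h2 := sin_add_cos_pos hm
  have h3 := sin_unitAngle_pos hy
  refine ((hasDerivAt_unitHeight hm).comp y (hasDerivAt_unitAngle hy)).congr_deriv ?_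
  field_simp

lemma unitHeight_mul_cos (y : ℝ) : unitHeight (unitAngle y) * Real.cos (unitAngle y) = -y := by
  have := unitAxial_unitAngle y
  rw [unitAxial] at this
  linarith

lemma strictMonoOn_unitHeight_unitAngle :
    StrictMonoOn (fun y => unitHeight (unitAngle y)) (Ici (-1)) := fun _ hy _ hy' h =>
  strictMonoOn_unitHeight ⟨unitAngle_nonneg hy, (unitAngle_mem _).2⟩
    ⟨unitAngle_nonneg hy', (unitAngle_mem _).2⟩ (strictMono_unitAngle h)

lemma continuous_unitHeight_unitAngle : Continuous fun y => unitHeight (unitAngle y) :=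
  continuousOn_unitHeight.comp_continuous continuous_unitAngle unitAngle_mem

lemma one_le_unitHeight_unitAngle {y : ℝ} (hy : -1 ≤ y) : 1 ≤ unitHeight (unitAngle y) := by
  have := strictMonoOn_unitHeight_unitAngle.monotoneOn (mem_Ici.2 le_rfl) (mem_Ici.2 hy) hy
  simpa [unitAngle_neg_one, unitHeight_zero] using this

/-- The contact of the profile of scale `1` with the cylinder: the axial component `y` of the
tangent tends to `-1` as the cube of the curvature. -/
lemma one_add_le_sin_unitAngle_pow {y : ℝ} (h1 : -1 ≤ y) (h2 : y ≤ 1) :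
    1 + y ≤ 6 * Real.sin (unitAngle y) ^ 3 := by
  set u := unitAngle y with hu
  have hm : u ∈ angleRange := unitAngle_mem y
  have h0 : 0 ≤ u := unitAngle_nonneg h1
  have hpi := Real.pi_pos
  have hs2 : √2 ^ 2 = 2 := Real.sq_sqrt (by norm_num)
  have hs3 : (1.4 : ℝ) ≤ √2 := Real.le_sqrt_of_sq_le (by norm_num)
  rcases le_or_gt u (Real.pi / 4) with h | h
  · -- compare the derivatives of both sides on `[0, π / 4]`
    have hsub : Icc 0 (Real.pi / 4) ⊆ angleRange := fun v hv =>
      ⟨by linarith [hv.1], by linarith [hv.2]⟩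
    have hmono : MonotoneOn (fun v => 6 * Real.sin v ^ 3 - unitAxial v) (Icc 0 (Real.pi / 4)) := by
      refine monotoneOn_of_deriv_nonneg (convex_Icc _ _)
        ((by fun_prop : Continuous fun v => 6 * Real.sin v ^ 3).continuousOn.sub
          (continuousOn_unitAxial.mono hsub)) ?_ ?_
      · intro v hv
        rw [interior_Icc] at hv
        exact (((by fun_prop : Differentiable ℝ fun v => 6 * Real.sin v ^ 3) v).sub
          (hasDerivAt_unitAxial (hsub (Ioo_subset_Icc_self hv))).differentiableAt
          ).differentiableWithinAt
      · intro v hv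
        rw [interior_Icc] at hv
        have hv' := hsub (Ioo_subset_Icc_self hv)
        have hd := (((Real.hasDerivAt_sin v).pow 3).const_mul 6).sub (hasDerivAt_unitAxial hv')
        have he : deriv (fun v => 6 * Real.sin v ^ 3 - unitAxial v) v = _ := hd.deriv
        rw [he]
        have hsn : 0 ≤ Real.sin v := Real.sin_nonneg_of_nonneg_of_le_pi hv.1.le
          (by linarith [hv.2])
        have hcs : √2 / 2 ≤ Real.cos v := by
          rw [← Real.cos_pi_div_four]
          exact Real.cos_le_cos_of_nonneg_of_le_pi hv.1.le (by linarith) hv.2.le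
        have hD : 1 ≤ Real.sin v + Real.cos v := by
          nlinarith [Real.sin_sq_add_cos_sq v]
        have he : Real.exp (v / 2) ≤ 3 := by
          refine (Real.exp_le_exp.2 (show v / 2 ≤ 1 by
            linarith [hv.2, Real.pi_le_four])).trans ?_
          linarith [Real.exp_one_lt_d9]
        have hn : unitHeight v ≤ 3 := by
          rw [unitHeight]
          exact (div_le_self (Real.exp_pos _).le (Real.one_le_sqrt.2 hD)).trans he
        have hq : unitHeight v * Real.sin v ^ 2 / (Real.sin v + Real.cos v)
            ≤ 3 * Real.sin v ^ 2 :=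
          (div_le_self (mul_nonneg (unitHeight_pos hv').le (sq_nonneg _)) hD).trans
            (mul_le_mul_of_nonneg_right hn (sq_nonneg _))
        have hq2 : 6 * (3 * Real.sin v ^ 2 * Real.cos v) ≥ 3 * Real.sin v ^ 2 := by
          nlinarith [sq_nonneg (Real.sin v)]
        simp only [Nat.cast_ofNat, Nat.add_one_sub_one]
        norm_num
        linarith
    have := hmono (left_mem_Icc.2 (by linarith)) ⟨h0, h⟩ h0
    simp only [Real.sin_zero, unitAxial_zero] at this
    have hy : unitAxial u = y := unitAxial_unitAngle y
    rw [hy] at this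
    norm_num at this
    linarith
  · have hs : √2 / 2 ≤ Real.sin u := by
      rcases le_total u (Real.pi / 2) with h3 | h3
      · rw [← Real.sin_pi_div_four]
        exact Real.sin_le_sin_of_le_of_le_pi_div_two (by linarith) h3 h.le
      · rw [← Real.sin_pi_sub, ← Real.sin_pi_div_four]
        exact Real.sin_le_sin_of_le_of_le_pi_div_two (by linarith) (by linarith)
          (by linarith [hm.2])
    have h4 : (0.7 : ℝ) ≤ Real.sin u := by linarith
    have : (0.7 : ℝ) ^ 3 ≤ Real.sin u ^ 3 := pow_le_pow_left₀ (by norm_num) h4 3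
    norm_num at this
    linarith

/-! ### The rotating profiles of scale `a ≥ 1` -/

lemma sin_unitAngle_neg_lt {y : ℝ} (h0 : 0 < y) (h1 : y ≤ 1) :
    Real.sin (unitAngle (-y)) < Real.sin (unitAngle y) := by
  have hlt := strictMonoOn_unitHeight_unitAngle (a := -y) (b := y) (by simpa using h1)
    (by simp; linarith) (by linarith)
  simp only at hlt
  have e1 := unitHeight_mul_cos y
  have e2 := unitHeight_mul_cos (-y)
  have p2 := one_le_unitHeight_unitAngle (y := -y) (by linarith)
  have s1 := sin_unitAngle_nonneg (y := y) (by linarith)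
  have s2 := Real.sin_sq_add_cos_sq (unitAngle y)
  have s3 := Real.sin_sq_add_cos_sq (unitAngle (-y))
  set h := unitHeight (unitAngle y)
  set h' := unitHeight (unitAngle (-y))
  have c1 : -Real.cos (unitAngle y) = y / h := by
    rw [eq_div_iff (by linarith)]; linarith
  have c2 : Real.cos (unitAngle (-y)) = y / h' := by
    rw [eq_div_iff (by linarith)]; linarith
  have hq : y / h < y / h' := by
    apply div_lt_div_of_pos_left h0 (by linarith) hlt
  have hq0 : 0 < y / h := div_pos h0 (by linarith)
  refine lt_of_pow_lt_pow_left₀ 2 s1 ?_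
  nlinarith

/-- The rate at which the tangent of the profile of scale `a` turns, as a function of the angle
`σ` between the tangent and the axis. -/
noncomputable def angularSpeed (a σ : ℝ) : ℝ := Real.sin (unitAngle (Real.cos σ / a))

lemma continuous_angularSpeed (a : ℝ) : Continuous (angularSpeed a) :=
  Real.continuous_sin.comp (continuous_unitAngle.comp (Real.continuous_cos.div_const a))

lemma neg_one_le_cos_div {a : ℝ} (ha : 1 ≤ a) (σ : ℝ) : -1 ≤ Real.cos σ / a := by
  rw [le_div_iff₀ (by linarith)]
  linarith [Real.neg_one_le_cos σ]

lemma cos_div_le_one {a : ℝ} (ha : 1 ≤ a) (σ : ℝ) : Real.cos σ / a ≤ 1 := by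
  rw [div_le_iff₀ (by linarith)]
  linarith [Real.cos_le_one σ]

lemma angularSpeed_nonneg {a : ℝ} (ha : 1 ≤ a) (σ : ℝ) : 0 ≤ angularSpeed a σ :=
  sin_unitAngle_nonneg (neg_one_le_cos_div ha σ)

lemma angularSpeed_pos_iff {a : ℝ} (ha : 0 < a) {σ : ℝ} :
    0 < angularSpeed a σ ↔ -a < Real.cos σ := by
  rw [angularSpeed, sin_unitAngle_pos_iff, lt_div_iff₀ ha, neg_one_mul]

lemma angularSpeed_le_one (a σ : ℝ) : angularSpeed a σ ≤ 1 := Real.sin_le_one _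

lemma angularSpeed_neg (a σ : ℝ) : angularSpeed a (-σ) = angularSpeed a σ := by
  rw [angularSpeed, Real.cos_neg, angularSpeed]

lemma angularSpeed_periodic (a : ℝ) : Function.Periodic (angularSpeed a) (2 * Real.pi) :=
  fun σ => by rw [angularSpeed, Real.cos_add_two_pi, angularSpeed]

lemma angularSpeed_pos_of_one_lt {a : ℝ} (ha : 1 < a) (σ : ℝ) : 0 < angularSpeed a σ :=
  (angularSpeed_pos_iff (by linarith)).2 (by linarith [Real.neg_one_le_cos σ])

lemma angularSpeed_pos_of_abs_lt {a σ : ℝ} (ha : 1 ≤ a) (hσ : |σ| < Real.pi) :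
    0 < angularSpeed a σ := by
  refine (angularSpeed_pos_iff (by linarith)).2 ?_
  have : -1 < Real.cos σ := by
    rw [← Real.cos_abs, ← Real.cos_pi]
    exact Real.cos_lt_cos_of_nonneg_of_le_pi (abs_nonneg _) le_rfl hσ
  linarith

/-- The tangent of the profile of scale `1` takes a finite time to turn into the direction of the
cylinder, because the angular speed vanishes there only to the order `2 / 3`. -/
lemma intervalIntegrable_inv_angularSpeed {a : ℝ} (ha : 1 ≤ a) (p q : ℝ) :
    IntervalIntegrable (fun σ => (angularSpeed a σ)⁻¹) MeasureTheory.volume p q := by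
  rcases eq_or_lt_of_le ha with rfl | ha
  · refine Function.Periodic.intervalIntegrable (T := 2 * Real.pi) (t := 0) ?_
      (by positivity) ?_ p q
    · intro σ
      simp only [angularSpeed_periodic 1 σ]
    have hdom : IntervalIntegrable (fun σ : ℝ => 4 * |σ - Real.pi| ^ (-(2 / 3) : ℝ))
        MeasureTheory.volume 0 (0 + 2 * Real.pi) := by
      refine IntervalIntegrable.const_mul ?_ _
      have h0 : IntervalIntegrable (fun σ : ℝ => |σ| ^ (-(2 / 3) : ℝ)) MeasureTheory.volume
          (-Real.pi) Real.pi := by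
        have hr : ∀ c : ℝ, 0 ≤ c → IntervalIntegrable (fun σ : ℝ => |σ| ^ (-(2 / 3) : ℝ))
            MeasureTheory.volume 0 c := by
          intro c hc
          refine (intervalIntegral.intervalIntegrable_rpow' (r := -(2 / 3))
            (by norm_num)).congr ?_
          intro σ hσ
          rw [uIoc_of_le hc] at hσ
          simp only [abs_of_pos hσ.1]
        have h2 := hr Real.pi Real.pi_pos.le
        have h3 := (hr Real.pi Real.pi_pos.le).comp_sub_left 0
        simp only [zero_sub, abs_neg, neg_zero] at h3
        exact h3.symm.trans h2
      have := h0.comp_sub_right Real.pi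
      convert this using 1 <;> ring
    refine hdom.mono_fun ?_ ?_
    · exact (continuous_angularSpeed 1).measurable.inv.aestronglyMeasurable
    · refine (MeasureTheory.ae_restrict_iff' measurableSet_uIoc).2 (Eventually.of_forall ?_)
      intro σ hσ
      rw [uIoc_of_le (by linarith [Real.pi_pos])] at hσ
      have hf0 := angularSpeed_nonneg le_rfl σ
      beta_reduce
      rw [Real.norm_of_nonneg (inv_nonneg.2 hf0), Real.norm_of_nonneg (by positivity)]
      rcases eq_or_lt_of_le hf0 with h | hf
      · rw [← h, inv_zero]; positivity
      have hne : σ ≠ Real.pi := by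
        rintro rfl
        have := (angularSpeed_pos_iff one_pos).1 hf
        simp at this
      have hd : 0 < |σ - Real.pi| := abs_pos.2 (sub_ne_zero.2 hne)
      have hb := one_add_le_sin_unitAngle_pow (Real.neg_one_le_cos σ) (Real.cos_le_one σ)
      have hc := Real.cos_le_one_sub_mul_cos_sq (x := σ - Real.pi)
        (by rw [abs_le]; constructor <;> linarith [hσ.1, hσ.2])
      rw [Real.cos_sub_pi] at hc
      have hf' : angularSpeed 1 σ = Real.sin (unitAngle (Real.cos σ)) := by
        rw [angularSpeed, div_one]
      rw [← hf'] at hb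
      have hpi2 : Real.pi ^ 2 ≤ 10 := by nlinarith [Real.pi_lt_d2, Real.pi_gt_three]
      have hk : 1 / 5 ≤ 2 / Real.pi ^ 2 := by
        rw [div_le_div_iff₀ (by norm_num) (by positivity)]; linarith
      have hcube : |σ - Real.pi| ^ 2 ≤ 64 * angularSpeed 1 σ ^ 3 := by
        rw [sq_abs]
        have := mul_le_mul_of_nonneg_right hk (sq_nonneg (σ - Real.pi))
        nlinarith [pow_pos hf 3]
      -- take cube roots
      have hroot : |σ - Real.pi| ^ (2 / 3 : ℝ) ≤ 4 * angularSpeed 1 σ := by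
        have h1 : (|σ - Real.pi| ^ 2) ^ (1 / 3 : ℝ) ≤ ((4 * angularSpeed 1 σ) ^ 3) ^ (1 / 3 : ℝ) :=
          Real.rpow_le_rpow (by positivity) (by rw [mul_pow]; linarith) (by norm_num)
        rw [← Real.rpow_natCast, ← Real.rpow_natCast, ← Real.rpow_mul hd.le,
          ← Real.rpow_mul (by positivity)] at h1
        norm_num at h1
        exact h1
      rw [Real.rpow_neg hd.le, inv_eq_one_div, ← div_eq_mul_inv,
        div_le_div_iff₀ hf (by positivity)]
      linarith
  · refine Continuous.intervalIntegrable ?_ _ _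
    exact (continuous_angularSpeed a).inv₀ fun σ => (angularSpeed_pos_of_one_lt ha σ).ne'

/-- The arc length of the profile of scale `a` as a function of the angle between its tangent and
the axis. -/
noncomputable def arcTime (a σ : ℝ) : ℝ := ∫ s in (0 : ℝ)..σ, (angularSpeed a s)⁻¹

lemma arcTime_zero (a : ℝ) : arcTime a 0 = 0 := intervalIntegral.integral_same

lemma continuous_arcTime {a : ℝ} (ha : 1 ≤ a) : Continuous (arcTime a) :=
  intervalIntegral.continuous_primitive (intervalIntegrable_inv_angularSpeed ha) 0

lemma arcTime_neg (a σ : ℝ) : arcTime a (-σ) = -arcTime a σ := by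
  have h := intervalIntegral.integral_comp_neg (a := 0) (b := σ)
    (fun s => (angularSpeed a s)⁻¹)
  simp only [angularSpeed_neg, neg_zero] at h
  rw [arcTime, arcTime, h, intervalIntegral.integral_symm]

lemma hasDerivAt_arcTime {a σ : ℝ} (ha : 1 ≤ a) (h : 0 < angularSpeed a σ) :
    HasDerivAt (arcTime a) (angularSpeed a σ)⁻¹ σ := by
  refine intervalIntegral.integral_hasDerivAt_right (intervalIntegrable_inv_angularSpeed ha _ _)
    ?_ ((continuous_angularSpeed a).continuousAt.inv₀ h.ne')
  exact ((continuous_angularSpeed a).measurable.inv.stronglyMeasurable).stronglyMeasurableAtFilter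

lemma ae_angularSpeed_pos {a : ℝ} (ha : 1 ≤ a) :
    ∀ᵐ σ : ℝ, 0 < angularSpeed a σ := by
  have hc : (range fun k : ℤ => Real.pi + k * (2 * Real.pi)).Countable := countable_range _
  filter_upwards [hc.ae_notMem MeasureTheory.volume] with σ hσ
  refine (angularSpeed_pos_iff (by linarith)).2 ?_
  rcases (Real.neg_one_le_cos σ).lt_or_eq with h | h
  · linarith
  · exact absurd (Real.cos_eq_neg_one_iff.1 h.symm) hσ

lemma sub_le_arcTime_sub {a σ σ' : ℝ} (ha : 1 ≤ a) (h : σ ≤ σ') :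
    σ' - σ ≤ arcTime a σ' - arcTime a σ := by
  have hint := intervalIntegrable_inv_angularSpeed ha
  rw [arcTime, arcTime, intervalIntegral.integral_interval_sub_left (hint _ _) (hint _ _)]
  have h1 : ∫ _ in σ..σ', (1 : ℝ) = σ' - σ := by simp
  rw [← h1]
  refine intervalIntegral.integral_mono_ae h (by simp) (hint _ _) ?_
  filter_upwards [ae_angularSpeed_pos ha] with s hs
  exact (one_le_inv₀ hs).2 (angularSpeed_le_one a s)

lemma strictMono_arcTime {a : ℝ} (ha : 1 ≤ a) : StrictMono (arcTime a) := fun σ σ' h => by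
  linarith [sub_le_arcTime_sub ha h.le]

lemma surjective_arcTime {a : ℝ} (ha : 1 ≤ a) : Function.Surjective (arcTime a) := by
  refine (continuous_arcTime ha).surjective ?_ ?_
  · refine tendsto_atTop_mono' _ ?_ tendsto_id
    filter_upwards [eventually_ge_atTop 0] with σ hσ
    simpa [arcTime_zero] using sub_le_arcTime_sub ha hσ
  · refine tendsto_atBot_mono' _ ?_ tendsto_id
    filter_upwards [eventually_le_atBot 0] with σ hσ
    simpa [arcTime_zero] using sub_le_arcTime_sub ha hσ

/-- The angle between the axis and the tangent of the profile of scale `a`, as a function of the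
arc length `t`: the inverse function of `arcTime a`. The tangent is
`(cos (tangentAngle a t), -sin (tangentAngle a t))`. -/
noncomputable def tangentAngle (a : ℝ) : ℝ → ℝ := Function.invFun (arcTime a)

lemma arcTime_tangentAngle {a : ℝ} (ha : 1 ≤ a) (t : ℝ) : arcTime a (tangentAngle a t) = t :=
  Function.rightInverse_invFun (surjective_arcTime ha) t

lemma tangentAngle_arcTime {a : ℝ} (ha : 1 ≤ a) (σ : ℝ) : tangentAngle a (arcTime a σ) = σ :=
  Function.leftInverse_invFun (strictMono_arcTime ha).injective σ

lemma strictMono_tangentAngle {a : ℝ} (ha : 1 ≤ a) : StrictMono (tangentAngle a) :=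
  fun t t' h => by
    rw [← (strictMono_arcTime ha).lt_iff_lt, arcTime_tangentAngle ha, arcTime_tangentAngle ha]
    exact h

lemma continuous_tangentAngle {a : ℝ} (ha : 1 ≤ a) : Continuous (tangentAngle a) :=
  (strictMono_tangentAngle ha).monotone.continuous_of_surjective
    fun σ => ⟨_, tangentAngle_arcTime ha σ⟩

lemma tangentAngle_zero {a : ℝ} (ha : 1 ≤ a) : tangentAngle a 0 = 0 := by
  conv_lhs => rw [← arcTime_zero a]
  rw [tangentAngle_arcTime ha]

lemma tangentAngle_neg {a : ℝ} (ha : 1 ≤ a) (t : ℝ) :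
    tangentAngle a (-t) = -tangentAngle a t := by
  rw [← (strictMono_arcTime ha).injective.eq_iff, arcTime_neg, arcTime_tangentAngle ha,
    arcTime_tangentAngle ha]

/-- A function that is continuous at `x` and has derivative `g` at all points near `x` but
different from `x` has derivative `g x` at `x`, if `g` is continuous at `x`. -/
lemma hasDerivAt_of_eventually_ne {f g : ℝ → ℝ} {x : ℝ}
    (h : ∀ᶠ y in 𝓝[≠] x, HasDerivAt f (g y) y) (hf : ContinuousAt f x) (hg : ContinuousAt g x) :
    HasDerivAt f (g x) x := by
  rw [← nhdsLT_sup_nhdsGT, eventually_sup] at h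
  have A : HasDerivWithinAt f (g x) (Ici x) x := by
    refine hasDerivWithinAt_Ici_of_tendsto_deriv (s := {y | HasDerivAt f (g y) y})
      (fun y hy => hy.differentiableAt.differentiableWithinAt) hf.continuousWithinAt h.2 ?_
    refine (hg.tendsto.mono_left nhdsWithin_le_nhds).congr' ?_
    filter_upwards [h.2] with y hy using hy.deriv.symm
  have B : HasDerivWithinAt f (g x) (Iic x) x := by
    refine hasDerivWithinAt_Iic_of_tendsto_deriv (s := {y | HasDerivAt f (g y) y})
      (fun y hy => hy.differentiableAt.differentiableWithinAt) hf.continuousWithinAt h.1 ?_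
    refine (hg.tendsto.mono_left nhdsWithin_le_nhds).congr' ?_
    filter_upwards [h.1] with y hy using hy.deriv.symm
  simpa using B.union A

/-- The directions in which the profile can touch the cylinder of radius `1` are isolated. -/
lemma eventually_angularSpeed_pos {a : ℝ} (ha : 1 ≤ a) (t : ℝ) :
    ∀ᶠ r in 𝓝[≠] t, 0 < angularSpeed a (tangentAngle a r) := by
  rcases (angularSpeed_nonneg ha (tangentAngle a t)).lt_or_eq with h | h
  · exact (((continuous_angularSpeed a).comp (continuous_tangentAngle ha)).continuousAt.eventually
      (lt_mem_nhds h)).filter_mono nhdsWithin_le_nhds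
  · have hcos : Real.cos (tangentAngle a t) = -1 := by
      by_contra hne
      have h1 := lt_of_le_of_ne (Real.neg_one_le_cos (tangentAngle a t)) (Ne.symm hne)
      exact h.not_lt ((angularSpeed_pos_iff (by linarith)).2 (by linarith))
    have hnear : ∀ᶠ r in 𝓝 t, |tangentAngle a r - tangentAngle a t| < 2 * Real.pi := by
      have hc : ContinuousAt (fun r => |tangentAngle a r - tangentAngle a t|) t :=
        ((continuous_tangentAngle ha).sub continuous_const).abs.continuousAt
      refine hc.eventually (gt_mem_nhds ?_)
      simp [Real.pi_pos]
    filter_upwards [hnear.filter_mono nhdsWithin_le_nhds, self_mem_nhdsWithin] with r hr hne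
    refine (angularSpeed_pos_iff (by linarith)).2 ?_
    refine lt_of_le_of_lt (b := -1) (by linarith) (lt_of_le_of_ne (Real.neg_one_le_cos _) ?_)
    intro h2
    have h3 : Real.cos (tangentAngle a r - tangentAngle a t) = 1 := by
      have h4 : Real.sin (tangentAngle a t) = 0 := by
        have := Real.sin_sq_add_cos_sq (tangentAngle a t)
        rw [hcos] at this
        nlinarith
      rw [Real.cos_sub, ← h2, hcos, h4]; norm_num
    have h5 := (Real.cos_eq_one_iff_of_lt_of_lt (abs_lt.1 hr).1 (abs_lt.1 hr).2).1 h3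
    exact hne ((strictMono_tangentAngle ha).injective (sub_eq_zero.1 h5))

lemma hasDerivAt_tangentAngle {a : ℝ} (ha : 1 ≤ a) (t : ℝ) :
    HasDerivAt (tangentAngle a) (angularSpeed a (tangentAngle a t)) t := by
  refine hasDerivAt_of_eventually_ne (g := fun t => angularSpeed a (tangentAngle a t)) ?_
    (continuous_tangentAngle ha).continuousAt
    ((continuous_angularSpeed a).comp (continuous_tangentAngle ha)).continuousAt
  filter_upwards [eventually_angularSpeed_pos ha t] with r hr
  have := HasDerivAt.of_local_left_inverse (continuous_tangentAngle ha).continuousAt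
    (hasDerivAt_arcTime ha hr) (inv_pos.2 hr).ne'
    (Eventually.of_forall (arcTime_tangentAngle ha))
  rwa [inv_inv] at this

/-- The distance to the axis of the profile of scale `a` at arc length `t`. -/
noncomputable def height (a t : ℝ) : ℝ :=
  a * unitHeight (unitAngle (Real.cos (tangentAngle a t) / a))

/-- The axial coordinate of the profile of scale `a` at arc length `t`. -/
noncomputable def axial (a t : ℝ) : ℝ := ∫ s in (0 : ℝ)..t, Real.cos (tangentAngle a s)

lemma continuous_height {a : ℝ} (ha : 1 ≤ a) : Continuous (height a) :=
  (continuous_unitHeight_unitAngle.comp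
    ((Real.continuous_cos.comp (continuous_tangentAngle ha)).div_const a)).const_mul a

lemma hasDerivAt_height {a : ℝ} (ha : 1 ≤ a) (t : ℝ) :
    HasDerivAt (height a) (-Real.sin (tangentAngle a t)) t := by
  refine hasDerivAt_of_eventually_ne (g := fun t => -Real.sin (tangentAngle a t)) ?_
    (continuous_height ha).continuousAt
    (Real.continuous_sin.comp (continuous_tangentAngle ha)).neg.continuousAt
  filter_upwards [eventually_angularSpeed_pos ha t] with r hr
  have ha0 : a ≠ 0 := by linarith
  have h1 : HasDerivAt (fun r => Real.cos (tangentAngle a r) / a) _ r :=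
    (hasDerivAt_tangentAngle ha r).cos.div_const a
  refine (((hasDerivAt_unitHeight_unitAngle (sin_unitAngle_pos_iff.1 hr)).comp r h1).const_mul
    a).congr_deriv ?_
  rw [angularSpeed] at hr ⊢
  field_simp

lemma hasDerivAt_axial {a : ℝ} (ha : 1 ≤ a) (t : ℝ) :
    HasDerivAt (axial a) (Real.cos (tangentAngle a t)) t := by
  have hc : Continuous fun s => Real.cos (tangentAngle a s) :=
    Real.continuous_cos.comp (continuous_tangentAngle ha)
  exact intervalIntegral.integral_hasDerivAt_right (hc.intervalIntegrable _ _)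
    hc.stronglyMeasurable.stronglyMeasurableAtFilter hc.continuousAt

lemma continuous_axial {a : ℝ} (ha : 1 ≤ a) : Continuous (axial a) :=
  continuous_iff_continuousAt.2 fun t => (hasDerivAt_axial ha t).continuousAt

lemma one_le_height {a : ℝ} (ha : 1 ≤ a) (t : ℝ) : 1 ≤ height a t := by
  have := one_le_unitHeight_unitAngle (neg_one_le_cos_div ha (tangentAngle a t))
  rw [height]
  nlinarith

lemma height_mul_cos {a : ℝ} (ha : 1 ≤ a) (t : ℝ) :
    height a t * Real.cos (unitAngle (Real.cos (tangentAngle a t) / a)) =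
      -Real.cos (tangentAngle a t) := by
  rw [height, mul_assoc, unitHeight_mul_cos]
  have : a ≠ 0 := by linarith
  field_simp

/-- The profile of scale `a` solves the equation `|A|² = 1`. -/
lemma angularSpeed_sq_add {a : ℝ} (ha : 1 ≤ a) (t : ℝ) :
    angularSpeed a (tangentAngle a t) ^ 2 + (Real.cos (tangentAngle a t) / height a t) ^ 2 = 1 := by
  have h1 := height_mul_cos ha t
  have h2 : 0 < height a t := by linarith [one_le_height ha t]
  rw [angularSpeed, ← Real.sin_sq_add_cos_sq (unitAngle (Real.cos (tangentAngle a t) / a)),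
    ← neg_sq (Real.cos (tangentAngle a t) / height a t), ← neg_div, ← h1]
  field_simp

/-- The largest distance to the axis on the profile of scale `a`. -/
noncomputable def maxHeight (a : ℝ) : ℝ := a * unitHeight (unitAngle (1 / a))

lemma height_zero {a : ℝ} (ha : 1 ≤ a) : height a 0 = maxHeight a := by
  rw [height, tangentAngle_zero ha, Real.cos_zero, maxHeight]

lemma height_le_maxHeight {a : ℝ} (ha : 1 ≤ a) (t : ℝ) : height a t ≤ maxHeight a := by
  refine mul_le_mul_of_nonneg_left (strictMonoOn_unitHeight_unitAngle.monotoneOn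
    (neg_one_le_cos_div ha _) ?_ ?_) (by linarith)
  · have : 0 ≤ 1 / a := by positivity
    simp only [mem_Ici]; linarith
  · exact div_le_div_of_nonneg_right (Real.cos_le_one _) (by linarith)

lemma cos_tangentAngle_of_height_eq {a t : ℝ} (ha : 1 ≤ a) (h : height a t = maxHeight a) :
    Real.cos (tangentAngle a t) = 1 := by
  have ha0 : 0 < a := by linarith
  have h1 : 0 ≤ 1 / a := by positivity
  have h2 := strictMonoOn_unitHeight_unitAngle.injOn (neg_one_le_cos_div ha (tangentAngle a t))
    (mem_Ici.2 (by linarith : -1 ≤ 1 / a)) (mul_left_cancel₀ ha0.ne' h)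
  have h3 := congrArg (· * a) h2
  rwa [div_mul_cancel₀ _ ha0.ne', div_mul_cancel₀ _ ha0.ne'] at h3

/-- The arc length from a highest point of the profile of scale `a` to a lowest one. -/
noncomputable def halfPeriod (a : ℝ) : ℝ := arcTime a Real.pi

lemma halfPeriod_pos {a : ℝ} (ha : 1 ≤ a) : 0 < halfPeriod a := by
  have := strictMono_arcTime ha Real.pi_pos
  rwa [arcTime_zero] at this

lemma tangentAngle_halfPeriod {a : ℝ} (ha : 1 ≤ a) : tangentAngle a (halfPeriod a) = Real.pi :=
  tangentAngle_arcTime ha _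

lemma arcTime_add_two_pi {a : ℝ} (ha : 1 ≤ a) (σ : ℝ) :
    arcTime a (σ + 2 * Real.pi) = arcTime a σ + 2 * halfPeriod a := by
  have hint := intervalIntegrable_inv_angularSpeed ha
  have hp : Function.Periodic (fun σ => (angularSpeed a σ)⁻¹) (2 * Real.pi) := fun σ => by
    simp only [angularSpeed_periodic a σ]
  have h1 := hp.intervalIntegral_add_eq σ (-Real.pi)
  have h2 : arcTime a (σ + 2 * Real.pi) - arcTime a σ =
      arcTime a Real.pi - arcTime a (-Real.pi) := by
    rw [arcTime, arcTime, arcTime, arcTime,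
      intervalIntegral.integral_interval_sub_left (hint _ _) (hint _ _),
      intervalIntegral.integral_interval_sub_left (hint _ _) (hint _ _), h1]
    congr 1; ring
  rw [arcTime_neg] at h2
  rw [halfPeriod]; linarith

lemma tangentAngle_add_period {a : ℝ} (ha : 1 ≤ a) (t : ℝ) :
    tangentAngle a (t + 2 * halfPeriod a) = tangentAngle a t + 2 * Real.pi := by
  rw [← (strictMono_arcTime ha).injective.eq_iff, arcTime_add_two_pi ha, arcTime_tangentAngle ha,
    arcTime_tangentAngle ha]

lemma height_add_period {a : ℝ} (ha : 1 ≤ a) (t : ℝ) :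
    height a (t + 2 * halfPeriod a) = height a t := by
  rw [height, tangentAngle_add_period ha, Real.cos_add_two_pi, height]

lemma height_neg {a : ℝ} (ha : 1 ≤ a) (t : ℝ) : height a (-t) = height a t := by
  rw [height, tangentAngle_neg ha, Real.cos_neg, height]

lemma axial_zero (a : ℝ) : axial a 0 = 0 := intervalIntegral.integral_same

lemma axial_neg {a : ℝ} (ha : 1 ≤ a) (t : ℝ) : axial a (-t) = -axial a t := by
  have h := intervalIntegral.integral_comp_neg (a := 0) (b := t)
    (fun s => Real.cos (tangentAngle a s))
  simp only [tangentAngle_neg ha, Real.cos_neg, neg_zero] at h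
  rw [axial, axial, h, intervalIntegral.integral_symm]

lemma axial_add_period {a : ℝ} (ha : 1 ≤ a) (t : ℝ) :
    axial a (t + 2 * halfPeriod a) = axial a t + 2 * axial a (halfPeriod a) := by
  have hc : Continuous fun s => Real.cos (tangentAngle a s) :=
    Real.continuous_cos.comp (continuous_tangentAngle ha)
  have hint := fun p q => hc.intervalIntegrable (μ := MeasureTheory.volume) p q
  have hp : Function.Periodic (fun s => Real.cos (tangentAngle a s)) (2 * halfPeriod a) :=
    fun s => by simp only [tangentAngle_add_period ha s, Real.cos_add_two_pi]
  have h1 := hp.intervalIntegral_add_eq t (-halfPeriod a)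
  have h2 : axial a (t + 2 * halfPeriod a) - axial a t =
      axial a (halfPeriod a) - axial a (-halfPeriod a) := by
    rw [axial, axial, axial, axial,
      intervalIntegral.integral_interval_sub_left (hint _ _) (hint _ _),
      intervalIntegral.integral_interval_sub_left (hint _ _) (hint _ _), h1]
    congr 1; ring
  rw [axial_neg ha] at h2
  linarith

/-- The profile moves backwards along the axis over a half period: at the same slope it turns more
slowly near its lowest point than near its highest one, so the backward part is longer. -/
lemma axial_halfPeriod_neg {a : ℝ} (ha : 1 ≤ a) : axial a (halfPeriod a) < 0 := by
  have hpi := Real.pi_pos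
  set X : ℝ → ℝ := fun σ => axial a (arcTime a σ) with hX
  have hXc : Continuous X := (continuous_axial ha).comp (continuous_arcTime ha)
  have hXd : ∀ σ, |σ| < Real.pi → HasDerivAt X (Real.cos σ * (angularSpeed a σ)⁻¹) σ := by
    intro σ hσ
    have := (hasDerivAt_axial ha (arcTime a σ)).comp σ
      (hasDerivAt_arcTime ha (angularSpeed_pos_of_abs_lt ha hσ))
    rwa [tangentAngle_arcTime ha] at this
  have hmono : StrictMonoOn (fun φ => X (Real.pi - φ) - X φ) (Icc 0 (Real.pi / 2)) := by
    refine strictMonoOn_of_deriv_pos (convex_Icc _ _)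
      ((hXc.comp (continuous_const.sub continuous_id)).sub hXc).continuousOn ?_
    intro φ hφ
    rw [interior_Icc] at hφ
    have hd1 := hXd φ (by rw [abs_of_pos hφ.1]; linarith [hφ.2])
    have hd2 := hXd (Real.pi - φ) (by rw [abs_of_pos] <;> linarith [hφ.1, hφ.2])
    have hd : HasDerivAt (fun φ => X (Real.pi - φ) - X φ) _ φ :=
      (hd2.comp φ ((hasDerivAt_id φ).const_sub Real.pi)).sub hd1
    rw [hd.deriv, Real.cos_pi_sub]
    have hcos := Real.cos_pos_of_mem_Ioo (x := φ) ⟨by linarith [hφ.1], hφ.2⟩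
    have hp2 : 0 < angularSpeed a (Real.pi - φ) :=
      angularSpeed_pos_of_abs_lt ha (by rw [abs_of_pos] <;> linarith [hφ.1, hφ.2])
    have hlt : angularSpeed a (Real.pi - φ) < angularSpeed a φ := by
      rw [angularSpeed, angularSpeed, Real.cos_pi_sub, neg_div]
      exact sin_unitAngle_neg_lt (by positivity) (cos_div_le_one ha φ)
    have := inv_strictAnti₀ hp2 hlt
    nlinarith
  have h := hmono (left_mem_Icc.2 (by linarith)) (right_mem_Icc.2 (by linarith))
    (by linarith : (0 : ℝ) < Real.pi / 2)
  simp only [hX, sub_zero, arcTime_zero, axial_zero,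
    show Real.pi - Real.pi / 2 = Real.pi / 2 by ring, sub_self] at h
  exact h

/-- The profile crosses the line of symmetry through its highest point transversally. -/
lemma exists_axial_eq_zero {a : ℝ} (ha : 1 ≤ a) :
    ∃ t ∈ Ioo 0 (halfPeriod a), axial a t = 0 ∧ Real.cos (tangentAngle a t) < 0 ∧
      0 < Real.sin (tangentAngle a t) := by
  have hpi := Real.pi_pos
  set t₁ := arcTime a (Real.pi / 2) with ht₁
  have h1 : 0 < t₁ := by
    have := strictMono_arcTime ha (by linarith : (0 : ℝ) < Real.pi / 2)
    rwa [arcTime_zero] at this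
  have h2 : t₁ < halfPeriod a := strictMono_arcTime ha (by linarith)
  have hτ₁ : tangentAngle a t₁ = Real.pi / 2 := tangentAngle_arcTime ha _
  have h3 : 0 < axial a t₁ := by
    have hmono : StrictMonoOn (axial a) (Icc 0 t₁) := by
      refine strictMonoOn_of_deriv_pos (convex_Icc _ _) (continuous_axial ha).continuousOn ?_
      intro t ht
      rw [interior_Icc] at ht
      rw [(hasDerivAt_axial ha t).deriv]
      refine Real.cos_pos_of_mem_Ioo ⟨?_, ?_⟩
      · have := strictMono_tangentAngle ha ht.1
        rw [tangentAngle_zero ha] at this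
        linarith
      · rw [← hτ₁]
        exact strictMono_tangentAngle ha ht.2
    have := hmono (left_mem_Icc.2 h1.le) (right_mem_Icc.2 h1.le) h1
    rwa [axial_zero] at this
  obtain ⟨t, ht, h0⟩ := intermediate_value_Ioo' h2.le (continuous_axial ha).continuousOn
    (show (0 : ℝ) ∈ Ioo _ _ from ⟨axial_halfPeriod_neg ha, h3⟩)
  have hlo := strictMono_tangentAngle ha ht.1
  have hhi := strictMono_tangentAngle ha ht.2
  rw [hτ₁] at hlo
  rw [tangentAngle_halfPeriod ha] at hhi
  exact ⟨t, ⟨by linarith [ht.1], ht.2⟩, h0, Real.cos_neg_of_pi_div_two_lt_of_lt hlo (by linarith),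
    Real.sin_pos_of_pos_of_lt_pi (by linarith) hhi⟩

/-- For `a > 1` the profile does not reach the cylinder, and is smooth. -/
lemma contDiff_tangentAngle_height {a : ℝ} (ha : 1 < a) (n : ℕ) :
    ContDiff ℝ n (tangentAngle a) ∧ ContDiff ℝ n (height a) := by
  induction n with
  | zero =>
    simp only [CharP.cast_eq_zero, contDiff_zero]
    exact ⟨continuous_tangentAngle ha.le, continuous_height ha.le⟩
  | succ n ih =>
    have e1 : deriv (tangentAngle a) =
        fun t => √(1 - (Real.cos (tangentAngle a t) / height a t) ^ 2) := by
      funext t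
      rw [(hasDerivAt_tangentAngle ha.le t).deriv, ← angularSpeed_sq_add ha.le t,
        add_sub_cancel_right, Real.sqrt_sq (angularSpeed_nonneg ha.le _)]
    have e2 : deriv (height a) = fun t => -Real.sin (tangentAngle a t) := by
      funext t
      exact (hasDerivAt_height ha.le t).deriv
    have hh : ∀ t, height a t ≠ 0 := fun t => by linarith [one_le_height ha.le t]
    have hpos : ∀ t, 1 - (Real.cos (tangentAngle a t) / height a t) ^ 2 ≠ 0 := fun t => by
      rw [← angularSpeed_sq_add ha.le t, add_sub_cancel_right]
      exact (pow_pos (angularSpeed_pos_of_one_lt ha _) 2).ne'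
    push_cast
    refine ⟨contDiff_succ_iff_deriv.2
        ⟨fun t => (hasDerivAt_tangentAngle ha.le t).differentiableAt, by simp, ?_⟩,
      contDiff_succ_iff_deriv.2
        ⟨fun t => (hasDerivAt_height ha.le t).differentiableAt, by simp, ?_⟩⟩
    · rw [e1]
      exact (contDiff_const.sub ((ih.1.cos.div ih.2 hh).pow 2)).sqrt hpos
    · rw [e2]
      exact ih.1.sin.neg

lemma contDiff_axial {a : ℝ} (ha : 1 < a) (n : ℕ) : ContDiff ℝ n (axial a) := by
  have e : deriv (axial a) = fun t => Real.cos (tangentAngle a t) := by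
    funext t
    exact (hasDerivAt_axial ha.le t).deriv
  have : ContDiff ℝ (n + 1) (axial a) := contDiff_succ_iff_deriv.2
    ⟨fun t => (hasDerivAt_axial ha.le t).differentiableAt, by simp, by
      rw [e]; exact (contDiff_tangentAngle_height ha n).1.cos⟩
  exact this.of_le (by norm_cast; omega)

/-- The inverse functions of a continuous family of increasing bijections depend continuously on
the parameter. -/
lemma continuous_uncurry_of_strictMono_leftInverse {X : Type*} [TopologicalSpace X]
    {T S : X → ℝ → ℝ} (hT : ∀ σ, Continuous fun a => T a σ) (hmono : ∀ a, StrictMono (T a))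
    (hTS : ∀ a t, T a (S a t) = t) : Continuous (Function.uncurry S) := by
  refine continuous_iff_continuousAt.2 fun ⟨a, t⟩ => ?_
  rw [ContinuousAt, tendsto_order]
  simp only [Function.uncurry_apply_pair]
  constructor
  · intro σ hσ
    have h1 : T a σ < t := by rw [← hTS a t]; exact hmono a hσ
    have h2 : ∀ᶠ p : X × ℝ in 𝓝 (a, t), T p.1 σ < p.2 :=
      (((hT σ).comp continuous_fst).continuousAt).eventually_lt continuous_snd.continuousAt h1
    filter_upwards [h2] with p hp
    rw [← hTS p.1 p.2] at hp
    exact (hmono p.1).lt_iff_lt.1 hp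
  · intro σ hσ
    have h1 : t < T a σ := by rw [← hTS a t]; exact hmono a hσ
    have h2 : ∀ᶠ p : X × ℝ in 𝓝 (a, t), p.2 < T p.1 σ :=
      continuous_snd.continuousAt.eventually_lt
        (((hT σ).comp continuous_fst).continuousAt) h1
    filter_upwards [h2] with p hp
    rw [← hTS p.1 p.2] at hp
    exact (hmono p.1).lt_iff_lt.1 hp

lemma continuous_tangentAngle_uncurry :
    Continuous fun p : Ioi (1 : ℝ) × ℝ => tangentAngle p.1 p.2 := by
  refine continuous_uncurry_of_strictMono_leftInverse
    (T := fun (a : Ioi (1 : ℝ)) σ => arcTime a σ) (S := fun (a : Ioi (1 : ℝ)) t => tangentAngle a t)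
    (fun σ => ?_) (fun a => strictMono_arcTime a.2.le) (fun a t => arcTime_tangentAngle a.2.le t)
  refine intervalIntegral.continuous_parametric_intervalIntegral_of_continuous
    (f := fun (a : Ioi (1 : ℝ)) s => (angularSpeed a s)⁻¹) (s := fun _ => σ) ?_ continuous_const
  refine Continuous.inv₀ ?_ fun p => (angularSpeed_pos_of_one_lt p.1.2 p.2).ne'
  refine Real.continuous_sin.comp (continuous_unitAngle.comp ?_)
  exact (Real.continuous_cos.comp continuous_snd).div
    (continuous_subtype_val.comp continuous_fst) fun p => (one_pos.trans p.1.2).ne'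

lemma continuous_height_uncurry : Continuous fun p : Ioi (1 : ℝ) × ℝ => height p.1 p.2 := by
  have hc : Continuous fun p : Ioi (1 : ℝ) × ℝ => (p.1 : ℝ) :=
    continuous_subtype_val.comp continuous_fst
  exact hc.mul (continuous_unitHeight_unitAngle.comp
    ((Real.continuous_cos.comp continuous_tangentAngle_uncurry).div hc
      fun p => (one_pos.trans p.1.2).ne'))

lemma continuous_axial_uncurry : Continuous fun p : Ioi (1 : ℝ) × ℝ => axial p.1 p.2 := by
  refine intervalIntegral.continuous_parametric_intervalIntegral_of_continuous
    (X := Ioi (1 : ℝ) × ℝ) (f := fun p s => Real.cos (tangentAngle p.1 s)) (s := fun p => p.2) ?_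
    continuous_snd
  exact Real.continuous_cos.comp (continuous_tangentAngle_uncurry.comp
    ((continuous_fst.comp continuous_fst).prodMk continuous_snd))

/-! ### The largest height as a parameter -/

/-- The height of the highest points of the profile of scale `1`. -/
noncomputable def criticalHeight : ℝ := maxHeight 1

/-- The scale of the profile whose largest height is `l`. At the highest points the tangent is
parallel to the axis, so `cos u = -1 / l` for the curvature angle `u`, and the scale is
`1 / unitAxial u`. -/
noncomputable def scaleOf (l : ℝ) : ℝ := (unitAxial (Real.arccos (-1 / l)))⁻¹

lemma maxHeight_mul_cos {a : ℝ} (ha : 0 < a) :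
    maxHeight a * Real.cos (unitAngle (1 / a)) = -1 := by
  rw [maxHeight, mul_assoc, unitHeight_mul_cos]
  field_simp

lemma maxHeight_pos {a : ℝ} (ha : 0 < a) : 0 < maxHeight a :=
  mul_pos ha (unitHeight_pos (unitAngle_mem _))

lemma arccos_neg_inv_maxHeight {a : ℝ} (ha : 0 < a) :
    Real.arccos (-1 / maxHeight a) = unitAngle (1 / a) := by
  have h : -1 / maxHeight a = Real.cos (unitAngle (1 / a)) := by
    rw [← maxHeight_mul_cos ha, mul_div_cancel_left₀ _ (maxHeight_pos ha).ne']
  have h0 : (0 : ℝ) ≤ 1 / a := by positivity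
  rw [h, Real.arccos_cos (unitAngle_nonneg (by linarith))
    (by linarith [(unitAngle_mem (1 / a)).2, Real.pi_pos])]

lemma scaleOf_maxHeight {a : ℝ} (ha : 0 < a) : scaleOf (maxHeight a) = a := by
  rw [scaleOf, arccos_neg_inv_maxHeight ha, unitAxial_unitAngle, one_div, inv_inv]

lemma one_lt_criticalHeight : 1 < criticalHeight := by
  have h1 := maxHeight_mul_cos one_pos
  have h2 : Real.cos (unitAngle (1 / 1)) > -1 := by
    have h3 := unitAngle_pos (y := 1 / 1) (by norm_num)
    rw [← Real.cos_pi]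
    exact Real.cos_lt_cos_of_nonneg_of_le_pi h3.le le_rfl
      (by linarith [(unitAngle_mem (1 / 1)).2, Real.pi_pos])
  rw [criticalHeight]
  nlinarith [maxHeight_pos one_pos]

lemma arccos_mem_of_criticalHeight_lt {l : ℝ} (hl : criticalHeight < l) :
    Real.pi / 2 < Real.arccos (-1 / l) ∧ Real.arccos (-1 / l) < unitAngle 1 := by
  have h1 := one_lt_criticalHeight
  have hlt : -1 / criticalHeight < -1 / l := by
    rw [neg_div, neg_div, neg_lt_neg_iff]
    exact one_div_lt_one_div_of_lt (by linarith) hl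
  have hge : -1 ≤ -1 / criticalHeight := by
    rw [le_div_iff₀ (by linarith)]; linarith
  have hneg : -1 / l < 0 := div_neg_of_neg_of_pos (by norm_num) (by linarith)
  constructor
  · rw [← Real.arccos_zero]
    exact Real.arccos_lt_arccos (by linarith) hneg (by norm_num)
  · have := arccos_neg_inv_maxHeight one_pos
    rw [div_one] at this
    rw [← this]
    exact Real.arccos_lt_arccos hge hlt (by linarith)

lemma arccos_mem_angleRange {l : ℝ} (hl : criticalHeight < l) :
    Real.arccos (-1 / l) ∈ angleRange := by
  have h := arccos_mem_of_criticalHeight_lt hl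
  exact ⟨by linarith [Real.pi_pos], h.2.trans (unitAngle_mem 1).2⟩

lemma unitAxial_arccos_pos {l : ℝ} (hl : criticalHeight < l) :
    0 < unitAxial (Real.arccos (-1 / l)) := by
  have h := arccos_mem_of_criticalHeight_lt hl
  have hm := arccos_mem_angleRange hl
  have := Real.cos_neg_of_pi_div_two_lt_of_lt h.1 (by linarith [hm.2, Real.pi_pos])
  rw [unitAxial]
  nlinarith [unitHeight_pos hm]

lemma one_lt_scaleOf {l : ℝ} (hl : criticalHeight < l) : 1 < scaleOf l := by
  have h := strictMonoOn_unitAxial (arccos_mem_angleRange hl) (unitAngle_mem 1)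
    (arccos_mem_of_criticalHeight_lt hl).2
  rw [unitAxial_unitAngle] at h
  exact (one_lt_inv₀ (unitAxial_arccos_pos hl)).2 h

lemma maxHeight_scaleOf {l : ℝ} (hl : criticalHeight < l) : maxHeight (scaleOf l) = l := by
  have h1 := one_lt_criticalHeight
  have hm := arccos_mem_angleRange hl
  have hp := unitHeight_pos hm
  have hx := unitAxial_arccos_pos hl
  rw [maxHeight, scaleOf, one_div, inv_inv, unitAngle_unitAxial hm, unitAxial, Real.cos_arccos]
  · rw [neg_mul_eq_mul_neg, ← neg_div, neg_neg, mul_one_div, inv_div, div_mul_cancel₀ _ hp.ne']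
  · rw [le_div_iff₀ (by linarith)]; linarith
  · rw [div_le_iff₀ (by linarith)]; linarith

lemma criticalHeight_lt_maxHeight {a : ℝ} (ha : 1 < a) : criticalHeight < maxHeight a := by
  have h1 : (1 : ℝ) / a < 1 / 1 := one_div_lt_one_div_of_lt one_pos ha
  have h0 : (0 : ℝ) < 1 / a := by positivity
  have hc := Real.cos_lt_cos_of_nonneg_of_le_pi (unitAngle_nonneg (by linarith))
    (by linarith [(unitAngle_mem (1 / 1)).2, Real.pi_pos]) (strictMono_unitAngle h1)
  have e1 := maxHeight_mul_cos one_pos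
  have e2 := maxHeight_mul_cos (one_pos.trans ha)
  have p1 := maxHeight_pos one_pos
  have p2 := maxHeight_pos (one_pos.trans ha)
  rw [criticalHeight]
  by_contra! h
  have hneg : Real.cos (unitAngle (1 / a)) < 0 := by nlinarith
  nlinarith

lemma continuousOn_scaleOf : ContinuousOn scaleOf (Ioi criticalHeight) := by
  intro l hl
  have h1 := one_lt_criticalHeight
  have hl0 : l ≠ 0 := by linarith [mem_Ioi.1 hl]
  have hc : ContinuousAt (fun l : ℝ => Real.arccos (-1 / l)) l :=
    ContinuousAt.comp (g := Real.arccos) Real.continuous_arccos.continuousAt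
      (continuousAt_const.div continuousAt_id hl0)
  have hx : ContinuousAt unitAxial (Real.arccos (-1 / l)) :=
    (hasDerivAt_unitAxial (arccos_mem_angleRange hl)).continuousAt
  exact ((ContinuousAt.comp (f := fun l : ℝ => Real.arccos (-1 / l)) hx hc).inv₀
    (unitAxial_arccos_pos hl).ne').continuousWithinAt

/-! ### The rotation map in an adapted frame -/

/-- The map `(t, φ) ↦ (ξ t, ζ t sin φ, ζ t cos φ)` in the orthonormal frame `e`. -/
noncomputable def revolve (e : OrthonormalBasis (Fin 3) ℝ E3) (ξ ζ : ℝ → ℝ) (p : ℝ × ℝ) : E3 :=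
  ξ p.1 • e 0 + (ζ p.1 * Real.sin p.2) • e 1 + (ζ p.1 * Real.cos p.2) • e 2

lemma inner_frame_comb (e : OrthonormalBasis (Fin 3) ℝ E3) (a b c a' b' c' : ℝ) :
    inner ℝ (a • e 0 + b • e 1 + c • e 2) (a' • e 0 + b' • e 1 + c' • e 2) =
      a * a' + b * b' + c * c' := by
  have h := orthonormal_iff_ite.1 e.orthonormal
  simp only [inner_add_left, inner_add_right, inner_smul_left, inner_smul_right, h]
  simp
  ring

lemma norm_sq_frame_comb (e : OrthonormalBasis (Fin 3) ℝ E3) (a b c : ℝ) :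
    ‖a • e 0 + b • e 1 + c • e 2‖ ^ 2 = a ^ 2 + b ^ 2 + c ^ 2 := by
  rw [← real_inner_self_eq_norm_sq, inner_frame_comb]
  ring

lemma frame_expand (e : OrthonormalBasis (Fin 3) ℝ E3) (n : E3) :
    n = inner ℝ (e 0) n • e 0 + inner ℝ (e 1) n • e 1 + inner ℝ (e 2) n • e 2 := by
  conv_lhs => rw [← e.sum_repr' n, Fin.sum_univ_three]

lemma hasFDerivAt_revolve (e : OrthonormalBasis (Fin 3) ℝ E3) {ξ ζ : ℝ → ℝ} {ξ' ζ' : ℝ}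
    {p : ℝ × ℝ} (hξ : HasDerivAt ξ ξ' p.1) (hζ : HasDerivAt ζ ζ' p.1) :
    HasFDerivAt (revolve e ξ ζ)
      ((ContinuousLinearMap.fst ℝ ℝ ℝ).smulRight
          (ξ' • e 0 + (ζ' * Real.sin p.2) • e 1 + (ζ' * Real.cos p.2) • e 2) +
        (ContinuousLinearMap.snd ℝ ℝ ℝ).smulRight
          ((0 : ℝ) • e 0 + (ζ p.1 * Real.cos p.2) • e 1 + (-(ζ p.1 * Real.sin p.2)) • e 2)) p := by
  have h1 := hξ.comp_hasFDerivAt p (hasFDerivAt_fst (𝕜 := ℝ))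
  have h2 := hζ.comp_hasFDerivAt p (hasFDerivAt_fst (𝕜 := ℝ))
  have h3 := (Real.hasDerivAt_sin p.2).comp_hasFDerivAt p (hasFDerivAt_snd (𝕜 := ℝ))
  have h4 := (Real.hasDerivAt_cos p.2).comp_hasFDerivAt p (hasFDerivAt_snd (𝕜 := ℝ))
  refine (((h1.smul_const (e 0)).add ((h2.mul h3).smul_const (e 1))).add
    ((h2.mul h4).smul_const (e 2))).congr_fderiv ?_
  refine ContinuousLinearMap.ext fun v => ?_
  simp only [add_apply, ContinuousLinearMap.smulRight_apply,
    smul_apply, ContinuousLinearMap.coe_fst', ContinuousLinearMap.coe_snd',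
    Function.comp_apply, smul_eq_mul]
  module

lemma partialD_zero_revolve (e : OrthonormalBasis (Fin 3) ℝ E3) (o : E3) {ξ ζ : ℝ → ℝ}
    {ξ' ζ' : ℝ} {p : ℝ × ℝ} (hξ : HasDerivAt ξ ξ' p.1) (hζ : HasDerivAt ζ ζ' p.1) :
    partialD 0 (fun q => o + revolve e ξ ζ q) p =
      ξ' • e 0 + (ζ' * Real.sin p.2) • e 1 + (ζ' * Real.cos p.2) • e 2 := by
  rw [partialD, ((hasFDerivAt_revolve e hξ hζ).const_add o).fderiv]
  simp

lemma partialD_one_revolve (e : OrthonormalBasis (Fin 3) ℝ E3) (o : E3) {ξ ζ : ℝ → ℝ}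
    {ξ' ζ' : ℝ} {p : ℝ × ℝ} (hξ : HasDerivAt ξ ξ' p.1) (hζ : HasDerivAt ζ ζ' p.1) :
    partialD 1 (fun q => o + revolve e ξ ζ q) p =
      (0 : ℝ) • e 0 + (ζ p.1 * Real.cos p.2) • e 1 + (-(ζ p.1 * Real.sin p.2)) • e 2 := by
  rw [partialD, ((hasFDerivAt_revolve e hξ hζ).const_add o).fderiv]
  simp

lemma partialD_congr {F G : ℝ × ℝ → E3} {p : ℝ × ℝ} (i : Fin 2) (h : F =ᶠ[𝓝 p] G) :
    partialD i F p = partialD i G p := by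
  rw [partialD, partialD, h.fderiv_eq]

namespace RotSurface

/-- The image of the standard frame under the rigid motion of a rotational surface; its first
vector spans the axis. -/
noncomputable def frame (S : RotSurface) : OrthonormalBasis (Fin 3) ℝ E3 :=
  (EuclideanSpace.basisFun (Fin 3) ℝ).map S.g.linearIsometryEquiv

lemma g_apply (S : RotSurface) (a b c : ℝ) :
    S.g !₂[a, b, c] = S.g 0 + (a • S.frame 0 + b • S.frame 1 + c • S.frame 2) := by
  have h1 : S.g !₂[a, b, c] = S.g.linearIsometryEquiv !₂[a, b, c] + S.g 0 := by
    have := S.g.map_vadd 0 !₂[a, b, c]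
    simpa using this
  have h2 : (!₂[a, b, c] : E3) = a • EuclideanSpace.basisFun (Fin 3) ℝ 0 +
      b • EuclideanSpace.basisFun (Fin 3) ℝ 1 + c • EuclideanSpace.basisFun (Fin 3) ℝ 2 := by
    ext i
    fin_cases i <;> simp
  rw [h1, add_comm, h2]
  simp only [map_add, map_smul, frame, OrthonormalBasis.map_apply]

lemma map_eq_revolve (S : RotSurface) :
    S.map = fun p => S.g 0 + revolve S.frame S.x S.z p := by
  funext p
  rw [map, g_apply, revolve]

lemma dist_map_sq (S : RotSurface) (t φ t' φ' : ℝ) :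
    dist (S.map (t, φ)) (S.map (t', φ')) ^ 2 = (S.x t - S.x t') ^ 2 +
      (S.z t * Real.sin φ - S.z t' * Real.sin φ') ^ 2 +
      (S.z t * Real.cos φ - S.z t' * Real.cos φ') ^ 2 := by
  rw [map, map, S.g.dist_map, EuclideanSpace.dist_eq, Real.sq_sqrt (by positivity),
    Fin.sum_univ_three]
  simp [Real.dist_eq, sq_abs]

/-- Points of the profile are at most as far apart as any points on the circles they sweep out. -/
lemma profile_dist_le (S : RotSurface) {t t' φ φ' : ℝ} (hz : 0 ≤ S.z t) (hz' : 0 ≤ S.z t') :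
    (S.x t - S.x t') ^ 2 + (S.z t - S.z t') ^ 2 ≤
      dist (S.map (t, φ)) (S.map (t', φ')) ^ 2 := by
  rw [dist_map_sq]
  have h1 := Real.sin_sq_add_cos_sq φ
  have h2 := Real.sin_sq_add_cos_sq φ'
  have h3 : Real.sin φ * Real.sin φ' + Real.cos φ * Real.cos φ' ≤ 1 := by
    nlinarith [sq_nonneg (Real.sin φ - Real.sin φ'), sq_nonneg (Real.cos φ - Real.cos φ')]
  have h4 : (S.z t * Real.sin φ - S.z t' * Real.sin φ') ^ 2 +
      (S.z t * Real.cos φ - S.z t' * Real.cos φ') ^ 2 = S.z t ^ 2 + S.z t' ^ 2 -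
      2 * (S.z t * S.z t') * (Real.sin φ * Real.sin φ' + Real.cos φ * Real.cos φ') := by
    linear_combination S.z t ^ 2 * h1 + S.z t' ^ 2 * h2
  nlinarith [mul_nonneg hz hz']

/-! ### The shape operator of a rotational surface -/

section Shape

variable {S : RotSurface} {c s : ℝ → ℝ} {c' s' t : ℝ}

lemma isUnitNormal_iff (φ : ℝ) (n : E3) (hx : HasDerivAt S.x (c t) t)
    (hz : HasDerivAt S.z (s t) t) (hpos : 0 < S.z t) :
    IsUnitNormal S.map (t, φ) n ↔ ∃ n₀ ν : ℝ, n₀ ^ 2 + ν ^ 2 = 1 ∧ n₀ * c t + ν * s t = 0 ∧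
      n = n₀ • S.frame 0 + (ν * Real.sin φ) • S.frame 1 + (ν * Real.cos φ) • S.frame 2 := by
  have hφ := Real.sin_sq_add_cos_sq φ
  rw [IsUnitNormal, map_eq_revolve, Fin.forall_fin_two,
    partialD_zero_revolve S.frame _ (p := (t, φ)) hx hz,
    partialD_one_revolve S.frame _ (p := (t, φ)) hx hz]
  constructor
  · rintro ⟨h1, h2, h3⟩
    have hn := frame_expand S.frame n
    set a := inner ℝ (S.frame 0) n
    set b := inner ℝ (S.frame 1) n
    set d := inner ℝ (S.frame 2) n
    rw [hn, inner_frame_comb] at h2 h3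
    have h4 : a ^ 2 + b ^ 2 + d ^ 2 = 1 := by
      rw [← norm_sq_frame_comb S.frame, ← hn, h1, one_pow]
    simp only at h2 h3
    have h5 : b * Real.cos φ = d * Real.sin φ := by
      refine mul_left_cancel₀ hpos.ne' ?_
      linarith
    have hb : b = (b * Real.sin φ + d * Real.cos φ) * Real.sin φ := by
      linear_combination -b * hφ + Real.cos φ * h5
    have hd : d = (b * Real.sin φ + d * Real.cos φ) * Real.cos φ := by
      linear_combination -d * hφ - Real.sin φ * h5
    refine ⟨a, b * Real.sin φ + d * Real.cos φ, ?_, by linarith, ?_⟩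
    · linear_combination h4 + b ^ 2 * hφ + d ^ 2 * hφ -
        (b * Real.cos φ - d * Real.sin φ) * h5
    · rw [← hb, ← hd]; exact hn
  · rintro ⟨n₀, ν, h1, h2, rfl⟩
    refine ⟨?_, ?_, ?_⟩
    · have : ‖n₀ • S.frame 0 + (ν * Real.sin φ) • S.frame 1 + (ν * Real.cos φ) • S.frame 2‖ ^ 2
          = 1 := by
        rw [norm_sq_frame_comb]
        linear_combination h1 + ν ^ 2 * hφ
      exact (pow_eq_one_iff_of_nonneg (norm_nonneg _) two_ne_zero).1 this
    · rw [inner_frame_comb]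
      linear_combination h2 + ν * s t * hφ
    · rw [inner_frame_comb]
      ring

/-- The principal curvatures of a rotational surface are the curvature of its profile and
`x' / z`. -/
lemma trace_shapeOperator_sq (φ : ℝ) (n : E3)
    (hx : ∀ᶠ r in 𝓝 t, HasDerivAt S.x (c r) r) (hz : ∀ᶠ r in 𝓝 t, HasDerivAt S.z (s r) r)
    (hc : HasDerivAt c c' t) (hs : HasDerivAt s s' t) (hpos : 0 < S.z t)
    (hunit : c t ^ 2 + s t ^ 2 = 1) (hn : IsUnitNormal S.map (t, φ) n) :
    (shapeOperator S.map (t, φ) n * shapeOperator S.map (t, φ) n).trace =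
      (c t * s' - c' * s t) ^ 2 + (c t / S.z t) ^ 2 := by
  have hφ := Real.sin_sq_add_cos_sq φ
  obtain ⟨n₀, ν, h1, h2, rfl⟩ := (isUnitNormal_iff φ n hx.self_of_nhds hz.self_of_nhds hpos).1 hn
  have hz0 : S.z t ≠ 0 := hpos.ne'
  have hx' : ∀ᶠ q : ℝ × ℝ in 𝓝 (t, φ), HasDerivAt S.x (c q.1) q.1 :=
    (continuous_fst.tendsto (t, φ)).eventually hx
  have hz' : ∀ᶠ q : ℝ × ℝ in 𝓝 (t, φ), HasDerivAt S.z (s q.1) q.1 :=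
    (continuous_fst.tendsto (t, φ)).eventually hz
  have e0 : partialD 0 S.map =ᶠ[𝓝 (t, φ)] fun q => 0 + revolve S.frame c s q := by
    filter_upwards [hx', hz'] with q h3 h4
    rw [map_eq_revolve, partialD_zero_revolve S.frame _ h3 h4, zero_add, revolve]
  have e1 : partialD 1 S.map =ᶠ[𝓝 (t, φ)]
      fun q => 0 + revolve S.frame (fun _ => 0) S.z (q.1, q.2 + Real.pi / 2) := by
    filter_upwards [hx', hz'] with q h3 h4
    rw [map_eq_revolve, partialD_one_revolve S.frame _ h3 h4, zero_add, revolve]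
    simp only [Real.sin_add_pi_div_two, Real.cos_add_pi_div_two, mul_neg]
  have e00 : partialD 0 (partialD 0 S.map) (t, φ) =
      c' • S.frame 0 + (s' * Real.sin φ) • S.frame 1 + (s' * Real.cos φ) • S.frame 2 := by
    rw [partialD_congr 0 e0, partialD_zero_revolve S.frame _ (p := (t, φ)) hc hs]
  have e10 : partialD 1 (partialD 0 S.map) (t, φ) =
      (0 : ℝ) • S.frame 0 + (s t * Real.cos φ) • S.frame 1 +
        (-(s t * Real.sin φ)) • S.frame 2 := by
    rw [partialD_congr 1 e0, partialD_one_revolve S.frame _ (p := (t, φ)) hc hs]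
  have hshift : HasFDerivAt (fun q : ℝ × ℝ => (q.1, q.2 + Real.pi / 2))
      (ContinuousLinearMap.id ℝ (ℝ × ℝ)) (t, φ) := by
    have := (hasFDerivAt_id (𝕜 := ℝ) ((t, φ) : ℝ × ℝ)).add_const (0, Real.pi / 2)
    refine this.congr_of_eventuallyEq (Eventually.of_forall fun q => ?_)
    simp [Prod.ext_iff]
  have hd1 := (((hasFDerivAt_revolve S.frame (p := (t, φ + Real.pi / 2)) (hasDerivAt_const t 0)
    hz.self_of_nhds).const_add 0).comp ((t, φ) : ℝ × ℝ) hshift).fderiv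
  have e01 : partialD 0 (partialD 1 S.map) (t, φ) =
      (0 : ℝ) • S.frame 0 + (s t * Real.cos φ) • S.frame 1 +
        (-(s t * Real.sin φ)) • S.frame 2 := by
    rw [partialD_congr 0 e1, partialD]
    refine (congrArg (fun L : ℝ × ℝ →L[ℝ] E3 => L _) hd1).trans ?_
    simp [Real.sin_add_pi_div_two, Real.cos_add_pi_div_two]
  have e11 : partialD 1 (partialD 1 S.map) (t, φ) =
      (0 : ℝ) • S.frame 0 + (-(S.z t * Real.sin φ)) • S.frame 1 +
        (-(S.z t * Real.cos φ)) • S.frame 2 := by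
    rw [partialD_congr 1 e1, partialD]
    refine (congrArg (fun L : ℝ × ℝ →L[ℝ] E3 => L _) hd1).trans ?_
    simp [Real.sin_add_pi_div_two, Real.cos_add_pi_div_two]
  have f0 : partialD 0 S.map (t, φ) = c t • S.frame 0 + (s t * Real.sin φ) • S.frame 1 +
      (s t * Real.cos φ) • S.frame 2 := by
    rw [map_eq_revolve, partialD_zero_revolve S.frame _ (p := (t, φ)) hx.self_of_nhds
      hz.self_of_nhds]
  have f1 : partialD 1 S.map (t, φ) = (0 : ℝ) • S.frame 0 + (S.z t * Real.cos φ) • S.frame 1 +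
      (-(S.z t * Real.sin φ)) • S.frame 2 := by
    rw [map_eq_revolve, partialD_one_revolve S.frame _ (p := (t, φ)) hx.self_of_nhds
      hz.self_of_nhds]
  have hI : firstForm S.map (t, φ) = !![1, 0; 0, S.z t ^ 2] := by
    ext i j
    fin_cases i <;> fin_cases j <;>
      simp only [firstForm, Matrix.of_apply, Fin.zero_eta, Fin.mk_one, f0, f1, inner_frame_comb,
        Matrix.cons_val', Matrix.cons_val_zero, Matrix.cons_val_one, Matrix.cons_val_fin_one]
    · linear_combination hunit + s t ^ 2 * hφ
    · ring
    · ring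
    · linear_combination S.z t ^ 2 * hφ
  have hinv : (firstForm S.map (t, φ))⁻¹ = !![1, 0; 0, (S.z t ^ 2)⁻¹] := by
    refine Matrix.inv_eq_left_inv ?_
    rw [hI, Matrix.mul_fin_two, Matrix.one_fin_two]
    simp [hz0]
  set n : E3 := n₀ • S.frame 0 + (ν * Real.sin φ) • S.frame 1 + (ν * Real.cos φ) • S.frame 2
  have hII : secondForm S.map (t, φ) n = !![n₀ * c' + ν * s', 0; 0, -(S.z t * ν)] := by
    ext i j
    fin_cases i <;> fin_cases j <;>
      simp only [secondForm, Matrix.of_apply, Fin.zero_eta, Fin.mk_one, e00, e01, e10, e11,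
        inner_frame_comb, n,
        Matrix.cons_val', Matrix.cons_val_zero, Matrix.cons_val_one, Matrix.cons_val_fin_one]
    · linear_combination ν * s' * hφ
    · ring
    · ring
    · linear_combination -(S.z t * ν) * hφ
  have hν : ν ^ 2 = c t ^ 2 := by
    linear_combination ν ^ 2 * (-hunit) + c t ^ 2 * h1 + (ν * s t - n₀ * c t) * h2
  have hn₀ : n₀ ^ 2 = s t ^ 2 := by linarith
  have hnν : n₀ * ν = -(c t * s t) := by
    linear_combination -(n₀ * ν) * hunit + (c t * ν + s t * n₀) * h2 - c t * s t * h1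
  rw [shapeOperator, hinv, hII, Matrix.mul_fin_two, Matrix.mul_fin_two, Matrix.trace_fin_two_of]
  have hν' : ν ^ 2 / S.z t ^ 2 = (c t / S.z t) ^ 2 := by rw [hν, div_pow]
  rw [← hν']
  field_simp
  linear_combination S.z t ^ 2 * (c' ^ 2 * hn₀ + s' ^ 2 * hν + 2 * c' * s' * hnν)

lemma exists_isUnitNormal (φ : ℝ) (hx : HasDerivAt S.x (c t) t)
    (hz : HasDerivAt S.z (s t) t) (hpos : 0 < S.z t) (hunit : c t ^ 2 + s t ^ 2 = 1) :
    ∃ n, IsUnitNormal S.map (t, φ) n :=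
  ⟨_, (isUnitNormal_iff φ _ hx hz hpos).2 ⟨-s t, c t, by linarith, by ring, rfl⟩⟩

end Shape

/-! ### Regularity of a rotational surface and of its profile -/

lemma contDiffOn_map {S : RotSurface} {J : Set ℝ} {k : WithTop ℕ∞} (hx : ContDiffOn ℝ k S.x J)
    (hz : ContDiffOn ℝ k S.z J) : ContDiffOn ℝ k S.map (J ×ˢ univ) := by
  have hfst : MapsTo (Prod.fst : ℝ × ℝ → ℝ) (J ×ˢ univ) J := fun p hp => hp.1
  have h1 := hx.comp contDiff_fst.contDiffOn hfst
  have h2 := hz.comp contDiff_fst.contDiffOn hfst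
  have h3 : ContDiffOn ℝ k (fun p : ℝ × ℝ => Real.sin p.2) (J ×ˢ univ) :=
    (Real.contDiff_sin.comp contDiff_snd).contDiffOn
  have h4 : ContDiffOn ℝ k (fun p : ℝ × ℝ => Real.cos p.2) (J ×ˢ univ) :=
    (Real.contDiff_cos.comp contDiff_snd).contDiffOn
  rw [map_eq_revolve]
  exact contDiffOn_const.add (((h1.smul contDiffOn_const).add
    ((h2.mul h3).smul contDiffOn_const)).add ((h2.mul h4).smul contDiffOn_const))

lemma contDiffOn_profile {S : RotSurface} {J : Set ℝ} {k : WithTop ℕ∞}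
    (h : ContDiffOn ℝ k S.map (J ×ˢ univ)) : ContDiffOn ℝ k S.x J ∧ ContDiffOn ℝ k S.z J := by
  have h1 : ContDiffOn ℝ k (fun t => S.map (t, 0) - S.g 0) J :=
    (h.comp (contDiff_id.prodMk contDiff_const).contDiffOn fun t ht => ⟨ht, mem_univ _⟩).sub
      contDiffOn_const
  have hval : ∀ t, S.map (t, 0) - S.g 0 =
      S.x t • S.frame 0 + (0 : ℝ) • S.frame 1 + S.z t • S.frame 2 := fun t => by
    rw [map_eq_revolve]
    simp [revolve]
  have hx : ∀ t, S.x t = inner ℝ ((1 : ℝ) • S.frame 0 + (0 : ℝ) • S.frame 1 +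
      (0 : ℝ) • S.frame 2) (S.map (t, 0) - S.g 0) := fun t => by
    rw [hval, inner_frame_comb]; ring
  have hz : ∀ t, S.z t = inner ℝ ((0 : ℝ) • S.frame 0 + (0 : ℝ) • S.frame 1 +
      (1 : ℝ) • S.frame 2) (S.map (t, 0) - S.g 0) := fun t => by
    rw [hval, inner_frame_comb]; ring
  exact ⟨(contDiffOn_const.inner ℝ h1).congr fun t _ => hx t,
    (contDiffOn_const.inner ℝ h1).congr fun t _ => hz t⟩

lemma isOfClass_of_univ {S : RotSurface} {k : ℕ∞} (hI : S.I = univ) (hk : 1 ≤ k)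
    (hx : ContDiff ℝ k S.x) (hz : ContDiff ℝ k S.z) (hpos : ∀ t, 0 < S.z t)
    (hunit : ∀ t, deriv S.x t ^ 2 + deriv S.z t ^ 2 = 1) : S.IsOfClass k where
  ordConnected := hI ▸ ordConnected_univ
  nonempty_interior := by rw [hI, interior_univ]; exact univ_nonempty
  continuousOn_x := hx.continuous.continuousOn
  continuousOn_z := hz.continuous.continuousOn
  nonneg := fun t _ => (hpos t).le
  pos_iff := fun t _ => by simp [hI, hpos t]
  contDiffOn := contDiffOn_map hx.contDiffOn hz.contDiffOn
  immersion := by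
    rintro ⟨t, φ⟩ -
    have hk' : (k : WithTop ℕ∞) ≠ 0 := by
      have : k ≠ 0 := (one_pos.trans_le hk).ne'
      exact_mod_cast this
    have h1 := (hx.differentiable hk' t).hasDerivAt
    have h2 := (hz.differentiable hk' t).hasDerivAt
    have hd := ((hasFDerivAt_revolve S.frame (p := (t, φ)) h1 h2).const_add (S.g 0)).fderiv
    rw [map_eq_revolve, hd, injective_iff_map_eq_zero]
    rintro ⟨v, w⟩ h0
    have hφ := Real.sin_sq_add_cos_sq φ
    have h3 : (v * deriv S.x t) • S.frame 0 +
        (v * (deriv S.z t * Real.sin φ) + w * (S.z t * Real.cos φ)) • S.frame 1 +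
        (v * (deriv S.z t * Real.cos φ) - w * (S.z t * Real.sin φ)) • S.frame 2 = 0 := by
      rw [← h0]
      simp only [add_apply, ContinuousLinearMap.smulRight_apply,
        ContinuousLinearMap.coe_fst', ContinuousLinearMap.coe_snd']
      module
    have h4 : v ^ 2 + w ^ 2 * S.z t ^ 2 = 0 := by
      have := norm_sq_frame_comb S.frame (v * deriv S.x t)
        (v * (deriv S.z t * Real.sin φ) + w * (S.z t * Real.cos φ))
        (v * (deriv S.z t * Real.cos φ) - w * (S.z t * Real.sin φ))
      rw [h3, norm_zero] at this
      linear_combination -this - v ^ 2 * hunit t - v ^ 2 * deriv S.z t ^ 2 * hφ -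
        w ^ 2 * S.z t ^ 2 * hφ
    have hz2 : 0 < S.z t ^ 2 := pow_pos (hpos t) 2
    have hv : v ^ 2 = 0 := by nlinarith [sq_nonneg v, mul_nonneg (sq_nonneg w) hz2.le]
    have hw : w ^ 2 * S.z t ^ 2 = 0 := by linarith
    rw [mul_eq_zero, or_iff_left hz2.ne'] at hw
    simp only [Prod.mk_eq_zero]
    exact ⟨pow_eq_zero_iff two_ne_zero |>.1 hv, pow_eq_zero_iff two_ne_zero |>.1 hw⟩
  unit_speed := fun t _ => hunit t
  pole := fun t _ h => absurd h (hpos t).ne'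

/-! ### Completeness -/

/-- A unit speed plane curve of curvature at most `1` moves in its initial direction by at least
`δ / 2` during the time `δ ≤ 1`. -/
lemma half_le_displacement {x z c s κ : ℝ → ℝ} (hx : ∀ t, HasDerivAt x (c t) t)
    (hz : ∀ t, HasDerivAt z (s t) t) (hc : ∀ t, HasDerivAt c (-(s t * κ t)) t)
    (hs : ∀ t, HasDerivAt s (c t * κ t) t) (hunit : ∀ t, c t ^ 2 + s t ^ 2 = 1)
    (hκ : ∀ t, |κ t| ≤ 1) (t : ℝ) {δ : ℝ} (h0 : 0 ≤ δ) (h1 : δ ≤ 1) :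
    δ / 2 ≤ c t * (x (t + δ) - x t) + s t * (z (t + δ) - z t) := by
  have hslope : ∀ r, t ≤ r → 1 - (r - t) ≤ c t * c r + s t * s r := by
    intro r hr
    have hd : ∀ r, HasDerivAt (fun r => c t * c r + s t * s r + r)
        (c t * -(s r * κ r) + s t * (c r * κ r) + 1) r := fun r =>
      (((hc r).const_mul _).add ((hs r).const_mul _)).add (hasDerivAt_id r)
    have hm : Monotone (fun r => c t * c r + s t * s r + r) := by
      refine monotone_of_deriv_nonneg (fun r => (hd r).differentiableAt) fun r => ?_
      rw [(hd r).deriv]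
      have h3 : (c t * s r - s t * c r) ^ 2 ≤ 1 := by
        nlinarith [hunit t, hunit r, sq_nonneg (c t * c r + s t * s r)]
      have h4 : |(c t * s r - s t * c r) * κ r| ≤ 1 := by
        rw [abs_mul]
        exact mul_le_one₀ ((sq_le_one_iff_abs_le_one _).1 h3) (abs_nonneg _) (hκ r)
      linarith [(abs_le.1 h4).2]
    have := hm hr
    simp only at this
    nlinarith [hunit t]
  have hd : ∀ r, HasDerivAt (fun r => c t * x r + s t * z r - r + (r - t) ^ 2 / 2)
      (c t * c r + s t * s r - 1 + (r - t)) r := fun r => by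
    refine ((((hx r).const_mul _).add ((hz r).const_mul _)).sub (hasDerivAt_id r)).add
      ((((hasDerivAt_id r).sub_const t).pow 2).div_const 2) |>.congr_deriv ?_
    simp
  have hm : MonotoneOn (fun r => c t * x r + s t * z r - r + (r - t) ^ 2 / 2) (Ici t) := by
    refine monotoneOn_of_deriv_nonneg (convex_Ici t)
      (fun r _ => (hd r).continuousAt.continuousWithinAt)
      (fun r _ => (hd r).differentiableAt.differentiableWithinAt) fun r hr => ?_
    rw [interior_Ici] at hr
    rw [(hd r).deriv]
    linarith [hslope r (le_of_lt hr)]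
  have := hm (mem_Ici.2 le_rfl) (mem_Ici.2 (by linarith : t ≤ t + δ)) (by linarith)
  simp only [sub_self, add_sub_cancel_left] at this
  nlinarith

/-- A rotational surface over the whole line whose profile has curvature at most `1` is complete:
along a path of finite length the profile parameter cannot oscillate, nor go to infinity. -/
lemma isComplete_of_univ {S : RotSurface} {c s κ : ℝ → ℝ} (hI : S.I = univ)
    (hx : ∀ t, HasDerivAt S.x (c t) t) (hz : ∀ t, HasDerivAt S.z (s t) t)
    (hc : ∀ t, HasDerivAt c (-(s t * κ t)) t) (hs : ∀ t, HasDerivAt s (c t * κ t) t)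
    (hunit : ∀ t, c t ^ 2 + s t ^ 2 = 1) (hκ : ∀ t, |κ t| ≤ 1) (hpos : ∀ t, 0 < S.z t) :
    S.IsComplete := by
  intro γ hγ hmem hfin
  have hnhds : 𝓝[Ico 0 1 ∩ Iio (1 : ℝ)] 1 = 𝓝[<] 1 := by
    have : Ico (0 : ℝ) 1 ∩ Iio 1 = Ico 0 1 := inter_eq_left.2 fun r hr => hr.2
    rw [this, nhdsWithin_Ico_eq_nhdsLT one_pos]
  obtain ⟨p, hp⟩ := BoundedVariationOn.exists_tendsto_left (x := (1 : ℝ)) (show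
    BoundedVariationOn (fun r => (γ r).2) (Ico 0 1) from hfin)
  rw [hnhds] at hp
  have hex : ∀ r : ℝ, r ∈ Ico (0 : ℝ) 1 → ∃ φ : ℝ, (γ r).2 = S.map ((γ r).1, φ) :=
    fun r hr => (hmem hr).2
  choose! φ hφ using hex
  -- close points in space have close parameters, if the parameters are within distance `1`
  have key : ∀ r ∈ Ico (0 : ℝ) 1, ∀ r' ∈ Ico (0 : ℝ) 1, ∀ δ, 0 ≤ δ → δ ≤ 1 →
      (γ r').1 = (γ r).1 + δ → δ / 2 ≤ dist (γ r).2 (γ r').2 := by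
    intro r hr r' hr' δ h0 h1 hδ
    have h2 := half_le_displacement hx hz hc hs hunit hκ (γ r).1 h0 h1
    rw [← hδ] at h2
    have h3 := S.profile_dist_le (φ := φ r) (φ' := φ r') (hpos (γ r).1).le (hpos (γ r').1).le
    rw [← hφ r hr, ← hφ r' hr'] at h3
    refine le_of_sq_le_sq ?_ dist_nonneg
    refine (pow_le_pow_left₀ (by linarith) h2 2).trans (le_trans ?_ h3)
    have h4 := hunit (γ r).1
    set C := c (γ r).1
    set D := s (γ r).1
    set X := S.x (γ r').1 - S.x (γ r).1
    set Z := S.z (γ r').1 - S.z (γ r).1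
    have h5 : (S.x (γ r).1 - S.x (γ r').1) ^ 2 + (S.z (γ r).1 - S.z (γ r').1) ^ 2 =
      X ^ 2 + Z ^ 2 := by ring
    rw [h5]
    nlinarith [sq_nonneg (C * Z - D * X)]
  have hcauchy : ∀ ε > 0, ∃ r₀ ∈ Ico (0 : ℝ) 1, ∀ r ∈ Ico r₀ 1, ∀ r' ∈ Ico r₀ 1,
      |(γ r).1 - (γ r').1| < ε := by
    intro ε hε
    set δ := min ε 1 with hδ
    have hδ0 : 0 < δ := lt_min hε one_pos
    have hev := (Metric.tendsto_nhds.1 hp (δ / 4) (by positivity)).and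
      (Ico_mem_nhdsLT (show (0 : ℝ) < 1 by norm_num))
    obtain ⟨r₁, hr₁, hsub⟩ := (mem_nhdsLT_iff_exists_Ico_subset).1 hev
    refine ⟨max r₁ 0, ⟨le_max_right _ _, max_lt hr₁ one_pos⟩, ?_⟩
    -- otherwise the parameter would change by exactly `δ` between two times
    have hle : ∀ r ∈ Ico (max r₁ 0) 1, ∀ r' ∈ Ico (max r₁ 0) 1,
        (γ r').1 - (γ r).1 < δ := by
      intro r hr r' hr'
      by_contra! hge
      have hsubI : uIcc r r' ⊆ Ico (max r₁ 0) 1 := ordConnected_Ico.uIcc_subset hr hr'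
      have hcont : ContinuousOn (fun r => (γ r).1) (uIcc r r') :=
        (continuous_fst.comp_continuousOn hγ).mono fun q hq =>
          ⟨(le_max_right _ _).trans (hsubI hq).1, (hsubI hq).2⟩
      obtain ⟨q, hq, hqe⟩ := intermediate_value_uIcc hcont
        (show (γ r).1 + δ ∈ uIcc (γ r).1 (γ r').1 from by
          rw [uIcc_of_le (by linarith)]; constructor <;> linarith)
      have hmemr := hsub ⟨(le_max_left _ _).trans hr.1, hr.2⟩
      have hmemq := hsub ⟨(le_max_left _ _).trans (hsubI hq).1, (hsubI hq).2⟩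
      have h3 := key r hmemr.2 q hmemq.2 δ hδ0.le (min_le_right _ _) hqe
      have h4 := dist_triangle_right (γ r).2 (γ q).2 p
      linarith [hmemr.1, hmemq.1]
    intro r hr r' hr'
    rw [abs_lt]
    have h3 := hle r hr r' hr'
    have h4 := hle r' hr' r hr
    constructor <;> linarith [min_le_left ε 1]
  obtain ⟨t, ht⟩ : ∃ t, Tendsto (fun r => (γ r).1) (𝓝[<] 1) (𝓝 t) := by
    refine cauchy_map_iff_exists_tendsto.1 ?_
    refine Metric.cauchy_iff.2 ⟨inferInstance, fun ε hε => ?_⟩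
    obtain ⟨r₀, hr₀, h⟩ := hcauchy ε hε
    refine ⟨_, image_mem_map (Ico_mem_nhdsLT hr₀.2), ?_⟩
    rintro _ ⟨r, hr, rfl⟩ _ ⟨r', hr', rfl⟩
    exact h r hr r' hr'
  refine ⟨(t, p), ⟨by simp [hI], ?_⟩, ht.prodMk_nhds hp⟩
  -- the circle over `t` is compact
  have hxc : Continuous S.x := continuous_iff_continuousAt.2 fun t => (hx t).continuousAt
  have hzc : Continuous S.z := continuous_iff_continuousAt.2 fun t => (hz t).continuousAt
  have hy := (S.g.symm.continuous.tendsto p).comp hp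
  set y := S.g.symm p with hyd
  have hev : ∀ᶠ r in 𝓝[<] (1 : ℝ), r ∈ Ico (0 : ℝ) 1 := Ico_mem_nhdsLT one_pos
  have hg : ∀ r ∈ Ico (0 : ℝ) 1, S.g.symm (γ r).2 =
      !₂[S.x (γ r).1, S.z (γ r).1 * Real.sin (φ r), S.z (γ r).1 * Real.cos (φ r)] := by
    intro r hr
    rw [hφ r hr, map, AffineIsometryEquiv.symm_apply_apply]
  have hcoord : ∀ i : Fin 3, Tendsto (fun r => S.g.symm (γ r).2 i) (𝓝[<] 1) (𝓝 (y i)) :=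
    fun i => ((EuclideanSpace.proj (𝕜 := ℝ) i).continuous.tendsto y).comp hy
  have hx0 : y 0 = S.x t := by
    refine tendsto_nhds_unique (hcoord 0) (((hxc.tendsto t).comp ht).congr' ?_)
    filter_upwards [hev] with r hr
    rw [hg r hr]; simp
  have hz0 : y 1 ^ 2 + y 2 ^ 2 = S.z t ^ 2 := by
    refine tendsto_nhds_unique (((hcoord 1).pow 2).add ((hcoord 2).pow 2))
      ((((hzc.tendsto t).comp ht).pow 2).congr' ?_)
    filter_upwards [hev] with r hr
    rw [hg r hr]
    simp only [Function.comp_apply]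
    have := Real.sin_sq_add_cos_sq (φ r)
    simp
    linear_combination -(S.z (γ r).1 ^ 2) * this
  have hz1 : 0 < S.z t := hpos t
  refine ⟨Complex.arg ⟨y 2, y 1⟩, ?_⟩
  have hnorm : ‖(⟨y 2, y 1⟩ : ℂ)‖ = S.z t := by
    rw [Complex.norm_def, Complex.normSq_mk, ← Real.sqrt_sq hz1.le, ← hz0]
    congr 1; ring
  have hs1 := Complex.norm_mul_sin_arg ⟨y 2, y 1⟩
  have hc1 := Complex.norm_mul_cos_arg ⟨y 2, y 1⟩
  rw [hnorm] at hs1 hc1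
  rw [map]
  simp only [hs1, hc1, ← hx0]
  have : (!₂[y 0, y 1, y 2] : E3) = y := by
    ext i; fin_cases i <;> simp
  rw [this, hyd, AffineIsometryEquiv.apply_symm_apply]

/-- A finite end of the parameter interval of a complete surface belongs to the interval. -/
lemma IsComplete.mem_of_segment {S : RotSurface} {k : ℕ∞} (hS : S.IsOfClass k) (hk : 1 ≤ k)
    (hcomp : S.IsComplete) {t₀ b : ℝ}
    (hb : ∀ r ∈ Ico (0 : ℝ) 1, t₀ + r * (b - t₀) ∈ interior S.I) : b ∈ S.I := by
  have hk' : (k : WithTop ℕ∞) ≠ 0 := by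
    have : k ≠ 0 := (one_pos.trans_le hk).ne'
    exact_mod_cast this
  obtain ⟨hx, hz⟩ := contDiffOn_profile hS.contDiffOn
  have hopen : IsOpen (interior S.I) := isOpen_interior
  set F : ℝ → E3 := fun r => S.map (t₀ + r * (b - t₀), 0) with hF
  have hd : ∀ r ∈ Ico (0 : ℝ) 1, HasDerivAt F ((b - t₀) •
      (deriv S.x (t₀ + r * (b - t₀)) • S.frame 0 + (0 : ℝ) • S.frame 1 +
        deriv S.z (t₀ + r * (b - t₀)) • S.frame 2)) r := by
    intro r hr
    have h1 := ((hx.differentiableOn hk').differentiableAt (hopen.mem_nhds (hb r hr))).hasDerivAt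
    have h2 := ((hz.differentiableOn hk').differentiableAt (hopen.mem_nhds (hb r hr))).hasDerivAt
    have h3 : HasDerivAt (fun r => t₀ + r * (b - t₀)) (b - t₀) r := by
      simpa using ((hasDerivAt_id r).mul_const (b - t₀)).const_add t₀
    have h4 := (((h1.comp r h3).smul_const (S.frame 0)).add
      ((h2.comp r h3).smul_const (S.frame 2))).const_add (S.g 0)
    have h5 : F = fun r => S.g 0 + ((S.x ∘ fun r => t₀ + r * (b - t₀)) r • S.frame 0 +
        (S.z ∘ fun r => t₀ + r * (b - t₀)) r • S.frame 2) := by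
      funext r
      simp [hF, map_eq_revolve, revolve]
    rw [h5]
    refine h4.congr_deriv ?_
    module
  have hlip : LipschitzOnWith ‖b - t₀‖₊ F (Ico 0 1) := by
    refine (convex_Ico 0 1).lipschitzOnWith_of_nnnorm_hasDerivWithin_le
      (fun r hr => (hd r hr).hasDerivWithinAt) fun r hr => ?_
    rw [nnnorm_smul]
    refine mul_le_of_le_one_right' (NNReal.coe_le_coe.1 ?_)
    have h6 := norm_sq_frame_comb S.frame (deriv S.x (t₀ + r * (b - t₀))) 0
      (deriv S.z (t₀ + r * (b - t₀)))
    have h7 := hS.unit_speed _ (hb r hr)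
    rw [coe_nnnorm, NNReal.coe_one]
    refine ((sq_le_one_iff₀ (norm_nonneg _)).1 ?_)
    rw [h6]; linarith
  have hbv : BoundedVariationOn F (Ico 0 1) := by
    have h1 : BoundedVariationOn (id : ℝ → ℝ) (Ico 0 1) :=
      ((monotone_id.monotoneOn univ).locallyBoundedVariationOn 0 1 (mem_univ _)
        (mem_univ _)).mono fun r hr => ⟨mem_univ _, Ico_subset_Icc_self hr⟩
    exact hlip.comp_boundedVariationOn (fun r hr => hr) h1
  obtain ⟨m, hm, hlim⟩ := hcomp (fun r => (t₀ + r * (b - t₀), F r))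
    ((by fun_prop : Continuous fun r : ℝ => t₀ + r * (b - t₀)).continuousOn.prodMk
      hlip.continuousOn)
    (fun r hr => ⟨interior_subset (hb r hr), 0, rfl⟩) hbv
  have h8 : Tendsto (fun r : ℝ => t₀ + r * (b - t₀)) (𝓝[<] 1) (𝓝 (t₀ + 1 * (b - t₀))) :=
    ((by fun_prop : Continuous fun r : ℝ => t₀ + r * (b - t₀)).tendsto 1).mono_left
      nhdsWithin_le_nhds
  have h9 := tendsto_nhds_unique ((continuous_fst.tendsto m).comp hlim) h8
  have h10 : m.1 = b := by rw [h9]; ring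
  exact h10 ▸ hm.1

/-! ### Surfaces that cross themselves -/

/-- A surface whose profile crosses itself transversally is not embedded: the differential of a
local equation would have to vanish on three independent vectors. -/
lemma not_isEmbeddedSurface_of_crossing {S : RotSurface} {t₁ t₂ c₁ s₁ c₂ s₂ : ℝ}
    (hI : S.I = univ) (hx₁ : HasDerivAt S.x c₁ t₁) (hz₁ : HasDerivAt S.z s₁ t₁)
    (hx₂ : HasDerivAt S.x c₂ t₂) (hz₂ : HasDerivAt S.z s₂ t₂) (hx : S.x t₁ = S.x t₂)
    (hz : S.z t₁ = S.z t₂) (hpos : S.z t₁ ≠ 0) (hdet : c₁ * s₂ - c₂ * s₁ ≠ 0) :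
    ¬ IsEmbeddedSurface S.carrier := by
  intro hemb
  have hmem : ∀ q, S.map q ∈ S.carrier := fun q =>
    ⟨(q.1, S.map q), ⟨by simp [hI], q.2, rfl⟩, rfl⟩
  have heq : S.map (t₁, 0) = S.map (t₂, 0) := by simp only [map, hx, hz]
  obtain ⟨U, G, hU, hpU, hG, hAU, hne⟩ := hemb _ (hmem (t₁, 0))
  have hGd : DifferentiableAt ℝ G (S.map (t₁, 0)) :=
    (hG.differentiableOn one_ne_zero).differentiableAt (hU.mem_nhds hpU)
  have hzero : ∀ {t c s : ℝ}, HasDerivAt S.x c t → HasDerivAt S.z s t →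
      S.map (t, 0) = S.map (t₁, 0) → ∀ v w : ℝ, fderiv ℝ G (S.map (t₁, 0))
        (v • (c • S.frame 0 + s • S.frame 2) + (w * S.z t) • S.frame 1) = 0 := by
    intro t c s h1 h2 h3 v w
    have h4 := (hasFDerivAt_revolve S.frame (p := (t, 0)) h1 h2).const_add (S.g 0)
    rw [← map_eq_revolve] at h4
    have h5 : HasFDerivAt (G ∘ S.map) _ (t, 0) := (h3 ▸ hGd.hasFDerivAt).comp (t, (0 : ℝ)) h4
    have h6 : G ∘ S.map =ᶠ[𝓝 (t, 0)] fun _ => 0 := by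
      have : S.map ⁻¹' U ∈ 𝓝 (t, (0 : ℝ)) :=
        h4.continuousAt.preimage_mem_nhds (h3 ▸ hU.mem_nhds hpU)
      filter_upwards [this] with q hq
      have : S.map q ∈ {q ∈ U | G q = 0} := hAU ▸ ⟨hmem q, hq⟩
      exact this.2
    have h7 := (h5.congr_of_eventuallyEq h6.symm).unique (hasFDerivAt_const 0 (t, (0 : ℝ)))
    have h8 := congrArg (fun L : ℝ × ℝ →L[ℝ] ℝ => L (v, w)) h7
    simp only [ContinuousLinearMap.comp_apply, add_apply,
      ContinuousLinearMap.smulRight_apply, ContinuousLinearMap.coe_fst',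
      ContinuousLinearMap.coe_snd', Real.sin_zero, Real.cos_zero,
      zero_apply] at h8
    rw [← h3]
    refine Eq.trans ?_ h8
    congr 1
    module
  refine hne _ ⟨hmem _, hpU⟩ ?_
  set L := fderiv ℝ G (S.map (t₁, 0))
  have hA : L (c₁ • S.frame 0 + s₁ • S.frame 2) = 0 := by
    simpa using hzero hx₁ hz₁ rfl 1 0
  have hB : L (c₂ • S.frame 0 + s₂ • S.frame 2) = 0 := by
    simpa using hzero hx₂ hz₂ heq.symm 1 0
  have hC : L (S.frame 1) = 0 := by
    have := hzero hx₁ hz₁ rfl 0 1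
    simp only [zero_smul, zero_add, one_mul, map_smul, smul_eq_mul] at this
    exact (mul_eq_zero.1 this).resolve_left hpos
  simp only [map_add, map_smul, smul_eq_mul] at hA hB
  have h0 : L (S.frame 0) = 0 := by
    refine (mul_eq_zero.1 (?_ : (c₁ * s₂ - c₂ * s₁) * L (S.frame 0) = 0)).resolve_left hdet
    linear_combination s₂ * hA - s₁ * hB
  have h2 : L (S.frame 2) = 0 := by
    refine (mul_eq_zero.1 (?_ : (c₁ * s₂ - c₂ * s₁) * L (S.frame 2) = 0)).resolve_left hdet
    linear_combination c₁ * hB - c₂ * hA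
  ext v
  rw [frame_expand S.frame v]
  simp [h0, hC, h2]

end RotSurface

/-! ### Profiles of surfaces with `|A| = 1` -/

/-- The equations of the profile of a rotational surface with `|A| = 1` over the open set `J`:
`(x, z)` is the profile curve, `(c, s)` its unit tangent, `κ` its curvature. -/
structure UnitProfile (J : Set ℝ) (x z c s κ : ℝ → ℝ) : Prop where
  deriv_x : ∀ t ∈ J, HasDerivAt x (c t) t
  deriv_z : ∀ t ∈ J, HasDerivAt z (s t) t
  deriv_c : ∀ t ∈ J, HasDerivAt c (-(s t * κ t)) t
  deriv_s : ∀ t ∈ J, HasDerivAt s (c t * κ t) t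
  continuousOn_curv : ContinuousOn κ J
  unit : ∀ t ∈ J, c t ^ 2 + s t ^ 2 = 1
  curv : ∀ t ∈ J, κ t ^ 2 + (c t / z t) ^ 2 = 1
  pos : ∀ t ∈ J, 0 < z t

/-- A function with derivative zero between two points takes the same value there. -/
lemma eq_of_hasDerivAt_zero {f : ℝ → ℝ} {p q : ℝ} (h : ∀ r ∈ uIcc p q, HasDerivAt f 0 r) :
    f p = f q := by
  have := (convex_uIcc p q).norm_image_sub_le_of_norm_hasDerivWithin_le (C := 0)
    (fun r hr => (h r hr).hasDerivWithinAt) (fun r _ => by simp) right_mem_uIcc left_mem_uIcc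
  rw [zero_mul, norm_le_zero_iff, sub_eq_zero] at this
  exact this

/-- A positive function cannot decrease at a rate bounded away from zero for ever. -/
lemma not_pos_of_deriv_le {f f' : ℝ → ℝ} {t₁ m : ℝ} (hm : 0 < m)
    (hd : ∀ t, t₁ ≤ t → HasDerivAt f (f' t) t) (hf : ∀ t, t₁ ≤ t → f' t ≤ -m)
    (hpos : ∀ t, t₁ ≤ t → 0 < f t) : False := by
  have hanti : AntitoneOn (fun t => f t + m * t) (Ici t₁) := by
    have hd' : ∀ t, t₁ ≤ t → HasDerivAt (fun t => f t + m * t) (f' t + m * 1) t := fun t ht =>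
      (hd t ht).add ((hasDerivAt_id t).const_mul m)
    refine antitoneOn_of_deriv_nonpos (convex_Ici _)
      (fun t ht => (hd' t ht).continuousAt.continuousWithinAt)
      (fun t ht => (hd' t (interior_subset ht)).differentiableAt.differentiableWithinAt)
      fun t ht => ?_
    rw [(hd' t (interior_subset ht)).deriv]
    linarith [hf t (interior_subset ht)]
  have hp := hpos t₁ le_rfl
  have h1 : t₁ ≤ t₁ + f t₁ / m := by linarith [div_pos hp hm]
  have h2 := hanti (mem_Ici.2 le_rfl) (mem_Ici.2 h1) h1
  have h3 := hpos _ h1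
  simp only [mul_add, mul_div_cancel₀ _ hm.ne'] at h2
  linarith

/-- A continuous function that is negative at `t₀` is negative on `[t₀, ∞)` or has a first zero. -/
lemma neg_or_exists_first_zero {κ : ℝ → ℝ} (hκ : Continuous κ) {t₀ : ℝ} (h : κ t₀ < 0) :
    (∀ t, t₀ ≤ t → κ t < 0) ∨ ∃ q, t₀ < q ∧ κ q = 0 ∧ ∀ t, t₀ ≤ t → t < q → κ t < 0 := by
  by_cases hall : ∀ t, t₀ ≤ t → κ t < 0
  · exact Or.inl hall
  right
  push Not at hall
  obtain ⟨t₁, h1, h2⟩ := hall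
  set Z := {t | 0 ≤ κ t} ∩ Icc t₀ t₁ with hZ
  have hcomp : IsCompact Z := isCompact_Icc.inter_left (isClosed_le continuous_const hκ)
  obtain ⟨q, hq⟩ := hcomp.exists_isLeast ⟨t₁, h2, h1, le_rfl⟩
  have hlt : ∀ t, t₀ ≤ t → t < q → κ t < 0 := by
    intro t ht htq
    by_contra! hk
    exact absurd (hq.2 ⟨hk, ht, htq.le.trans hq.1.2.2⟩) (not_le.2 htq)
  have hne : t₀ < q := by
    refine lt_of_le_of_ne hq.1.2.1 ?_
    rintro rfl
    exact absurd hq.1.1 (not_le.2 h)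
  refine ⟨q, hne, le_antisymm ?_ hq.1.1, hlt⟩
  refine le_of_tendsto (hκ.continuousAt.tendsto.mono_left nhdsWithin_le_nhds :
    Tendsto κ (𝓝[<] q) _) ?_
  filter_upwards [Ioo_mem_nhdsLT hne] with t ht using (hlt t ht.1.le ht.2).le

/-- The first integral of the profile equation, constant where the curvature is negative; its
value is the square of the scale of the profile, if it is positive. -/
noncomputable def firstIntegral (z c κ : ℝ → ℝ) (t : ℝ) : ℝ :=
  -(z t * (z t * κ t + c t)) * Real.exp (-Real.arccos (-(c t / z t)))

namespace UnitProfile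

variable {J : Set ℝ} {x z c s κ : ℝ → ℝ}

lemma reflect (h : UnitProfile J x z c s κ) :
    UnitProfile J (fun t => -x t) z (fun t => -c t) s (fun t => -κ t) where
  deriv_x := fun t ht => (h.deriv_x t ht).neg
  deriv_z := h.deriv_z
  deriv_c := fun t ht => (h.deriv_c t ht).neg.congr_deriv (by ring)
  deriv_s := fun t ht => (h.deriv_s t ht).congr_deriv (by ring)
  continuousOn_curv := h.continuousOn_curv.neg
  unit := fun t ht => by rw [neg_sq]; exact h.unit t ht
  curv := fun t ht => by rw [neg_sq, neg_div, neg_sq]; exact h.curv t ht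
  pos := h.pos

lemma reverse (h : UnitProfile univ x z c s κ) :
    UnitProfile univ (fun t => -x (-t)) (fun t => z (-t)) (fun t => c (-t)) (fun t => -s (-t))
      (fun t => κ (-t)) := by
  have key : ∀ {f f' : ℝ → ℝ}, (∀ t ∈ univ, HasDerivAt f (f' t) t) →
      ∀ t, HasDerivAt (fun t => f (-t)) (-f' (-t)) t := fun hf t => by
    have := (hf (-t) (mem_univ _)).comp t (hasDerivAt_neg t)
    rwa [mul_neg_one] at this
  exact
    { deriv_x := fun t _ => ((key h.deriv_x t).neg).congr_deriv (by ring)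
      deriv_z := fun t _ => key h.deriv_z t
      deriv_c := fun t _ => (key h.deriv_c t).congr_deriv (by ring)
      deriv_s := fun t _ => ((key h.deriv_s t).neg).congr_deriv (by ring)
      continuousOn_curv := h.continuousOn_curv.comp continuous_neg.continuousOn
        (mapsTo_univ _ _)
      unit := fun t _ => by rw [neg_sq]; exact h.unit (-t) (mem_univ _)
      curv := fun t _ => h.curv (-t) (mem_univ _)
      pos := fun t _ => h.pos (-t) (mem_univ _) }

lemma sq_axial_le (h : UnitProfile J x z c s κ) {t : ℝ} (ht : t ∈ J) : c t ^ 2 ≤ z t ^ 2 := by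
  have h1 := h.curv t ht
  have h2 := h.pos t ht
  rw [div_pow] at h1
  have h3 : c t ^ 2 / z t ^ 2 ≤ 1 := by nlinarith [sq_nonneg (κ t)]
  rwa [div_le_one (by positivity)] at h3

/-- Where its curvature vanishes, the profile touches the cylinder of radius `1`, because
`c ^ 2 - z ^ 2 ≤ 0` attains its maximum there. -/
lemma of_curv_eq_zero (h : UnitProfile J x z c s κ) (hJ : IsOpen J) {t : ℝ} (ht : t ∈ J)
    (h0 : κ t = 0) : s t = 0 ∧ z t = 1 ∧ c t ^ 2 = 1 := by
  have hp := h.pos t ht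
  have h1 : c t ^ 2 = z t ^ 2 := by
    have := h.curv t ht
    rw [h0, div_pow] at this
    field_simp at this
    linarith
  have hmax : IsLocalMax (fun r => c r ^ 2 - z r ^ 2) t := by
    filter_upwards [hJ.mem_nhds ht] with r hr
    rw [h1]
    linarith [h.sq_axial_le hr]
  have hd : HasDerivAt (fun r => c r ^ 2 - z r ^ 2) (-(2 * z t * s t)) t :=
    (((h.deriv_c t ht).pow 2).sub ((h.deriv_z t ht).pow 2)).congr_deriv (by simp [h0])
  have h2 := hmax.hasDerivAt_eq_zero hd
  have hs : s t = 0 := by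
    have : z t * s t = 0 := by linarith
    exact (mul_eq_zero.1 this).resolve_left hp.ne'
  have hu := h.unit t ht
  rw [hs] at hu
  have hc : c t ^ 2 = 1 := by linarith
  refine ⟨hs, ?_, hc⟩
  rw [hc] at h1
  nlinarith

lemma abs_axial_div_lt (h : UnitProfile J x z c s κ) {t : ℝ} (ht : t ∈ J) (h0 : κ t ≠ 0) :
    -1 < c t / z t ∧ c t / z t < 1 := by
  have h1 := h.curv t ht
  have h2 : 0 < κ t ^ 2 := by positivity
  constructor <;> nlinarith

lemma curv_eq (h : UnitProfile J x z c s κ) {t : ℝ} (ht : t ∈ J) (h0 : κ t < 0) :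
    κ t = -√(1 - (c t / z t) ^ 2) := by
  rw [← h.curv t ht, add_sub_cancel_right, Real.sqrt_sq_eq_abs, abs_of_neg h0, neg_neg]

lemma hasDerivAt_firstIntegral (h : UnitProfile J x z c s κ) (hJ : IsOpen J) {t : ℝ} (ht : t ∈ J)
    (h0 : κ t < 0) : HasDerivAt (firstIntegral z c κ) 0 t := by
  have hz0 := (h.pos t ht).ne'
  have hev : ∀ᶠ r in 𝓝 t, r ∈ J ∧ κ r < 0 := by
    have hc : ContinuousAt κ t := h.continuousOn_curv.continuousAt (hJ.mem_nhds ht)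
    exact Filter.Eventually.and (hJ.mem_nhds ht) (hc.eventually (gt_mem_nhds h0))
  have he : firstIntegral z c κ =ᶠ[𝓝 t] fun r =>
      -(z r * (z r * -√(1 - (c r / z r) ^ 2) + c r)) *
        Real.exp (-Real.arccos (-(c r / z r))) := by
    filter_upwards [hev] with r hr
    rw [firstIntegral, h.curv_eq hr.1 hr.2]
  refine HasDerivAt.congr_of_eventuallyEq ?_ he
  have hq := h.curv_eq ht h0
  obtain ⟨hw1, hw2⟩ := h.abs_axial_div_lt ht h0.ne
  have hpos : 0 < 1 - (c t / z t) ^ 2 := by nlinarith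
  have hw : HasDerivAt (fun r => c r / z r) ((-(s t * κ t) * z t - c t * s t) / z t ^ 2) t :=
    (h.deriv_c t ht).div (h.deriv_z t ht) hz0
  have hroot := ((hw.pow 2).const_sub 1).sqrt hpos.ne'
  have harc := (Real.hasDerivAt_arccos (x := -(c t / z t)) (by linarith) (by linarith)).comp t
    hw.neg
  have hz := h.deriv_z t ht
  have hc := h.deriv_c t ht
  refine ((hz.mul ((hz.mul hroot.neg).add hc)).neg.mul harc.neg.exp).congr_deriv ?_
  simp only [Pi.pow_apply, Function.comp_apply, Pi.neg_apply, Pi.mul_apply, Pi.add_apply]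
  have hsq : √(1 - (-(c t / z t)) ^ 2) = -κ t := by rw [neg_sq, hq, neg_neg]
  rw [hsq, show √(1 - (c t / z t) ^ 2) = -κ t by rw [hq, neg_neg]]
  have hk0 := h0.ne
  simp only [Nat.add_one_sub_one, pow_one, Nat.cast_ofNat]
  generalize Real.exp (-Real.arccos (-(c t / z t))) = e
  field_simp
  ring

lemma firstIntegral_eq (h : UnitProfile J x z c s κ) (hJ : IsOpen J) {p q : ℝ}
    (hpq : ∀ r ∈ uIcc p q, r ∈ J ∧ κ r < 0) :
    firstIntegral z c κ p = firstIntegral z c κ q :=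
  eq_of_hasDerivAt_zero fun r hr => h.hasDerivAt_firstIntegral hJ (hpq r hr).1 (hpq r hr).2

/-- Where the curvature is negative and the first integral is `a ^ 2`, height and curvature are
functions of the axial component of the tangent. -/
lemma height_and_curv_eq (h : UnitProfile J x z c s κ) {t a : ℝ} (ht : t ∈ J) (h0 : κ t < 0)
    (ha : 0 < a) (hE : firstIntegral z c κ t = a ^ 2) :
    z t = a * unitHeight (unitAngle (c t / a)) ∧ κ t = -Real.sin (unitAngle (c t / a)) := by
  have hz := h.pos t ht
  obtain ⟨hw1, hw2⟩ := h.abs_axial_div_lt ht h0.ne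
  set u := Real.arccos (-(c t / z t)) with hu
  have hcos : Real.cos u = -(c t / z t) := Real.cos_arccos (by linarith) (by linarith)
  have hsin : Real.sin u = -κ t := by
    rw [hu, Real.sin_arccos, neg_sq, h.curv_eq ht h0, neg_neg]
  have hD : z t ^ 2 * (Real.sin u + Real.cos u) = a ^ 2 * Real.exp u := by
    rw [firstIntegral, Real.exp_neg] at hE
    have he := Real.exp_pos u
    rw [← div_eq_mul_inv, div_eq_iff he.ne'] at hE
    rw [hsin, hcos, ← hE]
    field_simp
    ring
  have hpos : 0 < Real.sin u + Real.cos u := by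
    have : 0 < a ^ 2 * Real.exp u := by positivity
    rw [← hD] at this
    exact pos_of_mul_pos_right this (sq_nonneg _)
  have hm : u ∈ angleRange :=
    mem_angleRange_of_pos (Real.arccos_nonneg _) (Real.arccos_le_pi _) hpos
  have hza : z t = a * unitHeight u := by
    have h1 := unitHeight_sq hm
    have h2 := unitHeight_pos hm
    have h3 : z t ^ 2 = (a * unitHeight u) ^ 2 := by
      refine mul_right_cancel₀ hpos.ne' ?_
      rw [hD, mul_pow, mul_assoc, h1]
    exact (pow_left_inj₀ hz.le (by positivity) two_ne_zero).1 h3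
  have hang : unitAngle (c t / a) = u := by
    rw [← unitAngle_unitAxial hm]
    congr 1
    rw [unitAxial, hcos]
    have : unitHeight u = z t / a := by rw [hza]; field_simp
    rw [this]
    field_simp
  rw [hang, hsin, neg_neg]
  exact ⟨hza, rfl⟩

section Line

variable (h : UnitProfile univ x z c s κ)
include h

lemma continuous_curv : Continuous κ := continuousOn_univ.1 h.continuousOn_curv

lemma continuous_firstIntegral : Continuous (firstIntegral z c κ) := by
  have hz : Continuous z := continuous_iff_continuousAt.2 fun t =>
    (h.deriv_z t (mem_univ _)).continuousAt
  have hc : Continuous c := continuous_iff_continuousAt.2 fun t =>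
    (h.deriv_c t (mem_univ _)).continuousAt
  have hz0 : ∀ t, z t ≠ 0 := fun t => (h.pos t (mem_univ _)).ne'
  exact (hz.mul ((hz.mul h.continuous_curv).add hc)).neg.mul
    (Real.continuous_exp.comp (Real.continuous_arccos.comp (hc.div hz hz0).neg).neg)

/-- The profile turns from the direction of its tangent at `t₀` by the integral of its
curvature. -/
lemma exists_angle (t₀ : ℝ) : ∃ τ : ℝ → ℝ, (∀ t, HasDerivAt τ (-κ t) t) ∧
    (∀ t, c t = Real.cos (τ t)) ∧ (∀ t, s t = -Real.sin (τ t)) ∧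
    -Real.pi < τ t₀ ∧ τ t₀ ≤ Real.pi := by
  set τ₀ := Complex.arg ⟨c t₀, -s t₀⟩ with hτ₀
  have hnorm : ‖(⟨c t₀, -s t₀⟩ : ℂ)‖ = 1 := by
    rw [Complex.norm_def, Complex.normSq_mk, Real.sqrt_eq_one]
    linarith [h.unit t₀ (mem_univ _)]
  have hcos := Complex.norm_mul_cos_arg ⟨c t₀, -s t₀⟩
  have hsin := Complex.norm_mul_sin_arg ⟨c t₀, -s t₀⟩
  rw [hnorm, one_mul] at hcos hsin
  set τ : ℝ → ℝ := fun t => τ₀ + ∫ r in t₀..t, -κ r with hτ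
  have hτd : ∀ t, HasDerivAt τ (-κ t) t := fun t => by
    have hc := h.continuous_curv.neg
    exact (intervalIntegral.integral_hasDerivAt_right (hc.intervalIntegrable _ _)
      hc.stronglyMeasurable.stronglyMeasurableAtFilter hc.continuousAt).const_add τ₀
  have hτ0 : τ t₀ = τ₀ := by simp [hτ]
  have hA : ∀ t, c t * Real.cos (τ t) - s t * Real.sin (τ t) = 1 := by
    intro t
    have hd : ∀ r, HasDerivAt (fun r => c r * Real.cos (τ r) - s r * Real.sin (τ r)) 0 r :=
      fun r => by
        refine (((h.deriv_c r (mem_univ _)).mul (hτd r).cos).sub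
          ((h.deriv_s r (mem_univ _)).mul (hτd r).sin)).congr_deriv ?_
        ring
    have := eq_of_hasDerivAt_zero (p := t) (q := t₀) fun r _ => hd r
    rw [this, hτ0, hcos, hsin]
    linarith [h.unit t₀ (mem_univ _)]
  refine ⟨τ, hτd, fun t => ?_, fun t => ?_, ?_, ?_⟩
  · have h1 := hA t
    have h2 := h.unit t (mem_univ _)
    have h3 := Real.sin_sq_add_cos_sq (τ t)
    have h4 : (c t - Real.cos (τ t)) ^ 2 = 0 := by
      nlinarith [sq_nonneg (c t - Real.cos (τ t)), sq_nonneg (s t + Real.sin (τ t))]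
    exact sub_eq_zero.1 (pow_eq_zero_iff two_ne_zero |>.1 h4)
  · have h1 := hA t
    have h2 := h.unit t (mem_univ _)
    have h3 := Real.sin_sq_add_cos_sq (τ t)
    have h4 : (s t + Real.sin (τ t)) ^ 2 = 0 := by
      nlinarith [sq_nonneg (c t - Real.cos (τ t)), sq_nonneg (s t + Real.sin (τ t))]
    linarith [pow_eq_zero_iff two_ne_zero |>.1 h4]
  · rw [hτ0]; exact Complex.neg_pi_lt_arg _
  · rw [hτ0]; exact Complex.arg_le_pi _

/-- At a zero of the curvature that ends an interval of negative curvature, the first integral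
on the interval is `1` or negative. -/
lemma firstIntegral_of_first_zero {t₀ q : ℝ} (hq : t₀ < q) (hq0 : κ q = 0)
    (hneg : ∀ t, t₀ ≤ t → t < q → κ t < 0) :
    firstIntegral z c κ t₀ = 1 ∨ firstIntegral z c κ t₀ < 0 := by
  have hconst : firstIntegral z c κ q = firstIntegral z c κ t₀ := by
    refine tendsto_nhds_unique (h.continuous_firstIntegral.continuousAt.tendsto.mono_left
      nhdsWithin_le_nhds : Tendsto _ (𝓝[<] q) _) (tendsto_const_nhds.congr' ?_)
    filter_upwards [Ioo_mem_nhdsLT hq] with t ht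
    refine h.firstIntegral_eq isOpen_univ fun r hr => ⟨mem_univ _, ?_⟩
    rw [uIcc_of_le ht.1.le] at hr
    exact hneg r hr.1 (hr.2.trans_lt ht.2)
  obtain ⟨-, hz, hc⟩ := h.of_curv_eq_zero isOpen_univ (mem_univ q) hq0
  rw [← hconst, firstIntegral, hz, hq0]
  rw [sq, mul_self_eq_one_iff] at hc
  rcases hc with hc | hc
  · right
    rw [hc]
    have := Real.exp_pos (-Real.arccos (-(1 / 1)))
    linarith
  · left
    rw [hc]
    simp

/-- The first integral is positive: otherwise `z` would be concave, and hence would not stay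
positive. -/
lemma firstIntegral_pos_of_nonpos {t₀ : ℝ} (h0 : κ t₀ < 0) (hs0 : s t₀ ≤ 0) :
    0 < firstIntegral z c κ t₀ := by
  by_contra! hE
  have hcpos : ∀ t, κ t < 0 → firstIntegral z c κ t = firstIntegral z c κ t₀ → 0 < c t := by
    intro t ht he
    have hz := h.pos t (mem_univ _)
    rw [← he, firstIntegral] at hE
    have he := Real.exp_pos (-Real.arccos (-(c t / z t)))
    have h1 : 0 ≤ z t * (z t * κ t + c t) := by
      by_contra! hlt
      nlinarith
    have h2 : 0 ≤ z t * κ t + c t := nonneg_of_mul_nonneg_right h1 hz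
    nlinarith
  -- `s` decreases as long as the curvature is negative
  have hanti : ∀ q, t₀ ≤ q → (∀ t, t₀ ≤ t → t < q → κ t < 0) → StrictAntiOn s (Icc t₀ q) := by
    intro q hq hneg
    refine strictAntiOn_of_deriv_neg (convex_Icc _ _)
      (fun r _ => (h.deriv_s r (mem_univ _)).continuousAt.continuousWithinAt) fun r hr => ?_
    rw [interior_Icc] at hr
    rw [(h.deriv_s r (mem_univ _)).deriv]
    have hk := hneg r hr.1.le hr.2
    have he := h.firstIntegral_eq isOpen_univ (p := r) (q := t₀) fun r' hr' => by
      rw [uIcc_of_ge hr.1.le] at hr'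
      exact ⟨mem_univ _, hneg r' hr'.1 (hr'.2.trans_lt hr.2)⟩
    nlinarith [hcpos r hk he]
  rcases neg_or_exists_first_zero h.continuous_curv h0 with hneg | ⟨q, hq, hq0, hneg⟩
  · have hs1 : s (t₀ + 1) < 0 := by
      have := hanti (t₀ + 1) (by linarith) (fun t ht _ => hneg t ht)
        (left_mem_Icc.2 (by linarith)) (right_mem_Icc.2 (by linarith)) (by linarith)
      linarith
    refine not_pos_of_deriv_le (f := z) (f' := s) (t₁ := t₀ + 1) (neg_pos.2 hs1)
      (fun t _ => h.deriv_z t (mem_univ _)) (fun t ht => ?_) (fun t _ => h.pos t (mem_univ _))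
    rw [neg_neg]
    exact (hanti t (by linarith) (fun r hr _ => hneg r hr)).antitoneOn ⟨by linarith, ht⟩
      (right_mem_Icc.2 (by linarith)) ht
  · have := hanti q hq.le hneg (left_mem_Icc.2 hq.le) (right_mem_Icc.2 hq.le) hq
    rw [(h.of_curv_eq_zero isOpen_univ (mem_univ q) hq0).1] at this
    linarith

lemma firstIntegral_pos {t₀ : ℝ} (h0 : κ t₀ < 0) : 0 < firstIntegral z c κ t₀ := by
  rcases le_total (s t₀) 0 with hs | hs
  · exact h.firstIntegral_pos_of_nonpos h0 hs
  · have := h.reverse.firstIntegral_pos_of_nonpos (t₀ := -t₀) (by simpa using h0)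
      (by simpa using hs)
    simpa [firstIntegral] using this

/-- The first integral is at least `1`: otherwise the tangent would converge to a direction that
leads to the axis. -/
lemma one_le_firstIntegral {t₀ : ℝ} (h0 : κ t₀ < 0) : 1 ≤ firstIntegral z c κ t₀ := by
  have hpos := h.firstIntegral_pos h0
  by_contra! hlt
  obtain ⟨a, ha, hE⟩ : ∃ a, 0 < a ∧ firstIntegral z c κ t₀ = a ^ 2 :=
    ⟨√(firstIntegral z c κ t₀), Real.sqrt_pos.2 hpos, (Real.sq_sqrt hpos.le).symm⟩
  have ha1 : a < 1 := by nlinarith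
  have hneg : ∀ t, t₀ ≤ t → κ t < 0 := by
    rcases neg_or_exists_first_zero h.continuous_curv h0 with hneg | ⟨q, hq, hq0, hneg⟩
    · exact hneg
    · rcases h.firstIntegral_of_first_zero hq hq0 hneg with h1 | h1 <;> linarith
  obtain ⟨τ, hτd, hτc, hτs, hτ1, hτ2⟩ := h.exists_angle t₀
  have hτcont : Continuous τ := continuous_iff_continuousAt.2 fun t => (hτd t).continuousAt
  have hspeed : ∀ t, t₀ ≤ t → -κ t = angularSpeed a (τ t) := by
    intro t ht
    have he := h.firstIntegral_eq isOpen_univ (p := t) (q := t₀) fun r hr => by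
      rw [uIcc_of_ge ht] at hr
      exact ⟨mem_univ _, hneg r hr.1⟩
    rw [(h.height_and_curv_eq (mem_univ t) (hneg t ht) ha (he.trans hE)).2, neg_neg,
      angularSpeed, hτc]
  have hcos : ∀ t, t₀ ≤ t → -a < Real.cos (τ t) := fun t ht => by
    rw [← angularSpeed_pos_iff ha, ← hspeed t ht]
    linarith [hneg t ht]
  have hmono : StrictMonoOn τ (Ici t₀) := by
    refine strictMonoOn_of_deriv_pos (convex_Ici _) hτcont.continuousOn fun t ht => ?_
    rw [interior_Ici] at ht
    rw [(hτd t).deriv]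
    linarith [hneg t (le_of_lt ht)]
  have hbdd : ∀ t, t₀ ≤ t → τ t < Real.pi := by
    have hne : ∀ t, t₀ ≤ t → τ t ≠ Real.pi := fun t ht he => by
      have := hcos t ht
      rw [he, Real.cos_pi] at this
      linarith
    intro t ht
    by_contra! hge
    obtain ⟨r, hr, hre⟩ := intermediate_value_Icc ht hτcont.continuousOn
      (show Real.pi ∈ Icc (τ t₀) (τ t) from ⟨hτ2, hge⟩)
    exact hne r hr.1 hre
  obtain ⟨σ, hσ⟩ : ∃ σ, Tendsto (fun t => τ (max t t₀)) atTop (𝓝 σ) := by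
    have hm : Monotone fun t => τ (max t t₀) := fun t t' ht =>
      hmono.monotoneOn (mem_Ici.2 (le_max_right _ _)) (mem_Ici.2 (le_max_right _ _))
        (max_le_max_right _ ht)
    refine ⟨_, tendsto_atTop_ciSup hm ⟨Real.pi, ?_⟩⟩
    rintro _ ⟨t, rfl⟩
    exact (hbdd _ (le_max_right _ _)).le
  have hσ' : Tendsto τ atTop (𝓝 σ) := by
    refine hσ.congr' ?_
    filter_upwards [eventually_ge_atTop t₀] with t ht
    rw [max_eq_left ht]
  have hle : ∀ t, t₀ ≤ t → τ t < σ := by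
    intro t ht
    refine (hmono (mem_Ici.2 ht) (mem_Ici.2 (by linarith : t₀ ≤ t + 1)) (by linarith)).trans_le ?_
    refine ge_of_tendsto hσ' ?_
    filter_upwards [eventually_ge_atTop (t + 1)] with r hr
    exact hmono.monotoneOn (mem_Ici.2 (by linarith)) (mem_Ici.2 (by linarith)) hr
  have hσpi : σ ≤ Real.pi := le_of_tendsto hσ' (by
    filter_upwards [eventually_ge_atTop t₀] with t ht using (hbdd t ht).le)
  have hcosσ : -a ≤ Real.cos σ := by
    refine ge_of_tendsto ((Real.continuous_cos.tendsto σ).comp hσ') ?_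
    filter_upwards [eventually_ge_atTop t₀] with t ht using (hcos t ht).le
  -- the limit direction is an equilibrium
  have hlim : Real.cos σ = -a := by
    refine le_antisymm ?_ hcosσ
    by_contra! hgt
    have hf := (angularSpeed_pos_iff ha).2 hgt
    have hev : ∀ᶠ t in atTop, angularSpeed a σ / 2 < angularSpeed a (τ t) :=
      (((continuous_angularSpeed a).tendsto σ).comp hσ').eventually
        (lt_mem_nhds (by linarith))
    obtain ⟨t₁, ht₁⟩ := eventually_atTop.1 (hev.and (eventually_ge_atTop t₀))
    refine not_pos_of_deriv_le (f := fun t => σ - τ t) (f' := fun t => -(-κ t)) (t₁ := t₁)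
      (half_pos hf) (fun t _ => (hτd t).const_sub σ) (fun t ht => ?_) (fun t ht => ?_)
    · rw [hspeed t (ht₁ t ht).2]
      linarith [(ht₁ t ht).1]
    · linarith [hle t (ht₁ t ht).2]
  have hσ0 : 0 ≤ σ := by
    by_contra! hneg'
    have h1 := hle t₀ le_rfl
    have h2 := Real.cos_lt_cos_of_nonneg_of_le_pi (x := -σ) (y := -τ t₀) (by linarith)
      (by linarith) (by linarith)
    rw [Real.cos_neg, Real.cos_neg, hlim] at h2
    linarith [hcos t₀ le_rfl]
  have hsin : 0 < Real.sin σ := by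
    have h1 := Real.sin_nonneg_of_nonneg_of_le_pi hσ0 hσpi
    have h2 := Real.sin_sq_add_cos_sq σ
    rw [hlim] at h2
    nlinarith
  have hev : ∀ᶠ t in atTop, Real.sin σ / 2 < Real.sin (τ t) :=
    ((Real.continuous_sin.tendsto σ).comp hσ').eventually (lt_mem_nhds (by linarith))
  obtain ⟨t₁, ht₁⟩ := eventually_atTop.1 hev
  refine not_pos_of_deriv_le (f := z) (f' := s) (t₁ := t₁) (half_pos hsin)
    (fun t _ => h.deriv_z t (mem_univ _)) (fun t ht => ?_) (fun t _ => h.pos t (mem_univ _))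
  rw [hτs]
  linarith [ht₁ t ht]

/-- A profile with first integral `a ^ 2` agrees with the profile of scale `a` as long as the
curvature of the latter does not vanish: `arcTime a (τ t) - t` is locally constant for the angle
`τ` of the tangent. -/
lemma eq_model_on {τ : ℝ → ℝ} (hτd : ∀ t, HasDerivAt τ (-κ t) t)
    (hτc : ∀ t, c t = Real.cos (τ t)) {t₀ a b : ℝ} (ha : 1 ≤ a) (h0 : κ t₀ < 0)
    (hE : firstIntegral z c κ t₀ = a ^ 2) (hb : arcTime a (τ t₀) = t₀ + b) {V : Set ℝ}
    (hVc : IsPreconnected V) (ht₀ : t₀ ∈ V)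
    (hVpos : ∀ t ∈ V, 0 < angularSpeed a (tangentAngle a (t + b))) :
    ∀ t ∈ V, κ t < 0 ∧ τ t = tangentAngle a (t + b) ∧ firstIntegral z c κ t = a ^ 2 := by
  have ha0 : 0 < a := by linarith
  set G : Set ℝ := {t | κ t < 0 ∧ τ t = tangentAngle a (t + b) ∧
    firstIntegral z c κ t = a ^ 2} with hG
  have hτcont : Continuous τ := continuous_iff_continuousAt.2 fun t => (hτd t).continuousAt
  have hshift : Continuous fun t => tangentAngle a (t + b) :=
    (continuous_tangentAngle ha).comp (continuous_id.add continuous_const)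
  have hκG : ∀ t, κ t < 0 → firstIntegral z c κ t = a ^ 2 → κ t = -angularSpeed a (τ t) := by
    intro t ht he
    rw [(h.height_and_curv_eq (mem_univ t) ht ha0 he).2, angularSpeed, hτc]
  have hopen : IsOpen G := by
    rw [isOpen_iff_mem_nhds]
    rintro t ⟨ht1, ht2, ht3⟩
    obtain ⟨ε, hε, hball⟩ := Metric.mem_nhds_iff.1
      (h.continuous_curv.continuousAt.eventually (gt_mem_nhds ht1))
    refine mem_of_superset (Metric.ball_mem_nhds t hε) fun r hr => ?_
    have hsub : uIcc r t ⊆ {r | κ r < 0} := by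
      refine ((Real.ball_eq_Ioo t ε ▸ ordConnected_Ioo).uIcc_subset hr
        (Metric.mem_ball_self hε)).trans hball
    have hEr : ∀ r' ∈ uIcc r t, firstIntegral z c κ r' = a ^ 2 := fun r' hr' => by
      rw [← ht3]
      exact h.firstIntegral_eq isOpen_univ fun q hq => ⟨mem_univ _, hsub
        (uIcc_subset_uIcc hr' right_mem_uIcc hq)⟩
    have hconst : arcTime a (τ r) - r = arcTime a (τ t) - t := by
      refine eq_of_hasDerivAt_zero (f := fun r => arcTime a (τ r) - r) fun q hq => ?_
      have hk := hκG q (hsub hq) (hEr q hq)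
      have hp : 0 < angularSpeed a (τ q) := by
        have : κ q < 0 := hsub hq
        linarith
      refine (((hasDerivAt_arcTime ha hp).comp q (hτd q)).sub (hasDerivAt_id q)).congr_deriv ?_
      rw [hk, neg_neg, inv_mul_cancel₀ hp.ne', sub_self]
    rw [ht2, arcTime_tangentAngle ha] at hconst
    refine ⟨hsub left_mem_uIcc, ?_, hEr r left_mem_uIcc⟩
    rw [← tangentAngle_arcTime ha (τ r)]
    congr 1
    linarith
  have hmem : t₀ ∈ G := ⟨h0, by rw [← hb, tangentAngle_arcTime ha], hE⟩
  refine fun t ht => hVc.subset_of_closure_inter_subset hopen ⟨t₀, ht₀, hmem⟩ ?_ ht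
  rintro t ⟨htc, htV⟩
  have h1 : τ t = tangentAngle a (t + b) :=
    closure_minimal (t := {t | τ t = tangentAngle a (t + b)}) (fun r hr => hr.2.1)
      (isClosed_eq hτcont hshift) htc
  have h2 : firstIntegral z c κ t = a ^ 2 :=
    closure_minimal (t := {t | firstIntegral z c κ t = a ^ 2}) (fun r hr => hr.2.2)
      (isClosed_eq h.continuous_firstIntegral continuous_const) htc
  have h3 : κ t = -angularSpeed a (τ t) :=
    closure_minimal (t := {t | κ t = -angularSpeed a (τ t)})
      (fun r hr => hκG r hr.1 hr.2.2) (isClosed_eq h.continuous_curv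
        ((continuous_angularSpeed a).comp hτcont).neg) htc
  refine ⟨?_, h1, h2⟩
  rw [h3, h1]
  linarith [hVpos t htV]

/-- A profile over the whole line is, near a point of negative curvature, a profile of some scale
`a ≥ 1`: all of it if `a > 1`, and a full hump if `a = 1`. -/
lemma eq_model_of_curv_neg {t₀ : ℝ} (h0 : κ t₀ < 0) :
    (∃ a b, 1 < a ∧ ∀ t, κ t < 0 ∧ z t = height a (t + b) ∧
      c t = Real.cos (tangentAngle a (t + b))) ∨
    (firstIntegral z c κ t₀ = 1 ∧ ∃ b, |t₀ + b| < halfPeriod 1 ∧ ∀ t, |t + b| ≤ halfPeriod 1 →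
      κ t = -angularSpeed 1 (tangentAngle 1 (t + b)) ∧ z t = height 1 (t + b) ∧
      c t = Real.cos (tangentAngle 1 (t + b)) ∧ s t = -Real.sin (tangentAngle 1 (t + b))) := by
  have hE1 := h.one_le_firstIntegral h0
  obtain ⟨a, ha, hE⟩ : ∃ a, 1 ≤ a ∧ firstIntegral z c κ t₀ = a ^ 2 :=
    ⟨√(firstIntegral z c κ t₀), Real.one_le_sqrt.2 hE1, (Real.sq_sqrt (by linarith)).symm⟩
  have ha0 : 0 < a := by linarith
  obtain ⟨τ, hτd, hτc, hτs, hτ1, hτ2⟩ := h.exists_angle t₀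
  have hb : arcTime a (τ t₀) = t₀ + (arcTime a (τ t₀) - t₀) := by ring
  set b := arcTime a (τ t₀) - t₀
  have hz : ∀ t, κ t < 0 → τ t = tangentAngle a (t + b) → firstIntegral z c κ t = a ^ 2 →
      z t = height a (t + b) := fun t h1 h2 h3 => by
    rw [(h.height_and_curv_eq (mem_univ t) h1 ha0 h3).1, hτc, h2, height]
  rcases eq_or_lt_of_le ha with rfl | ha1
  · right
    refine ⟨by rw [hE, one_pow], b, ?_, ?_⟩
    all_goals
      have hτlt : |τ t₀| < Real.pi := by
        refine abs_lt.2 ⟨hτ1, lt_of_le_of_ne hτ2 fun he => ?_⟩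
        have h1 := (h.height_and_curv_eq (mem_univ t₀) h0 one_pos hE).2
        rw [hτc, he, Real.cos_pi, div_one, unitAngle_neg_one, Real.sin_zero] at h1
        linarith
      have hb1 : |t₀ + b| < halfPeriod 1 := by
        rw [← hb, abs_lt, halfPeriod, ← arcTime_neg]
        exact ⟨strictMono_arcTime ha (abs_lt.1 hτlt).1, strictMono_arcTime ha (abs_lt.1 hτlt).2⟩
    · exact hb1
    set V : Set ℝ := Ioo (-halfPeriod 1 - b) (halfPeriod 1 - b) with hV
    have hVmem : ∀ t, t ∈ V ↔ |t + b| < halfPeriod 1 := fun t => by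
      rw [abs_lt, hV, mem_Ioo]
      constructor <;> rintro ⟨h1, h2⟩ <;> constructor <;> linarith
    have hmodel := h.eq_model_on hτd hτc ha h0 hE hb (V := V) isPreconnected_Ioo
      ((hVmem _).2 hb1) fun t ht => by
        refine angularSpeed_pos_of_abs_lt ha (abs_lt.2 ?_)
        have h1 := abs_lt.1 ((hVmem t).1 ht)
        have h2 := strictMono_tangentAngle ha h1.1
        have h3 := strictMono_tangentAngle ha h1.2
        rw [tangentAngle_neg ha, tangentAngle_halfPeriod ha] at h2
        rw [tangentAngle_halfPeriod ha] at h3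
        exact ⟨h2, h3⟩
    have hclos : closure V = Icc (-halfPeriod 1 - b) (halfPeriod 1 - b) :=
      closure_Ioo (by linarith [halfPeriod_pos ha])
    have hsh : Continuous fun t => tangentAngle 1 (t + b) :=
      (continuous_tangentAngle ha).comp (continuous_id.add continuous_const)
    have hext : ∀ {f g : ℝ → ℝ}, Continuous f → Continuous g → (∀ t ∈ V, f t = g t) →
        ∀ t, |t + b| ≤ halfPeriod 1 → f t = g t := by
      intro f g hf hg hfg t ht
      refine closure_minimal (t := {t | f t = g t}) hfg (isClosed_eq hf hg) ?_
      rw [hclos]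
      have := abs_le.1 ht
      constructor <;> linarith
    have hzc : Continuous z := continuous_iff_continuousAt.2 fun t =>
      (h.deriv_z t (mem_univ _)).continuousAt
    have hcc : Continuous c := continuous_iff_continuousAt.2 fun t =>
      (h.deriv_c t (mem_univ _)).continuousAt
    have hsc : Continuous s := continuous_iff_continuousAt.2 fun t =>
      (h.deriv_s t (mem_univ _)).continuousAt
    refine fun t ht => ⟨?_, ?_, ?_, ?_⟩
    · refine hext h.continuous_curv ((continuous_angularSpeed 1).comp hsh).neg (fun t ht => ?_) t ht
      obtain ⟨h1, h2, h3⟩ := hmodel t ht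
      rw [(h.height_and_curv_eq (mem_univ t) h1 ha0 h3).2, hτc, h2]
      rfl
    · refine hext hzc ((continuous_height ha).comp (continuous_id.add continuous_const))
        (fun t ht => ?_) t ht
      obtain ⟨h1, h2, h3⟩ := hmodel t ht
      exact hz t h1 h2 h3
    · refine hext hcc (Real.continuous_cos.comp hsh) (fun t ht => ?_) t ht
      rw [hτc, (hmodel t ht).2.1, Function.comp_apply]
    · refine hext hsc (Real.continuous_sin.comp hsh).neg (fun t ht => ?_) t ht
      rw [hτs, (hmodel t ht).2.1]
      rfl
  · left
    have hmodel := h.eq_model_on hτd hτc ha h0 hE hb (V := univ) isPreconnected_univ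
      (mem_univ _) fun t _ => angularSpeed_pos_of_one_lt ha1 _
    refine ⟨a, b, ha1, fun t => ?_⟩
    obtain ⟨h1, h2, h3⟩ := hmodel t (mem_univ _)
    exact ⟨h1, hz t h1 h2 h3, by rw [hτc, h2]⟩

end Line

end UnitProfile

/-! ### Contact with the cylinder and differentiability of the curvature -/

namespace UnitProfile

variable {x z c s κ : ℝ → ℝ}

section Contact

variable (h : UnitProfile univ x z c s κ)
include h

lemma continuous_axial_tangent : Continuous c :=
  continuous_iff_continuousAt.2 fun t => (h.deriv_c t (mem_univ _)).continuousAt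

lemma continuous_radial_tangent : Continuous s :=
  continuous_iff_continuousAt.2 fun t => (h.deriv_s t (mem_univ _)).continuousAt

lemma continuous_radius : Continuous z :=
  continuous_iff_continuousAt.2 fun t => (h.deriv_z t (mem_univ _)).continuousAt

lemma abs_curv_le_one (t : ℝ) : |κ t| ≤ 1 := by
  rw [← sq_le_one_iff_abs_le_one]
  linarith [h.curv t (mem_univ _), sq_nonneg (c t / z t)]

lemma hasDerivAt_slope (t : ℝ) :
    HasDerivAt (fun r => c r / z r) (-(s t * (z t * κ t + c t)) / z t ^ 2) t :=
  ((h.deriv_c t (mem_univ _)).div (h.deriv_z t (mem_univ _))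
    (h.pos t (mem_univ _)).ne').congr_deriv (by ring)

lemma hasDerivAt_curv_of_neg {t : ℝ} (h0 : κ t < 0) :
    HasDerivAt κ (c t * s t / z t ^ 2 * (κ t + c t / z t) / κ t) t := by
  have hz0 := (h.pos t (mem_univ _)).ne'
  have he : κ =ᶠ[𝓝 t] fun r => -√(1 - (c r / z r) ^ 2) := by
    filter_upwards [h.continuous_curv.continuousAt.eventually (gt_mem_nhds h0)] with r hr
    exact h.curv_eq (mem_univ r) hr
  refine HasDerivAt.congr_of_eventuallyEq ?_ he
  have hq := h.curv_eq (mem_univ t) h0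
  obtain ⟨hw1, hw2⟩ := h.abs_axial_div_lt (mem_univ t) h0.ne
  have hpos : 0 < 1 - (c t / z t) ^ 2 := by nlinarith
  refine ((((h.hasDerivAt_slope t).pow 2).const_sub 1).sqrt hpos.ne').neg.congr_deriv ?_
  simp only [Pi.pow_apply, Nat.add_one_sub_one, pow_one, Nat.cast_ofNat]
  rw [show √(1 - (c t / z t) ^ 2) = -κ t by rw [hq, neg_neg]]
  have hk0 := h0.ne
  field_simp

lemma hasDerivAt_curv_of_ne {t : ℝ} (h0 : κ t ≠ 0) :
    HasDerivAt κ (c t * s t / z t ^ 2 * (κ t + c t / z t) / κ t) t := by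
  rcases lt_or_gt_of_ne h0 with h0 | h0
  · exact h.hasDerivAt_curv_of_neg h0
  · have := (h.reflect.hasDerivAt_curv_of_neg (t := t) (by simpa using h0)).neg
    simp only [Pi.neg_def, neg_neg] at this
    refine this.congr_deriv ?_
    have := (h.pos t (mem_univ _)).ne'
    have := h0.ne'
    field_simp
    ring

/-- If `s = O(|κ| ^ (3 / 2))`, then the curvature vanishes quadratically at its zeros, because
`y = κ ^ 2` satisfies `|y'| ≤ 4 |s| = O(y ^ (3 / 4))`. -/
lemma abs_curv_le_sq (hz : ∀ t, 1 ≤ z t) (hs : ∀ t, s t ^ 2 ≤ 12 * |κ t| ^ 3) {t₁ : ℝ}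
    (h1 : κ t₁ = 0) (t : ℝ) : |κ t| ≤ 192 * (t - t₁) ^ 2 := by
  obtain ⟨t', ht', hmax⟩ := isCompact_uIcc.exists_isMaxOn (s := uIcc t₁ t) nonempty_uIcc
    h.continuous_curv.abs.continuousOn
  set K := |κ t'| with hK
  have hK0 : 0 ≤ K := abs_nonneg _
  have hle : |κ t| ≤ K := hmax right_mem_uIcc
  have hy : ∀ r, 1 - (c r / z r) ^ 2 = |κ r| ^ 2 := fun r => by
    rw [sq_abs, ← h.curv r (mem_univ _), add_sub_cancel_right]
  have hderiv : ∀ r ∈ uIcc t₁ t, ‖-(2 * (c r / z r) * (-(s r * (z r * κ r + c r)) / z r ^ 2))‖ ≤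
      4 * √(12 * K ^ 3) := by
    intro r hr
    have hzr := hz r
    have hsr : |s r| ≤ √(12 * K ^ 3) := by
      refine Real.abs_le_sqrt ((hs r).trans ?_)
      have hrK : |κ r| ≤ K := hmax hr
      have := pow_le_pow_left₀ (abs_nonneg _) hrK 3
      linarith
    have hw : |c r / z r| ≤ 1 := by
      rw [← sq_le_one_iff_abs_le_one]
      linarith [h.curv r (mem_univ _), sq_nonneg (κ r)]
    have hc : |c r| ≤ 1 := by
      rw [← sq_le_one_iff_abs_le_one]
      linarith [h.unit r (mem_univ _), sq_nonneg (s r)]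
    have hq : |(z r * κ r + c r) / z r ^ 2| ≤ 2 := by
      rw [abs_div, abs_of_pos (by positivity : 0 < z r ^ 2), div_le_iff₀ (by positivity)]
      refine (abs_add_le _ _).trans ?_
      rw [abs_mul, abs_of_pos (by linarith : 0 < z r)]
      nlinarith [h.abs_curv_le_one r]
    have he : -(2 * (c r / z r) * (-(s r * (z r * κ r + c r)) / z r ^ 2)) =
        2 * (c r / z r) * s r * ((z r * κ r + c r) / z r ^ 2) := by ring
    rw [he, Real.norm_eq_abs, abs_mul, abs_mul, abs_mul, abs_two]
    calc 2 * |c r / z r| * |s r| * |(z r * κ r + c r) / z r ^ 2|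
        ≤ 2 * 1 * √(12 * K ^ 3) * 2 := by gcongr
      _ = 4 * √(12 * K ^ 3) := by ring
  have hmv := (convex_uIcc t₁ t).norm_image_sub_le_of_norm_hasDerivWithin_le
    (f := fun r => 1 - (c r / z r) ^ 2) (x := t₁) (y := t')
    (fun r _ => ((((h.hasDerivAt_slope r).pow 2).const_sub 1).congr_deriv
      (by simp)).hasDerivWithinAt) hderiv left_mem_uIcc ht'
  simp only [hy] at hmv
  rw [h1, abs_zero, zero_pow two_ne_zero, sub_zero, Real.norm_of_nonneg (by positivity),
    ← hK] at hmv
  have hdist : ‖t' - t₁‖ ≤ |t - t₁| := by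
    rw [Real.norm_eq_abs]
    exact abs_sub_left_of_mem_uIcc ht'
  have hK2 : K ^ 2 ≤ 4 * √(12 * K ^ 3) * |t - t₁| :=
    hmv.trans (mul_le_mul_of_nonneg_left hdist (by positivity))
  have hK4 : K ^ 4 ≤ 192 * (t - t₁) ^ 2 * K ^ 3 := by
    have := pow_le_pow_left₀ (by positivity) hK2 2
    rw [mul_pow, mul_pow, Real.sq_sqrt (by positivity), sq_abs (t - t₁)] at this
    nlinarith
  refine hle.trans ?_
  rcases hK0.eq_or_lt with h0 | h0
  · rw [← h0]; positivity
  · refine le_of_mul_le_mul_right ?_ (pow_pos h0 3)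
    rw [← pow_succ']
    exact hK4

/-- Division by zero makes the formula for the derivative of the curvature valid at the zeros of
the curvature, too. -/
lemma hasDerivAt_curv (hz : ∀ t, 1 ≤ z t) (hs : ∀ t, s t ^ 2 ≤ 12 * |κ t| ^ 3) (t : ℝ) :
    HasDerivAt κ (c t * s t / z t ^ 2 * (κ t + c t / z t) / κ t) t := by
  by_cases h0 : κ t = 0
  · have hO : κ =O[𝓝 t] fun r => ‖r - t‖ ^ 2 := by
      refine Asymptotics.IsBigO.of_bound 192 (Eventually.of_forall fun r => ?_)
      have := h.abs_curv_le_sq hz hs h0 r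
      rw [norm_pow, norm_norm, Real.norm_eq_abs, Real.norm_eq_abs, sq_abs]
      exact this
    rw [h0, div_zero, hasDerivAt_iff_hasFDerivAt]
    exact (hO.hasFDerivAt one_lt_two).congr_fderiv (by ext; simp)
  · exact h.hasDerivAt_curv_of_ne h0

lemma continuous_deriv_curv (hz : ∀ t, 1 ≤ z t) (hs : ∀ t, s t ^ 2 ≤ 12 * |κ t| ^ 3) :
    Continuous fun t => c t * s t / z t ^ 2 * (κ t + c t / z t) / κ t := by
  have hzc := h.continuous_radius
  have hcc := h.continuous_axial_tangent
  have hsc := h.continuous_radial_tangent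
  have hkc := h.continuous_curv
  have hz0 : ∀ t, z t ≠ 0 := fun t => (h.pos t (mem_univ _)).ne'
  have hnum : Continuous fun t => c t * s t / z t ^ 2 * (κ t + c t / z t) :=
    ((hcc.mul hsc).div (hzc.pow 2) fun t => pow_ne_zero 2 (hz0 t)).mul
      (hkc.add (hcc.div hzc hz0))
  refine continuous_iff_continuousAt.2 fun t => ?_
  by_cases h0 : κ t = 0
  · have hbound : ∀ r, ‖c r * s r / z r ^ 2 * (κ r + c r / z r) / κ r‖ ≤ √(48 * |κ r|) := by
      intro r
      refine Real.abs_le_sqrt ?_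
      by_cases hr : κ r = 0
      · simp [hr]
      have hw : |c r / z r| ≤ 1 := by
        rw [← sq_le_one_iff_abs_le_one]
        linarith [h.curv r (mem_univ _), sq_nonneg (κ r)]
      have hfac : |c r / z r ^ 2 * (κ r + c r / z r)| ≤ 2 := by
        have h1 : |c r / z r ^ 2| ≤ 1 := by
          rw [sq, ← div_div, abs_div, abs_of_pos (by linarith [hz r] : 0 < z r)]
          exact div_le_one_of_le₀ (hw.trans (hz r)) (by linarith [hz r])
        have h2 : |κ r + c r / z r| ≤ 2 :=
          (abs_add_le _ _).trans (by linarith [h.abs_curv_le_one r])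
        rw [abs_mul]
        nlinarith [abs_nonneg (c r / z r ^ 2), abs_nonneg (κ r + c r / z r)]
      have hpos : 0 < |κ r| := abs_pos.2 hr
      have he : c r * s r / z r ^ 2 * (κ r + c r / z r) / κ r =
          (c r / z r ^ 2 * (κ r + c r / z r)) * (s r / κ r) := by ring
      have hq : (s r / κ r) ^ 2 ≤ 12 * |κ r| := by
        rw [div_pow, ← sq_abs (κ r), div_le_iff₀ (by positivity)]
        have := hs r
        nlinarith
      have h4 : (c r / z r ^ 2 * (κ r + c r / z r)) ^ 2 ≤ 4 := by
        rw [← sq_abs]; nlinarith [abs_nonneg (c r / z r ^ 2 * (κ r + c r / z r))]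
      rw [he, mul_pow]
      nlinarith [sq_nonneg (s r / κ r)]
    rw [ContinuousAt, h0, div_zero]
    refine squeeze_zero_norm hbound ?_
    have : Tendsto (fun r => √(48 * |κ r|)) (𝓝 t) (𝓝 √(48 * |κ t|)) :=
      ((continuous_const.mul hkc.abs).sqrt).tendsto t
    simpa [h0] using this
  · exact hnum.continuousAt.div hkc.continuousAt h0

lemma contDiff_two : ContDiff ℝ 2 x ∧ ContDiff ℝ 2 z := by
  have hc1 : ContDiff ℝ 1 c := contDiff_one_iff_deriv.2
    ⟨fun t => (h.deriv_c t (mem_univ _)).differentiableAt, by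
      rw [funext fun t => (h.deriv_c t (mem_univ _)).deriv]
      exact (h.continuous_radial_tangent.mul h.continuous_curv).neg⟩
  have hs1 : ContDiff ℝ 1 s := contDiff_one_iff_deriv.2
    ⟨fun t => (h.deriv_s t (mem_univ _)).differentiableAt, by
      rw [funext fun t => (h.deriv_s t (mem_univ _)).deriv]
      exact h.continuous_axial_tangent.mul h.continuous_curv⟩
  rw [show (2 : WithTop ℕ∞) = 1 + 1 by norm_num]
  refine ⟨contDiff_succ_iff_deriv.2 ⟨fun t => (h.deriv_x t (mem_univ _)).differentiableAt,
    by simp, ?_⟩, contDiff_succ_iff_deriv.2 ⟨fun t => (h.deriv_z t (mem_univ _)).differentiableAt,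
    by simp, ?_⟩⟩
  · rwa [funext fun t => (h.deriv_x t (mem_univ _)).deriv]
  · rwa [funext fun t => (h.deriv_z t (mem_univ _)).deriv]

lemma contDiff_three (hz : ∀ t, 1 ≤ z t) (hs : ∀ t, s t ^ 2 ≤ 12 * |κ t| ^ 3) :
    ContDiff ℝ 3 x ∧ ContDiff ℝ 3 z := by
  have hk1 : ContDiff ℝ 1 κ := contDiff_one_iff_deriv.2
    ⟨fun t => (h.hasDerivAt_curv hz hs t).differentiableAt, by
      rw [funext fun t => (h.hasDerivAt_curv hz hs t).deriv]
      exact h.continuous_deriv_curv hz hs⟩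
  have hdx : deriv x = c := funext fun t => (h.deriv_x t (mem_univ _)).deriv
  have hdz : deriv z = s := funext fun t => (h.deriv_z t (mem_univ _)).deriv
  obtain ⟨hx2, hz2⟩ := h.contDiff_two
  rw [show (2 : WithTop ℕ∞) = 1 + 1 by norm_num] at hx2 hz2
  have hc1 : ContDiff ℝ 1 c := hdx ▸ (contDiff_succ_iff_deriv.1 hx2).2.2
  have hs1 : ContDiff ℝ 1 s := hdz ▸ (contDiff_succ_iff_deriv.1 hz2).2.2
  have hc2 : ContDiff ℝ (1 + 1) c := contDiff_succ_iff_deriv.2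
    ⟨fun t => (h.deriv_c t (mem_univ _)).differentiableAt, by simp, by
      rw [funext fun t => (h.deriv_c t (mem_univ _)).deriv]
      exact (hs1.mul hk1).neg⟩
  have hs2 : ContDiff ℝ (1 + 1) s := contDiff_succ_iff_deriv.2
    ⟨fun t => (h.deriv_s t (mem_univ _)).differentiableAt, by simp, by
      rw [funext fun t => (h.deriv_s t (mem_univ _)).deriv]
      exact hc1.mul hk1⟩
  rw [show (3 : WithTop ℕ∞) = 1 + 1 + 1 by norm_num]
  refine ⟨contDiff_succ_iff_deriv.2 ⟨fun t => (h.deriv_x t (mem_univ _)).differentiableAt,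
    by simp, ?_⟩, contDiff_succ_iff_deriv.2 ⟨fun t => (h.deriv_z t (mem_univ _)).differentiableAt,
    by simp, ?_⟩⟩
  · rwa [hdx]
  · rwa [hdz]

end Contact

end UnitProfile

/-! ### Cylindrical ends -/

/-- A function whose derivative vanishes at `p` may be replaced by a constant before `p`. -/
lemma hasDerivAt_comp_max {f f' : ℝ → ℝ} (hf : ∀ t, HasDerivAt f (f' t) t) {p : ℝ}
    (hp : f' p = 0) (t : ℝ) : HasDerivAt (fun t => f (max p t)) (f' (max p t)) t := by
  rcases lt_trichotomy t p with h | rfl | h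
  · rw [max_eq_left h.le, hp]
    refine (hasDerivAt_const t (f p)).congr_of_eventuallyEq ?_
    filter_upwards [gt_mem_nhds h] with r hr
    rw [max_eq_left (le_of_lt hr)]
  · have h0 := hf t
    rw [max_self]
    rw [hp] at h0 ⊢
    have h1 : HasDerivWithinAt (fun r => f (max t r)) 0 (Iic t) t :=
      (hasDerivWithinAt_const t _ (f t)).congr (fun r hr => by rw [max_eq_left hr])
        (by rw [max_self])
    have h2 : HasDerivWithinAt (fun r => f (max t r)) 0 (Ici t) t :=
      h0.hasDerivWithinAt.congr (fun r hr => by rw [max_eq_right hr]) (by rw [max_self])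
    simpa using h1.union h2
  · rw [max_eq_right h.le]
    refine (hf t).congr_of_eventuallyEq ?_
    filter_upwards [lt_mem_nhds h] with r hr
    rw [max_eq_right (le_of_lt hr)]

/-- A function whose derivative vanishes at `p` and `q` may be replaced by constants before `p`
and after `q`. -/
lemma hasDerivAt_comp_clamp {f f' : ℝ → ℝ} (hf : ∀ t, HasDerivAt f (f' t) t) {p q : ℝ}
    (hpq : p ≤ q) (hp : f' p = 0) (hq : f' q = 0) (t : ℝ) :
    HasDerivAt (fun t => f (max p (min q t))) (f' (max p (min q t))) t := by
  have h1 := hasDerivAt_comp_max hf hp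
  have h2 : ∀ t, HasDerivAt (fun t => f (max p (-t))) (-f' (max p (-t))) t := fun t => by
    have := (h1 (-t)).comp t (hasDerivAt_neg t)
    rwa [mul_neg_one] at this
  have h3 := hasDerivAt_comp_max (p := -q) h2 (by rw [neg_neg, max_eq_right hpq, hq, neg_zero])
  have h4 := (h3 (-t)).comp t (hasDerivAt_neg t)
  rw [mul_neg_one] at h4
  have he : ∀ r, -max (-q) (-r) = min q r := fun r => by rw [max_neg_neg, neg_neg]
  simp only [Function.comp_def, he, neg_neg] at h4
  exact h4

namespace UnitProfile

variable {x z c s κ : ℝ → ℝ}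

/-- The part of a profile between two points of contact with the cylinder may be continued along
the cylinder. -/
lemma clamp (h : UnitProfile univ x z c s κ) {p q : ℝ} (hpq : p ≤ q) (hp : κ p = 0) (hq : κ q = 0)
    (hcp : c p = -1) (hcq : c q = -1) :
    UnitProfile univ (fun t => x (max p (min q t)) + max p (min q t) - t)
      (fun t => z (max p (min q t))) (fun t => c (max p (min q t)))
      (fun t => s (max p (min q t))) (fun t => κ (max p (min q t))) where
  deriv_x := fun t _ => by
    have hd : ∀ t, HasDerivAt (fun t => x t + t) (c t + 1) t := fun t =>
      (h.deriv_x t (mem_univ _)).add (hasDerivAt_id t)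
    refine ((hasDerivAt_comp_clamp hd hpq (by rw [hcp]; norm_num) (by rw [hcq]; norm_num) t).sub
      (hasDerivAt_id t)).congr_deriv (by ring)
  deriv_z := fun t _ => hasDerivAt_comp_clamp (fun t => h.deriv_z t (mem_univ _)) hpq
    (h.of_curv_eq_zero isOpen_univ (mem_univ p) hp).1
    (h.of_curv_eq_zero isOpen_univ (mem_univ q) hq).1 t
  deriv_c := fun t _ => hasDerivAt_comp_clamp (fun t => h.deriv_c t (mem_univ _)) hpq
    (by simp [hp]) (by simp [hq]) t
  deriv_s := fun t _ => hasDerivAt_comp_clamp (fun t => h.deriv_s t (mem_univ _)) hpq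
    (by simp [hp]) (by simp [hq]) t
  continuousOn_curv := (h.continuous_curv.comp
    (continuous_const.max (continuous_const.min continuous_id))).continuousOn
  unit := fun t _ => h.unit _ (mem_univ _)
  curv := fun t _ => h.curv _ (mem_univ _)
  pos := fun t _ => h.pos _ (mem_univ _)

end UnitProfile

/-- The profile of scale `a` rotates to a surface with `|A| = 1`. -/
lemma unitProfile_model {a : ℝ} (ha : 1 ≤ a) :
    UnitProfile univ (axial a) (height a) (fun t => Real.cos (tangentAngle a t))
      (fun t => -Real.sin (tangentAngle a t)) (fun t => -angularSpeed a (tangentAngle a t)) where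
  deriv_x := fun t _ => hasDerivAt_axial ha t
  deriv_z := fun t _ => hasDerivAt_height ha t
  deriv_c := fun t _ => (hasDerivAt_tangentAngle ha t).cos.congr_deriv (by ring)
  deriv_s := fun t _ => (hasDerivAt_tangentAngle ha t).sin.neg.congr_deriv (by ring)
  continuousOn_curv := ((continuous_angularSpeed a).comp
    (continuous_tangentAngle ha)).neg.continuousOn
  unit := fun t _ => by rw [neg_sq, add_comm, Real.sin_sq_add_cos_sq]
  curv := fun t _ => by rw [neg_sq]; exact angularSpeed_sq_add ha t
  pos := fun t _ => by linarith [one_le_height ha t]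

namespace RotSurface

/-! ### Rotational surfaces with `|A| = 1` and their profiles -/

lemma IsOfClass.exists_unitProfile {S : RotSurface} (hS : S.IsOfClass 2) (hA : S.HasUnitShape) :
    ∃ c s κ, UnitProfile (interior S.I) S.x S.z c s κ := by
  set J := interior S.I with hJ
  have hopen : IsOpen J := isOpen_interior
  obtain ⟨hx, hz⟩ := contDiffOn_profile hS.contDiffOn
  have hpos : ∀ t ∈ J, 0 < S.z t := fun t ht => (hS.pos_iff t (interior_subset ht)).2 ht
  have hd : ∀ {f : ℝ → ℝ}, ContDiffOn ℝ ((2 : ℕ∞) : WithTop ℕ∞) f J →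
      (∀ t ∈ J, HasDerivAt f (deriv f t) t) ∧ ContDiffOn ℝ 1 (deriv f) J ∧
      (∀ t ∈ J, HasDerivAt (deriv f) (deriv (deriv f) t) t) ∧
      ContinuousOn (deriv (deriv f)) J := by
    intro f hf
    have h1 : ContDiffOn ℝ 1 (deriv f) J := by
      have hf' : ContDiffOn ℝ (1 + 1) f J := by
        rw [show (1 + 1 : WithTop ℕ∞) = ((2 : ℕ∞) : WithTop ℕ∞) by norm_num]; exact hf
      exact ((contDiffOn_succ_iff_deriv_of_isOpen hopen).1 hf').2.2
    exact ⟨fun t ht => ((hf.differentiableOn (by norm_num)).differentiableAt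
      (hopen.mem_nhds ht)).hasDerivAt, h1, fun t ht => ((h1.differentiableOn
      one_ne_zero).differentiableAt (hopen.mem_nhds ht)).hasDerivAt,
      h1.continuousOn_deriv_of_isOpen hopen le_rfl⟩
  obtain ⟨hx1, hx2, hx3, hx4⟩ := hd hx
  obtain ⟨hz1, hz2, hz3, hz4⟩ := hd hz
  have hunit : ∀ t ∈ J, deriv S.x t ^ 2 + deriv S.z t ^ 2 = 1 := hS.unit_speed
  have horth : ∀ t ∈ J, deriv S.x t * deriv (deriv S.x) t +
      deriv S.z t * deriv (deriv S.z) t = 0 := by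
    intro t ht
    have h1 := ((hx3 t ht).pow 2).add ((hz3 t ht).pow 2)
    have h2 : (fun r => deriv S.x r ^ 2 + deriv S.z r ^ 2) =ᶠ[𝓝 t] fun _ => 1 := by
      filter_upwards [hopen.mem_nhds ht] with r hr using hunit r hr
    have h3 := (h1.congr_of_eventuallyEq h2.symm).unique (hasDerivAt_const t 1)
    norm_num at h3
    linarith
  refine ⟨deriv S.x, deriv S.z,
    fun t => deriv S.x t * deriv (deriv S.z) t - deriv (deriv S.x) t * deriv S.z t, ?_⟩
  exact
    { deriv_x := hx1
      deriv_z := hz1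
      deriv_c := fun t ht => (hx3 t ht).congr_deriv (by
        linear_combination deriv S.x t * horth t ht - deriv (deriv S.x) t * hunit t ht)
      deriv_s := fun t ht => (hz3 t ht).congr_deriv (by
        linear_combination deriv S.z t * horth t ht - deriv (deriv S.z) t * hunit t ht)
      continuousOn_curv := (hx2.continuousOn.mul hz4).sub (hx4.mul hz2.continuousOn)
      unit := hunit
      curv := fun t ht => by
        obtain ⟨n, hn⟩ := exists_isUnitNormal (S := S) (c := deriv S.x) (s := deriv S.z) 0
          (hx1 t ht) (hz1 t ht) (hpos t ht) (hunit t ht)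
        have h1 := hA (t, 0) ⟨ht, mem_univ _⟩ n hn
        rw [trace_shapeOperator_sq (c := deriv S.x) (s := deriv S.z) 0 n
          (eventually_of_mem (hopen.mem_nhds ht) hx1) (eventually_of_mem (hopen.mem_nhds ht) hz1)
          (hx3 t ht) (hz3 t ht) (hpos t ht) (hunit t ht) hn] at h1
        exact h1
      pos := hpos }

lemma isComplete_of_unitProfile {S : RotSurface} {c s κ : ℝ → ℝ} (hI : S.I = univ)
    (h : UnitProfile univ S.x S.z c s κ) :
    S.IsComplete :=
  isComplete_of_univ hI (fun t => h.deriv_x t (mem_univ _)) (fun t => h.deriv_z t (mem_univ _))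
    (fun t => h.deriv_c t (mem_univ _)) (fun t => h.deriv_s t (mem_univ _))
    (fun t => h.unit t (mem_univ _)) h.abs_curv_le_one (fun t => h.pos t (mem_univ _))

lemma hasUnitShape_of_unitProfile {S : RotSurface} {c s κ : ℝ → ℝ}
    (h : UnitProfile univ S.x S.z c s κ) :
    S.HasUnitShape := by
  rintro ⟨t, φ⟩ - n hn
  rw [trace_shapeOperator_sq φ n (Eventually.of_forall fun r => h.deriv_x r (mem_univ _))
    (Eventually.of_forall fun r => h.deriv_z r (mem_univ _)) (h.deriv_c t (mem_univ _))
    (h.deriv_s t (mem_univ _)) (h.pos t (mem_univ _)) (h.unit t (mem_univ _)) hn,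
    ← h.curv t (mem_univ _)]
  linear_combination (κ t ^ 2 * (c t ^ 2 + s t ^ 2) + κ t ^ 2) * h.unit t (mem_univ _)

lemma isOfClass_of_unitProfile {S : RotSurface} {c s κ : ℝ → ℝ} (hI : S.I = univ)
    (h : UnitProfile univ S.x S.z c s κ) {k : ℕ∞} (hk : 1 ≤ k) (hx : ContDiff ℝ k S.x)
    (hz : ContDiff ℝ k S.z) : S.IsOfClass k := by
  refine isOfClass_of_univ hI hk hx hz (fun t => h.pos t (mem_univ _)) fun t => ?_
  rw [(h.deriv_x t (mem_univ _)).deriv, (h.deriv_z t (mem_univ _)).deriv, h.unit t (mem_univ _)]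

/-! ### Reflection and congruence -/

/-- The reflection of space in the plane orthogonal to the `x`-axis. -/
noncomputable def axisReflection : E3 ≃ᵃⁱ[ℝ] E3 :=
  (LinearIsometryEquiv.piLpCongrRight 2 fun i : Fin 3 =>
    if i = 0 then LinearIsometryEquiv.neg ℝ else LinearIsometryEquiv.refl ℝ ℝ).toAffineIsometryEquiv

lemma axisReflection_apply (a b d : ℝ) : axisReflection !₂[a, b, d] = !₂[-a, b, d] := by
  ext i
  fin_cases i <;> simp [axisReflection]

/-- The same surface, described by the reflected profile curve. -/
noncomputable def mirror (S : RotSurface) : RotSurface :=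
  ⟨S.I, fun t => -S.x t, S.z, axisReflection.trans S.g⟩

lemma mirror_map (S : RotSurface) : S.mirror.map = S.map := by
  funext p
  simp only [map, mirror, AffineIsometryEquiv.coe_trans, Function.comp_apply,
    axisReflection_apply, neg_neg]

lemma mirror_points (S : RotSurface) : S.mirror.points = S.points := by
  ext m
  simp only [points, mirror_map, mem_ofPred_eq]
  rfl

lemma mirror_carrier (S : RotSurface) : S.mirror.carrier = S.carrier := by
  rw [carrier, mirror_points, carrier]

lemma mirror_congruent_iff {S S' : RotSurface} : S.mirror.Congruent S' ↔ S.Congruent S' := by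
  rw [Congruent, mirror_points, Congruent]

lemma IsOfClass.mirror {S : RotSurface} {k : ℕ∞} (hS : S.IsOfClass k) :
    S.mirror.IsOfClass k where
  ordConnected := hS.ordConnected
  nonempty_interior := hS.nonempty_interior
  continuousOn_x := hS.continuousOn_x.neg
  continuousOn_z := hS.continuousOn_z
  nonneg := hS.nonneg
  pos_iff := hS.pos_iff
  contDiffOn := by rw [mirror_map]; exact hS.contDiffOn
  immersion := by rw [mirror_map]; exact hS.immersion
  unit_speed := fun t ht => by
    have : deriv S.mirror.x t = -deriv S.x t := deriv.fun_neg
    rw [this, neg_sq]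
    exact hS.unit_speed t ht
  pole := fun t ht h0 => by
    obtain ⟨f, hf, he⟩ := hS.pole t ht h0
    refine ⟨fun p => -f p, hf.neg, ?_⟩
    filter_upwards [he] with r hr φ
    exact congrArg Neg.neg (hr φ)

lemma IsComplete.mirror {S : RotSurface} (hS : S.IsComplete) : S.mirror.IsComplete := by
  rw [IsComplete, mirror_points]; exact hS

lemma congruent_refl (S : RotSurface) : S.Congruent S :=
  ⟨AffineIsometryEquiv.refl ℝ E3, Homeomorph.refl _, fun _ => rfl⟩

/-- Surfaces over the whole line whose profiles differ by a shift of the parameter and a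
translation along the axis are congruent. -/
lemma congruent_of_shift {S S' : RotSurface} (hI : S.I = univ) (hI' : S'.I = univ) (b d : ℝ)
    (hz : ∀ t, S.z t = S'.z (t + b)) (hx : ∀ t, S.x t = S'.x (t + b) + d) : S.Congruent S' := by
  set R : E3 ≃ᵃⁱ[ℝ] E3 := (S.g.symm.trans
    (AffineIsometryEquiv.constVAdd ℝ E3 (!₂[-d, 0, 0] : E3))).trans S'.g with hR
  have hmap : ∀ t φ, R (S.map (t, φ)) = S'.map (t + b, φ) := by
    intro t φ
    simp only [hR, map, AffineIsometryEquiv.coe_trans, Function.comp_apply,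
      AffineIsometryEquiv.symm_apply_apply, AffineIsometryEquiv.coe_constVAdd, hz, hx]
    congr 1
    ext i
    fin_cases i <;> simp
  have hmem : ∀ m : ℝ × E3, m ∈ S.points ↔
      ((Homeomorph.addRight b).prodCongr R.toHomeomorph) m ∈ S'.points := by
    rintro ⟨t, p⟩
    constructor
    · rintro ⟨-, φ, hp⟩
      refine ⟨by simp [hI'], φ, ?_⟩
      have hp' : p = S.map (t, φ) := hp
      change R p = S'.map (t + b, φ)
      rw [hp', hmap]
    · rintro ⟨-, φ, hp⟩
      refine ⟨by simp [hI], φ, R.injective ?_⟩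
      change R p = R (S.map (t, φ))
      rw [hmap]
      exact hp
  exact ⟨R, ((Homeomorph.addRight b).prodCongr R.toHomeomorph).subtype hmem, fun m => rfl⟩

lemma Congruent.exists_carrier {S S' : RotSurface} (h : S.Congruent S') :
    ∃ R : E3 ≃ᵃⁱ[ℝ] E3, (∀ p ∈ S.carrier, R p ∈ S'.carrier) ∧
      ∀ p ∈ S'.carrier, R.symm p ∈ S.carrier := by
  obtain ⟨R, h, hR⟩ := h
  refine ⟨R, ?_, ?_⟩
  · rintro _ ⟨m, hm, rfl⟩
    exact ⟨_, (h ⟨m, hm⟩).2, hR ⟨m, hm⟩⟩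
  · rintro _ ⟨m, hm, rfl⟩
    refine ⟨_, (h.symm ⟨m, hm⟩).2, ?_⟩
    have := hR (h.symm ⟨m, hm⟩)
    rw [Homeomorph.apply_symm_apply] at this
    simp only at this
    rw [this, AffineIsometryEquiv.symm_apply_apply]

/-! ### Cylinders and spheres -/

lemma dist_g_sq (S : RotSurface) (a b d a' b' d' : ℝ) :
    dist (S.g !₂[a, b, d]) (S.g !₂[a', b', d']) ^ 2 =
      (a - a') ^ 2 + (b - b') ^ 2 + (d - d') ^ 2 := by
  rw [S.g.dist_map, EuclideanSpace.dist_eq, Real.sq_sqrt (by positivity), Fin.sum_univ_three]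
  simp [Real.dist_eq, sq_abs]

lemma exists_g_eq (S : RotSurface) (p : E3) : ∃ a b d : ℝ, p = S.g !₂[a, b, d] := by
  refine ⟨S.g.symm p 0, S.g.symm p 1, S.g.symm p 2, ?_⟩
  have : (!₂[S.g.symm p 0, S.g.symm p 1, S.g.symm p 2] : E3) = S.g.symm p := by
    ext i; fin_cases i <;> simp
  rw [this, AffineIsometryEquiv.apply_symm_apply]

lemma exists_polar {b d r : ℝ} (hr : 0 ≤ r) (h : b ^ 2 + d ^ 2 = r ^ 2) :
    ∃ φ : ℝ, b = r * Real.sin φ ∧ d = r * Real.cos φ := by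
  have hnorm : ‖(⟨d, b⟩ : ℂ)‖ = r := by
    rw [Complex.norm_def, Complex.normSq_mk, ← Real.sqrt_sq hr, ← h]
    congr 1; ring
  have hs := Complex.norm_mul_sin_arg ⟨d, b⟩
  have hc := Complex.norm_mul_cos_arg ⟨d, b⟩
  rw [hnorm] at hs hc
  exact ⟨_, hs.symm, hc.symm⟩

lemma infDist_axis (S : RotSurface) (a b d : ℝ) :
    Metric.infDist (S.g !₂[a, b, d]) (range fun r : ℝ => S.g 0 + r • S.frame 0) =
      √(b ^ 2 + d ^ 2) := by
  have hline : ∀ r : ℝ, S.g 0 + r • S.frame 0 = S.g !₂[r, 0, 0] := fun r => by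
    rw [g_apply]; simp
  simp only [hline]
  have hd : ∀ r, dist (S.g !₂[a, b, d]) (S.g !₂[r, 0, 0]) = √((a - r) ^ 2 + b ^ 2 + d ^ 2) :=
    fun r => by
      rw [← Real.sqrt_sq (dist_nonneg (x := S.g !₂[a, b, d]) (y := S.g !₂[r, 0, 0])), dist_g_sq]
      congr 1; ring
  refine le_antisymm ?_ ?_
  · refine (Metric.infDist_le_dist_of_mem (mem_range_self a)).trans ?_
    rw [hd]
    exact Real.sqrt_le_sqrt (by simp)
  · refine (Metric.le_infDist (range_nonempty _)).2 ?_
    rintro _ ⟨r, rfl⟩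
    rw [hd]
    exact Real.sqrt_le_sqrt (by nlinarith [sq_nonneg (a - r)])

lemma isCylinder_of_curv_eq_zero {S : RotSurface} {c s κ : ℝ → ℝ} (hI : S.I = univ)
    (h : UnitProfile univ S.x S.z c s κ) (h0 : ∀ t, κ t = 0) : S.IsCylinder 1 := by
  have hz : ∀ t, S.z t = 1 := fun t => (h.of_curv_eq_zero isOpen_univ (mem_univ t) (h0 t)).2.1
  have hc : ∀ t, c t = c 0 := fun t => eq_of_hasDerivAt_zero fun r _ =>
    (h.deriv_c r (mem_univ _)).congr_deriv (by simp [h0])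
  have hc2 : c 0 ^ 2 = 1 := (h.of_curv_eq_zero isOpen_univ (mem_univ 0) (h0 0)).2.2
  have hx : ∀ t, S.x t = S.x 0 + c 0 * t := fun t => by
    have : S.x t - c 0 * t = S.x 0 - c 0 * 0 :=
      eq_of_hasDerivAt_zero (f := fun t => S.x t - c 0 * t) fun r _ =>
        ((h.deriv_x r (mem_univ _)).sub ((hasDerivAt_id r).const_mul (c 0))).congr_deriv
          (by rw [hc r]; ring)
    linarith
  have hc0 : c 0 ≠ 0 := by
    intro h1
    rw [h1] at hc2
    norm_num at hc2
  have hmap : ∀ t φ, S.map (t, φ) = S.g !₂[S.x 0 + c 0 * t, Real.sin φ, Real.cos φ] := by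
    intro t φ
    simp only [map, hz, one_mul, hx t]
  refine ⟨S.g 0, S.frame 0, S.frame.orthonormal.ne_zero 0, ?_, ?_, ?_⟩
  · rintro ⟨t, p⟩ ⟨-, φ, hp⟩
    have hp' : p = S.map (t, φ) := hp
    simp only [mem_ofPred_eq]
    rw [hp', hmap, infDist_axis, Real.sin_sq_add_cos_sq, Real.sqrt_one]
  · rintro ⟨t, p⟩ ⟨-, φ, hp⟩ ⟨t', p'⟩ ⟨-, φ', hp'⟩ he
    have h1 : p = S.map (t, φ) := hp
    have h2 : p' = S.map (t', φ') := hp'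
    have he' : p = p' := he
    have h3 := he'
    rw [h1, h2, hmap, hmap] at h3
    have h4 := congrArg (fun y : E3 => y 0) (S.g.injective h3)
    simp [hc0] at h4
    rw [h4, he']
  · intro p hp
    obtain ⟨a, b, d, rfl⟩ := S.exists_g_eq p
    rw [mem_ofPred_eq, infDist_axis, Real.sqrt_eq_one] at hp
    obtain ⟨φ, hφ1, hφ2⟩ := exists_polar (b := b) (d := d) zero_le_one (by rw [hp]; norm_num)
    refine ⟨((a - S.x 0) / c 0, _), ⟨by simp [hI], φ, ?_⟩, rfl⟩
    rw [hmap, hφ1, hφ2, mul_div_cancel₀ _ hc0]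
    simp

end RotSurface

/-- If the profile approaches the axis at an end of its parameter interval where its curvature is
negative, then the first integral vanishes, and the principal curvatures agree. -/
lemma UnitProfile.umbilic_of_tendsto_zero {J : Set ℝ} {x z c s κ : ℝ → ℝ}
    (h : UnitProfile J x z c s κ) (hJ : IsOpen J) (hJc : J.OrdConnected) {b : ℝ}
    (hb : (𝓝[J] b).NeBot) (hz : Tendsto z (𝓝[J] b) (𝓝 0)) {δ : ℝ} (hδ : 0 < δ)
    (hneg : ∀ t ∈ J, |t - b| < δ → κ t < 0) :
    ∀ t ∈ J, κ t < 0 ∧ z t * κ t + c t = 0 := by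
  set G : Set ℝ := {t | t ∈ J ∧ κ t < 0 ∧ firstIntegral z c κ t = 0} with hG
  have hlin : ∀ t ∈ J, firstIntegral z c κ t = 0 → z t * κ t + c t = 0 := by
    intro t ht h0
    rw [firstIntegral, mul_eq_zero, neg_eq_zero, mul_eq_zero] at h0
    exact (h0.resolve_right (Real.exp_pos _).ne').resolve_left (h.pos t ht).ne'
  have hcurv : ∀ t ∈ J, z t * κ t + c t = 0 → κ t ^ 2 = 1 / 2 := by
    intro t ht h0
    have h1 : c t / z t = -κ t := by
      rw [div_eq_iff (h.pos t ht).ne']; linarith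
    have := h.curv t ht
    rw [h1] at this
    linarith
  have hopen : IsOpen G := by
    rw [isOpen_iff_mem_nhds]
    rintro t ⟨ht, ht1, ht2⟩
    have hc : ContinuousAt κ t := h.continuousOn_curv.continuousAt (hJ.mem_nhds ht)
    obtain ⟨ε, hε, hball⟩ := Metric.mem_nhds_iff.1
      (inter_mem (hJ.mem_nhds ht) (hc.eventually (gt_mem_nhds ht1)))
    refine mem_of_superset (Metric.ball_mem_nhds t hε) fun r hr => ?_
    have hsub : uIcc r t ⊆ J ∩ {r | κ r < 0} :=
      ((Real.ball_eq_Ioo t ε ▸ ordConnected_Ioo).uIcc_subset hr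
        (Metric.mem_ball_self hε)).trans hball
    exact ⟨(hsub left_mem_uIcc).1, (hsub left_mem_uIcc).2,
      (h.firstIntegral_eq hJ fun q hq => hsub hq).trans ht2⟩
  -- the first integral is constant near the end `b`, and tends to zero there
  obtain ⟨t₀, ht₀⟩ : ∃ t₀, t₀ ∈ G := by
    have hev : ∀ᶠ t in 𝓝[J] b, t ∈ J ∧ |t - b| < δ := by
      refine eventually_mem_nhdsWithin.and (nhdsWithin_le_nhds ?_)
      exact (by fun_prop : Continuous fun t => |t - b|).continuousAt.eventually
        (gt_mem_nhds (by simpa using hδ))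
    obtain ⟨t₀, ht₀, ht₀δ⟩ := hev.exists
    refine ⟨t₀, ht₀, hneg t₀ ht₀ ht₀δ, ?_⟩
    have hconst : ∀ᶠ t in 𝓝[J] b, firstIntegral z c κ t = firstIntegral z c κ t₀ := by
      filter_upwards [hev] with t ht
      refine h.firstIntegral_eq hJ fun r hr => ?_
      have hrJ := hJc.uIcc_subset ht.1 ht₀ hr
      have hrb : r ∈ Metric.ball b δ := by
        refine (Real.ball_eq_Ioo b δ ▸ ordConnected_Ioo :
          (Metric.ball b δ).OrdConnected).uIcc_subset ?_ ?_ hr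
        · rw [Metric.mem_ball, Real.dist_eq]; exact ht.2
        · rw [Metric.mem_ball, Real.dist_eq]; exact ht₀δ
      rw [Metric.mem_ball, Real.dist_eq] at hrb
      exact ⟨hrJ, hneg r hrJ hrb⟩
    refine tendsto_nhds_unique (tendsto_const_nhds.congr' (hconst.mono fun t ht => ht.symm)) ?_
    refine squeeze_zero_norm' (a := fun t => z t * (z t + 1)) ?_ (by
      simpa using hz.mul (hz.add_const 1))
    filter_upwards [hev] with t ht
    have hzt := h.pos t ht.1
    have hκ : |κ t| ≤ 1 := by
      rw [← sq_le_one_iff_abs_le_one]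
      linarith [h.curv t ht.1, sq_nonneg (c t / z t)]
    have hc : |c t| ≤ 1 := by
      rw [← sq_le_one_iff_abs_le_one]
      linarith [h.unit t ht.1, sq_nonneg (s t)]
    have h1 : |z t * κ t + c t| ≤ z t + 1 := by
      refine (abs_add_le _ _).trans ?_
      rw [abs_mul, abs_of_pos hzt]
      nlinarith
    have h2 : Real.exp (-Real.arccos (-(c t / z t))) ≤ 1 := by
      rw [Real.exp_le_one_iff]; linarith [Real.arccos_nonneg (-(c t / z t))]
    rw [firstIntegral, Real.norm_eq_abs, abs_mul, abs_neg, abs_mul, abs_of_pos hzt,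
      abs_of_pos (Real.exp_pos _)]
    calc z t * |z t * κ t + c t| * Real.exp (-Real.arccos (-(c t / z t)))
        ≤ z t * (z t + 1) * 1 := by gcongr
      _ = z t * (z t + 1) := mul_one _
  have hsub : J ⊆ G := by
    refine hJc.isPreconnected.subset_of_closure_inter_subset hopen ⟨t₀, ht₀.1, ht₀⟩ ?_
    rintro t ⟨htc, htJ⟩
    have hcont : ∀ {f : ℝ → ℝ}, ContinuousAt f t → (∀ r ∈ G, f r = 0) → f t = 0 := by
      intro f hf hfG
      have : (𝓝[G] t).NeBot := mem_closure_iff_nhdsWithin_neBot.1 htc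
      refine tendsto_nhds_unique (hf.tendsto.mono_left nhdsWithin_le_nhds :
        Tendsto f (𝓝[G] t) _) (tendsto_const_nhds.congr' ?_)
      filter_upwards [self_mem_nhdsWithin] with r hr using (hfG r hr).symm
    have hκc : ContinuousAt κ t := h.continuousOn_curv.continuousAt (hJ.mem_nhds htJ)
    have hval : ∀ r ∈ G, κ r = -√(1 / 2) := fun r hr => by
      rw [← hcurv r hr.1 (hlin r hr.1 hr.2.2), Real.sqrt_sq_eq_abs, abs_of_neg hr.2.1, neg_neg]
    have h1 : κ t + √(1 / 2) = 0 := hcont (f := fun r => κ r + √(1 / 2))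
      (hκc.add continuousAt_const) fun r hr => by simp only [hval r hr]; ring
    have h2 : z t * κ t + c t = 0 := hcont (f := fun r => z r * κ r + c r)
      (((h.deriv_z t htJ).continuousAt.mul hκc).add
      (h.deriv_c t htJ).continuousAt) fun r hr => hlin r hr.1 hr.2.2
    refine ⟨htJ, ?_, ?_⟩
    · have : 0 < √(1 / 2 : ℝ) := by positivity
      linarith
    · rw [firstIntegral, h2]; simp
  exact fun t ht => ⟨(hsub ht).2.1, hlin t ht (hsub ht).2.2⟩

namespace RotSurface

lemma mem_and_eq_zero_of_segment {S : RotSurface} (hS : S.IsOfClass 2) (hcomp : S.IsComplete)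
    {t₀ b : ℝ} (hb : ∀ r ∈ Ico (0 : ℝ) 1, t₀ + r * (b - t₀) ∈ interior S.I)
    (hbi : b ∉ interior S.I) : b ∈ S.I ∧ S.z b = 0 := by
  have hmem := hcomp.mem_of_segment hS (by norm_num) hb
  refine ⟨hmem, le_antisymm ?_ (hS.nonneg b hmem)⟩
  by_contra! hpos
  exact hbi ((hS.pos_iff b hmem).1 hpos)

/-- A complete surface with umbilic points only, whose profile interval is bounded because `z` is
a positive solution of `z'' = -z / 2`, is a round sphere. -/
lemma isRoundSphere_of_umbilic {S : RotSurface} {c s κ : ℝ → ℝ} (hS : S.IsOfClass 2)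
    (hcomp : S.IsComplete) (h : UnitProfile (interior S.I) S.x S.z c s κ)
    (humb : ∀ t ∈ interior S.I, κ t < 0 ∧ S.z t * κ t + c t = 0) :
    S.IsRoundSphere (√2) := by
  set J := interior S.I with hJ
  have hJo : IsOpen J := isOpen_interior
  have hJc : J.OrdConnected := hS.ordConnected.interior
  obtain ⟨t₀, ht₀⟩ := hS.nonempty_interior
  have hpi := Real.pi_pos
  set r := √2 with hr
  have hr0 : 0 < r := by positivity
  have hr2 : r ^ 2 = 2 := Real.sq_sqrt (by norm_num)
  have hκ : ∀ t ∈ J, κ t = -(1 / r) := by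
    intro t ht
    obtain ⟨h1, h2⟩ := humb t ht
    have h3 : c t / S.z t = -κ t := by
      rw [div_eq_iff (h.pos t ht).ne']; linarith
    have h4 := h.curv t ht
    rw [h3] at h4
    have h5 : (-κ t) ^ 2 = (1 / r) ^ 2 := by
      rw [div_pow, hr2]; linarith
    have := (pow_left_inj₀ (by linarith) (by positivity) two_ne_zero).1 h5
    linarith
  have hzc : ∀ t ∈ J, S.z t = r * c t := by
    intro t ht
    have := (humb t ht).2
    rw [hκ t ht] at this
    field_simp at this
    linarith
  have hcpos : ∀ t ∈ J, 0 < c t := fun t ht => by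
    have := h.pos t ht
    rw [hzc t ht] at this
    exact pos_of_mul_pos_right this hr0.le
  -- the unit tangent rotates with constant speed
  obtain ⟨ψ₀, hψ₀1, hψ₀2, hψ₀s, hψ₀c⟩ : ∃ ψ₀ : ℝ, -(Real.pi / 2) < ψ₀ ∧ ψ₀ < Real.pi / 2 ∧
      s t₀ = -Real.sin ψ₀ ∧ c t₀ = Real.cos ψ₀ := by
    have hs1 : -1 < -s t₀ ∧ -s t₀ < 1 := by
      have := h.unit t₀ ht₀
      have := hcpos t₀ ht₀
      constructor <;> nlinarith
    refine ⟨Real.arcsin (-s t₀), ?_, ?_, ?_, ?_⟩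
    · exact Real.neg_pi_div_two_lt_arcsin.2 hs1.1
    · exact Real.arcsin_lt_pi_div_two.2 hs1.2
    · rw [Real.sin_arcsin hs1.1.le hs1.2.le]; ring
    · rw [Real.cos_arcsin, neg_sq, show 1 - s t₀ ^ 2 = c t₀ ^ 2 by linarith [h.unit t₀ ht₀],
        Real.sqrt_sq (hcpos t₀ ht₀).le]
  set t₁ := t₀ - r * ψ₀ with ht₁
  set θ : ℝ → ℝ := fun t => (t - t₁) / r with hθ
  have hθ₀ : θ t₀ = ψ₀ := by simp only [hθ, ht₁]; field_simp; ring
  have hθd : ∀ t, HasDerivAt θ (1 / r) t := fun t => ((hasDerivAt_id t).sub_const t₁).div_const r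
  have hθc : Continuous θ := continuous_iff_continuousAt.2 fun t => (hθd t).continuousAt
  have hcs : ∀ t ∈ J, c t = Real.cos (θ t) := by
    intro t ht
    have hseg : ∀ q ∈ uIcc t t₀, q ∈ J := fun q hq => hJc.uIcc_subset ht ht₀ hq
    have hA : c t * Real.cos (θ t) - s t * Real.sin (θ t) =
        c t₀ * Real.cos (θ t₀) - s t₀ * Real.sin (θ t₀) := by
      refine eq_of_hasDerivAt_zero
        (f := fun t => c t * Real.cos (θ t) - s t * Real.sin (θ t)) fun q hq => ?_
      refine (((h.deriv_c q (hseg q hq)).mul (hθd q).cos).sub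
        ((h.deriv_s q (hseg q hq)).mul (hθd q).sin)).congr_deriv ?_
      rw [hκ q (hseg q hq)]
      ring
    rw [hθ₀, hψ₀s, hψ₀c] at hA
    have h1 := h.unit t ht
    have h2 := Real.sin_sq_add_cos_sq (θ t)
    have h3 := Real.sin_sq_add_cos_sq ψ₀
    have h4 : (c t - Real.cos (θ t)) ^ 2 = 0 := by
      nlinarith [sq_nonneg (c t - Real.cos (θ t)), sq_nonneg (s t + Real.sin (θ t))]
    exact sub_eq_zero.1 (pow_eq_zero_iff two_ne_zero |>.1 h4)
  have hθmem : ∀ t ∈ J, -(Real.pi / 2) < θ t ∧ θ t < Real.pi / 2 := by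
    have hno : ∀ t ∈ J, θ t ≠ Real.pi / 2 ∧ θ t ≠ -(Real.pi / 2) := by
      intro t ht
      have := hcpos t ht
      rw [hcs t ht] at this
      constructor <;> intro he <;> rw [he] at this <;> simp at this
    intro t ht
    have hpre := (hJc.isPreconnected.image θ hθc.continuousOn).ordConnected
    have hm0 : θ t₀ ∈ θ '' J := mem_image_of_mem _ ht₀
    have hm : θ t ∈ θ '' J := mem_image_of_mem _ ht
    rw [← hθ₀] at hψ₀1 hψ₀2
    constructor
    · by_contra! hle
      obtain ⟨q, hq, hqe⟩ := hpre.out hm hm0 ⟨hle, hψ₀1.le⟩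
      exact (hno q hq).2 hqe
    · by_contra! hle
      obtain ⟨q, hq, hqe⟩ := hpre.out hm0 hm ⟨hψ₀2.le, hle⟩
      exact (hno q hq).1 hqe
  have hbound : ∀ t ∈ J, t₁ - r * (Real.pi / 2) < t ∧ t < t₁ + r * (Real.pi / 2) := by
    intro t ht
    obtain ⟨h1, h2⟩ := hθmem t ht
    simp only [hθ] at h1 h2
    rw [lt_div_iff₀ hr0] at h1
    rw [div_lt_iff₀ hr0] at h2
    constructor <;> linarith
  have hbelow : BddBelow J := ⟨_, fun t ht => (hbound t ht).1.le⟩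
  have habove : BddAbove J := ⟨_, fun t ht => (hbound t ht).2.le⟩
  have hne : J.Nonempty := ⟨t₀, ht₀⟩
  have hJioo : J = Ioo (sInf J) (sSup J) := by
    have hpre : IsConnected J := ⟨hne, hJc.isPreconnected⟩
    refine Subset.antisymm (fun t ht => ⟨lt_of_le_of_ne (csInf_le hbelow ht) fun he => ?_,
      lt_of_le_of_ne (le_csSup habove ht) fun he => ?_⟩)
      (hpre.Ioo_csInf_csSup_subset hbelow habove)
    · obtain ⟨l, hl, hlJ⟩ := exists_Ioc_subset_of_mem_nhds (hJo.mem_nhds ht) (exists_lt t)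
      have := csInf_le hbelow (hlJ ⟨(left_lt_add_div_two.2 hl), (add_div_two_lt_right.2 hl).le⟩)
      linarith [add_div_two_lt_right.2 hl]
    · obtain ⟨l, hl, hlJ⟩ := exists_Ico_subset_of_mem_nhds (hJo.mem_nhds ht) (exists_gt t)
      have := le_csSup habove (hlJ ⟨(left_lt_add_div_two.2 hl).le, (add_div_two_lt_right.2 hl)⟩)
      linarith [left_lt_add_div_two.2 hl]
  set p := sInf J
  set q := sSup J
  have ht₀J : t₀ ∈ J := ht₀
  have hpq : p < t₀ ∧ t₀ < q := by rw [hJioo] at ht₀J; exact ht₀J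
  have hzcos : ∀ t ∈ closure J ∩ S.I, S.z t = r * Real.cos (θ t) := by
    rintro t ⟨htc, htI⟩
    have hnb : (𝓝[J] t).NeBot := mem_closure_iff_nhdsWithin_neBot.1 htc
    refine tendsto_nhds_unique ((hS.continuousOn_z t htI).mono interior_subset)
      (((continuous_const.mul (Real.continuous_cos.comp hθc)).tendsto t
        |>.mono_left nhdsWithin_le_nhds).congr' ?_)
    filter_upwards [self_mem_nhdsWithin] with a ha
    rw [hzc a ha, hcs a ha]
    rfl
  have hcl : closure J = Icc p q := by
    rw [hJioo]; exact closure_Ioo (by linarith [hpq.1, hpq.2])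
  obtain ⟨hpI, hpz⟩ := mem_and_eq_zero_of_segment hS hcomp (t₀ := t₀) (b := p) (fun a ha => by
    rw [← hJ, hJioo]
    constructor <;> nlinarith [ha.1, ha.2, hpq.1, hpq.2]) (by
    rw [← hJ, hJioo]; exact fun hh => lt_irrefl _ hh.1)
  obtain ⟨hqI, hqz⟩ := mem_and_eq_zero_of_segment hS hcomp (t₀ := t₀) (b := q) (fun a ha => by
    rw [← hJ, hJioo]
    constructor <;> nlinarith [ha.1, ha.2, hpq.1, hpq.2]) (by
    rw [← hJ, hJioo]; exact fun hh => lt_irrefl _ hh.2)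
  have hθlin : ∀ t, t = t₁ + r * θ t := fun t => by simp only [hθ]; field_simp; ring
  have hθmono : StrictMono θ := fun a a' haa => by
    simp only [hθ]
    exact div_lt_div_of_pos_right (by linarith) hr0
  have hθcl : ∀ t ∈ Icc p q, -(Real.pi / 2) ≤ θ t ∧ θ t ≤ Real.pi / 2 := by
    intro t ht
    rw [← hcl] at ht
    exact closure_minimal (t := {t | -(Real.pi / 2) ≤ θ t ∧ θ t ≤ Real.pi / 2})
      (fun a ha => ⟨(hθmem a ha).1.le, (hθmem a ha).2.le⟩)
      ((isClosed_le continuous_const hθc).inter (isClosed_le hθc continuous_const)) ht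
  have hpm : p ∈ Icc p q := ⟨le_rfl, by linarith [hpq.1, hpq.2]⟩
  have hqm : q ∈ Icc p q := ⟨by linarith [hpq.1, hpq.2], le_rfl⟩
  have hcos0 : ∀ t ∈ Icc p q, t ∈ S.I → S.z t = 0 →
      ¬(-(Real.pi / 2) < θ t ∧ θ t < Real.pi / 2) := by
    intro t ht htI h0 hin
    have h1 := hzcos t ⟨hcl ▸ ht, htI⟩
    rw [h0] at h1
    have := Real.cos_pos_of_mem_Ioo hin
    nlinarith
  have hθp : θ p = -(Real.pi / 2) := by
    refine le_antisymm ?_ (hθcl p hpm).1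
    by_contra! hlt
    exact hcos0 p hpm hpI hpz ⟨hlt, (hθmono hpq.1).trans_le (by rw [hθ₀]; exact hψ₀2.le)⟩
  have hθq : θ q = Real.pi / 2 := by
    refine le_antisymm (hθcl q hqm).2 ?_
    by_contra! hlt
    exact hcos0 q hqm hqI hqz ⟨lt_of_le_of_lt (by rw [hθ₀]; exact hψ₀1.le) (hθmono hpq.2), hlt⟩
  have hIcc : S.I = Icc p q := by
    refine Subset.antisymm (fun t ht => ⟨?_, ?_⟩) (hS.ordConnected.out hpI hqI)
    · by_contra! hlt
      have : p ∈ interior S.I := by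
        refine mem_interior.2 ⟨Ioo t q, fun a ha => hS.ordConnected.out ht hqI
          (Ioo_subset_Icc_self ha), isOpen_Ioo, hlt, by linarith [hpq.1, hpq.2]⟩
      rw [← hJ, hJioo] at this
      exact lt_irrefl _ this.1
    · by_contra! hlt
      have : q ∈ interior S.I := by
        refine mem_interior.2 ⟨Ioo p t, fun a ha => hS.ordConnected.out hpI ht
          (Ioo_subset_Icc_self ha), isOpen_Ioo, by linarith [hpq.1, hpq.2], hlt⟩
      rw [← hJ, hJioo] at this
      exact lt_irrefl _ this.2
  set x₁ := S.x t₀ - r * Real.sin (θ t₀) with hx₁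
  have hxJ : ∀ t ∈ J, S.x t = x₁ + r * Real.sin (θ t) := by
    intro t ht
    have : S.x t - r * Real.sin (θ t) = S.x t₀ - r * Real.sin (θ t₀) := by
      refine eq_of_hasDerivAt_zero (f := fun t => S.x t - r * Real.sin (θ t)) fun a ha => ?_
      have haJ := hJc.uIcc_subset ht ht₀ ha
      refine ((h.deriv_x a haJ).sub ((hθd a).sin.const_mul r)).congr_deriv ?_
      rw [hcs a haJ]
      field_simp
      ring
    linarith
  have hxI : ∀ t ∈ S.I, S.x t = x₁ + r * Real.sin (θ t) := by
    intro t htI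
    have htc : t ∈ closure J := by rw [hcl, ← hIcc]; exact htI
    have hnb : (𝓝[J] t).NeBot := mem_closure_iff_nhdsWithin_neBot.1 htc
    refine tendsto_nhds_unique ((hS.continuousOn_x t htI).mono interior_subset)
      (((continuous_const.add (continuous_const.mul (Real.continuous_sin.comp hθc))).tendsto t
        |>.mono_left nhdsWithin_le_nhds).congr' ?_)
    filter_upwards [self_mem_nhdsWithin] with a ha
    rw [hxJ a ha]
    rfl
  have hzI : ∀ t ∈ S.I, S.z t = r * Real.cos (θ t) := fun t htI =>
    hzcos t ⟨by rw [hcl, ← hIcc]; exact htI, htI⟩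
  refine ⟨S.g !₂[x₁, 0, 0], ?_, ?_, ?_⟩
  · rintro ⟨t, y⟩ ⟨htI, φ, hy⟩
    have hy' : y = S.map (t, φ) := hy
    have htI' : t ∈ S.I := htI
    rw [Metric.mem_sphere, hy', map, ← Real.sqrt_sq dist_nonneg, dist_g_sq, hr,
      hxI t htI', hzI t htI']
    congr 1
    have e1 := Real.sin_sq_add_cos_sq (θ t)
    have e2 := Real.sin_sq_add_cos_sq φ
    linear_combination hr2 + r ^ 2 * Real.cos (θ t) ^ 2 * e2 + r ^ 2 * e1
  · rintro ⟨t, y⟩ ⟨htI, φ, hy⟩ ⟨t', y'⟩ ⟨htI', φ', hy'⟩ he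
    have h1 : y = S.map (t, φ) := hy
    have h2 : y' = S.map (t', φ') := hy'
    have h3 : y = y' := he
    have h4 := h3
    rw [h1, h2, map, map] at h4
    have h5 := congrArg (fun v : E3 => v 0) (S.g.injective h4)
    have hxx : S.x t = S.x t' := by simpa using h5
    rw [hxI t htI, hxI t' htI'] at hxx
    have hsin : Real.sin (θ t) = Real.sin (θ t') := mul_left_cancel₀ hr0.ne' (by linarith)
    have htm := hθcl t (hIcc ▸ htI)
    have htm' := hθcl t' (hIcc ▸ htI')
    have := hθmono.injective (Real.injOn_sin htm htm' hsin)
    rw [this, h3]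
  · intro y hy
    obtain ⟨a, b, d, rfl⟩ := S.exists_g_eq y
    have hsq : (a - x₁) ^ 2 + b ^ 2 + d ^ 2 = r ^ 2 := by
      have := dist_g_sq S a b d x₁ 0 0
      rw [Metric.mem_sphere.1 hy] at this
      linarith
    have hle : ((a - x₁) / r) ^ 2 ≤ 1 := by
      rw [div_pow, div_le_one (by positivity)]
      nlinarith [sq_nonneg b, sq_nonneg d]
    obtain ⟨hlo, hhi⟩ := abs_le.1 ((sq_le_one_iff_abs_le_one _).1 hle)
    set t := t₁ + r * Real.arcsin ((a - x₁) / r) with ht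
    have hθt : θ t = Real.arcsin ((a - x₁) / r) := by simp only [hθ, ht]; field_simp; ring
    have htI : t ∈ S.I := by
      rw [hIcc]
      constructor
      · rw [← hθmono.le_iff_le, hθp, hθt]; exact Real.neg_pi_div_two_le_arcsin _
      · rw [← hθmono.le_iff_le, hθq, hθt]; exact Real.arcsin_le_pi_div_two _
    have hxt : S.x t = a := by
      rw [hxI t htI, hθt, Real.sin_arcsin hlo hhi]; field_simp; ring
    obtain ⟨φ, hφ1, hφ2⟩ := exists_polar (b := b) (d := d) (hS.nonneg t htI) (by
      rw [hzI t htI, hθt, mul_pow, Real.cos_sq', Real.sin_arcsin hlo hhi, div_pow]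
      field_simp
      linarith)
    refine ⟨(t, _), ⟨htI, φ, ?_⟩, rfl⟩
    rw [map, hxt, hφ1, hφ2]

/-- A complete surface whose profile is not defined on the whole line is a sphere. -/
lemma isRoundSphere_of_ne_univ {S : RotSurface} (hS : S.IsOfClass 2) (hcomp : S.IsComplete)
    (hA : S.HasUnitShape) (hI : S.I ≠ univ) : S.IsRoundSphere (√2) := by
  obtain ⟨c, s, κ, h⟩ := hS.exists_unitProfile hA
  set J := interior S.I with hJ
  have hJo : IsOpen J := isOpen_interior
  have hJc : J.OrdConnected := hS.ordConnected.interior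
  obtain ⟨t₀, ht₀⟩ := hS.nonempty_interior
  -- a finite end of the parameter interval is a pole
  obtain ⟨b, hbI, hbz, hbcl⟩ : ∃ b, b ∈ S.I ∧ S.z b = 0 ∧ b ∈ closure J := by
    obtain ⟨a, ha⟩ := (ne_univ_iff_exists_notMem _).1 hI
    have hseg : ∃ b, b ∉ J ∧ ∀ r ∈ Ico (0 : ℝ) 1, t₀ + r * (b - t₀) ∈ J := by
      set f : ℝ → ℝ := fun r => t₀ + r * (a - t₀) with hf
      have hfc : Continuous f := by fun_prop
      set Z := {r | f r ∉ J} ∩ Icc 0 1 with hZ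
      have hZc : IsCompact Z :=
        isCompact_Icc.inter_left ((hJo.isClosed_compl).preimage hfc)
      obtain ⟨r, hr, hmin⟩ := hZc.exists_isLeast ⟨1, by
        simp only [hf, mem_ofPred_eq, one_mul, add_sub_cancel]
        exact fun hh => ha (interior_subset hh), by simp⟩
      refine ⟨f r, hr.1, fun r' hr' => ?_⟩
      have h0 : r ≠ 0 := by
        rintro rfl
        exact hr.1 (by simpa [hf] using ht₀)
      have hrpos : 0 < r := lt_of_le_of_ne hr.2.1 (Ne.symm h0)
      have he : t₀ + r' * (f r - t₀) = f (r' * r) := by simp only [hf]; ring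
      rw [he]
      by_contra hn
      have := hmin ⟨hn, by nlinarith [hr'.1], by nlinarith [hr'.1, hr'.2, hr.2.2]⟩
      nlinarith [hr'.2]
    obtain ⟨b, hbJ, hb⟩ := hseg
    obtain ⟨h1, h2⟩ := mem_and_eq_zero_of_segment hS hcomp hb hbJ
    refine ⟨b, h1, h2, ?_⟩
    have hcont : Tendsto (fun r : ℝ => t₀ + r * (b - t₀)) (𝓝[<] 1) (𝓝 (t₀ + 1 * (b - t₀))) :=
      ((by fun_prop : Continuous fun r : ℝ => t₀ + r * (b - t₀)).tendsto 1).mono_left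
        nhdsWithin_le_nhds
    rw [one_mul, add_sub_cancel] at hcont
    refine mem_closure_of_tendsto hcont ?_
    filter_upwards [Ico_mem_nhdsLT (show (0 : ℝ) < 1 from one_pos)] with r hr using hb r hr
  have hnb : (𝓝[J] b).NeBot := mem_closure_iff_nhdsWithin_neBot.1 hbcl
  have hz : Tendsto S.z (𝓝[J] b) (𝓝 0) := by
    rw [← hbz]; exact (hS.continuousOn_z b hbI).mono interior_subset
  obtain ⟨δ, hδ, hsmall⟩ : ∃ δ > 0, ∀ t ∈ J, |t - b| < δ → S.z t < 1 := by
    have := hz.eventually (gt_mem_nhds one_pos)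
    obtain ⟨δ, hδ, hsub⟩ := Metric.mem_nhdsWithin_iff.1 this
    exact ⟨δ, hδ, fun t ht htb => hsub ⟨by rwa [Metric.mem_ball, Real.dist_eq], ht⟩⟩
  have hne : ∀ t ∈ J, |t - b| < δ → κ t ≠ 0 := fun t ht htb h0 => by
    have h1 := (h.of_curv_eq_zero hJo ht h0).2.1
    linarith [hsmall t ht htb]
  obtain ⟨t₁, ht₁, ht₁b⟩ : ∃ t₁ ∈ J, |t₁ - b| < δ := by
    obtain ⟨t₁, h1, h2⟩ := Metric.mem_closure_iff.1 hbcl δ hδ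
    exact ⟨t₁, h1, by rwa [dist_comm, Real.dist_eq] at h2⟩
  have hsign : ∀ {κ' : ℝ → ℝ}, ContinuousOn κ' J → (∀ t ∈ J, |t - b| < δ → κ' t ≠ 0) →
      κ' t₁ < 0 → ∀ t ∈ J, |t - b| < δ → κ' t < 0 := by
    intro κ' hκ' hne' hneg t ht htb
    by_contra! hge
    have hball : ∀ q ∈ uIcc t₁ t, q ∈ J ∧ |q - b| < δ := fun q hq => by
      refine ⟨hJc.uIcc_subset ht₁ ht hq, ?_⟩
      have : q ∈ Metric.ball b δ := by
        refine (Real.ball_eq_Ioo b δ ▸ ordConnected_Ioo :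
          (Metric.ball b δ).OrdConnected).uIcc_subset ?_ ?_ hq
        · rwa [Metric.mem_ball, Real.dist_eq]
        · rwa [Metric.mem_ball, Real.dist_eq]
      rwa [Metric.mem_ball, Real.dist_eq] at this
    obtain ⟨q, hq, hq0⟩ := intermediate_value_uIcc (hκ'.mono fun q hq => (hball q hq).1)
      (show (0 : ℝ) ∈ uIcc (κ' t₁) (κ' t) by
        rw [uIcc_of_le (by linarith)]; exact ⟨hneg.le, hge⟩)
    exact hne' q (hball q hq).1 (hball q hq).2 hq0
  rcases lt_or_gt_of_ne (hne t₁ ht₁ ht₁b) with hneg | hpos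
  · exact isRoundSphere_of_umbilic hS hcomp h (h.umbilic_of_tendsto_zero hJo hJc hnb hz hδ
      (hsign h.continuousOn_curv hne hneg))
  · have h' : UnitProfile (interior S.mirror.I) S.mirror.x S.mirror.z _ s _ := h.reflect
    have := isRoundSphere_of_umbilic hS.mirror hcomp.mirror h'
      (h.reflect.umbilic_of_tendsto_zero hJo hJc hnb hz hδ
        (hsign h.reflect.continuousOn_curv (fun t ht htb => neg_ne_zero.2 (hne t ht htb))
          (neg_neg_of_pos hpos)))
    rw [IsRoundSphere, mirror_points] at this
    exact this

end RotSurface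

/-! ### The periodic surfaces -/

lemma tangentAngle_add_mul_period {a : ℝ} (ha : 1 ≤ a) (t : ℝ) (k : ℕ) :
    tangentAngle a (t + k * (2 * halfPeriod a)) = tangentAngle a t + k * (2 * Real.pi) := by
  induction k with
  | zero => simp
  | succ k ih =>
    rw [Nat.cast_succ, show t + ((k : ℝ) + 1) * (2 * halfPeriod a) =
      t + k * (2 * halfPeriod a) + 2 * halfPeriod a by ring, tangentAngle_add_period ha, ih]
    ring

lemma axial_mul_period {a : ℝ} (ha : 1 ≤ a) (k : ℕ) :
    axial a (k * (2 * halfPeriod a)) = k * (2 * axial a (halfPeriod a)) := by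
  induction k with
  | zero => simp [axial_zero]
  | succ k ih =>
    rw [Nat.cast_succ, show ((k : ℝ) + 1) * (2 * halfPeriod a) =
      k * (2 * halfPeriod a) + 2 * halfPeriod a by ring, axial_add_period ha, ih]
    ring

lemma exists_lt_abs_axial {a : ℝ} (ha : 1 ≤ a) (C : ℝ) : ∃ t, C < |axial a t| := by
  have hd : 0 < |2 * axial a (halfPeriod a)| :=
    abs_pos.2 (mul_ne_zero two_ne_zero (axial_halfPeriod_neg ha).ne)
  obtain ⟨k, hk⟩ := exists_nat_gt (C / |2 * axial a (halfPeriod a)|)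
  refine ⟨k * (2 * halfPeriod a), ?_⟩
  rw [axial_mul_period ha, abs_mul, Nat.abs_cast]
  exact (div_lt_iff₀ hd).1 hk

namespace RotSurface

/-- The surface over the whole line with a given profile, in standard position. -/
noncomputable def ofProfile (x z : ℝ → ℝ) : RotSurface :=
  ⟨univ, x, z, AffineIsometryEquiv.refl ℝ E3⟩

/-- The periodic surface whose largest radius is `l`, for `l` above the critical height. -/
noncomputable def periodic (l : ℝ) : RotSurface :=
  ofProfile (axial (scaleOf l)) (height (scaleOf l))

lemma isOfClass_periodic {l : ℝ} (hl : criticalHeight < l) :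
    (periodic l).IsOfClass (⊤ : ℕ∞) := by
  have ha := one_lt_scaleOf hl
  exact isOfClass_of_unitProfile (S := periodic l) rfl (unitProfile_model ha.le) le_top
    (contDiff_infty.2 fun n => contDiff_axial ha n)
    (contDiff_infty.2 fun n => (contDiff_tangentAngle_height ha n).2)

lemma isPeriodic_periodic {l : ℝ} (hl : criticalHeight < l) : (periodic l).IsPeriodic := by
  have ha := (one_lt_scaleOf hl).le
  refine ⟨rfl, 2 * halfPeriod (scaleOf l), 2 * axial (scaleOf l) (halfPeriod (scaleOf l)), ?_, ?_,
    fun t => ⟨axial_add_period ha t, height_add_period ha t⟩⟩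
  · linarith [halfPeriod_pos ha]
  · linarith [axial_halfPeriod_neg ha]

/-- A surface whose profile contains a full hump of a model profile crosses itself. -/
lemma not_isEmbeddedSurface_of_hump {S : RotSurface} {c s κ : ℝ → ℝ} {a b : ℝ} (ha : 1 ≤ a)
    (hI : S.I = univ) (h : UnitProfile univ S.x S.z c s κ)
    (hump : ∀ t, |t + b| ≤ halfPeriod a → S.z t = height a (t + b) ∧
      c t = Real.cos (tangentAngle a (t + b)) ∧ s t = -Real.sin (tangentAngle a (t + b))) :
    ¬ IsEmbeddedSurface S.carrier := by
  obtain ⟨r, ⟨hr0, hr1⟩, hxr, hcr, hsr⟩ := exists_axial_eq_zero ha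
  have hb : ∀ u, u - b + b = u := fun u => by ring
  have hp := hump (r - b) (by rw [hb, abs_of_pos hr0]; exact hr1.le)
  have hm := hump (-r - b) (by rw [hb, abs_neg, abs_of_pos hr0]; exact hr1.le)
  rw [hb] at hp hm
  rw [height_neg ha, tangentAngle_neg ha, Real.cos_neg, Real.sin_neg, neg_neg] at hm
  have hx : S.x (r - b) - axial a (r - b + b) = S.x (-r - b) - axial a (-r - b + b) := by
    refine eq_of_hasDerivAt_zero (f := fun t => S.x t - axial a (t + b)) fun t ht => ?_
    rw [uIcc_of_ge (by linarith)] at ht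
    have hd := (h.deriv_x t (mem_univ _)).sub
      ((hasDerivAt_axial ha (t + b)).comp_add_const t b)
    refine hd.congr_deriv ?_
    rw [(hump t (abs_le.2 ⟨by linarith [ht.1], by linarith [ht.2]⟩)).2.1, sub_self]
  rw [hb, hb, axial_neg ha, hxr, neg_zero, sub_zero, sub_zero] at hx
  refine not_isEmbeddedSurface_of_crossing hI (h.deriv_x (r - b) (mem_univ _))
    (h.deriv_z _ (mem_univ _)) (h.deriv_x (-r - b) (mem_univ _)) (h.deriv_z _ (mem_univ _)) hx
    (hp.1.trans hm.1.symm) (h.pos _ (mem_univ _)).ne' ?_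
  rw [hp.2.1, hp.2.2, hm.2.1, hm.2.2]
  have := mul_neg_of_neg_of_pos hcr hsr
  linarith

lemma not_isEmbeddedSurface_periodic {l : ℝ} (hl : criticalHeight < l) :
    ¬ IsEmbeddedSurface (periodic l).carrier := by
  have ha := (one_lt_scaleOf hl).le
  refine not_isEmbeddedSurface_of_hump (S := periodic l) (b := 0) ha rfl (unitProfile_model ha)
    fun t _ => ?_
  rw [add_zero]
  exact ⟨rfl, rfl, rfl⟩

lemma hasMaxRadius_periodic {l : ℝ} (hl : criticalHeight < l) : (periodic l).HasMaxRadius l := by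
  have ha := (one_lt_scaleOf hl).le
  refine ⟨⟨0, mem_univ _, (height_zero ha).trans (maxHeight_scaleOf hl)⟩, ?_⟩
  rintro _ ⟨t, -, rfl⟩
  exact (height_le_maxHeight ha t).trans_eq (maxHeight_scaleOf hl)

lemma continuousOn_periodic_map :
    ContinuousOn (fun q : ℝ × (ℝ × ℝ) => (periodic q.1).map q.2) (Ioi criticalHeight ×ˢ univ) := by
  rw [continuousOn_iff_continuous_domRestrict]
  have hs : Continuous fun q : (Ioi criticalHeight ×ˢ univ : Set (ℝ × (ℝ × ℝ))) =>
      scaleOf q.1.1 :=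
    continuousOn_scaleOf.comp_continuous (continuous_fst.comp continuous_subtype_val)
      fun q => q.2.1
  have hp : Continuous fun q : (Ioi criticalHeight ×ˢ univ : Set (ℝ × (ℝ × ℝ))) =>
      ((⟨scaleOf q.1.1, one_lt_scaleOf q.2.1⟩, q.1.2.1) : Ioi (1 : ℝ) × ℝ) :=
    (hs.subtype_mk _).prodMk (by fun_prop)
  have hx := continuous_axial_uncurry.comp hp
  have hz := continuous_height_uncurry.comp hp
  have hφ : Continuous fun q : (Ioi criticalHeight ×ˢ univ : Set (ℝ × (ℝ × ℝ))) => q.1.2.2 := by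
    fun_prop
  refine (PiLp.continuous_toLp 2 _).comp (continuous_pi fun i => ?_)
  fin_cases i
  · exact hx
  · exact hz.mul (Real.continuous_sin.comp hφ)
  · exact hz.mul (Real.continuous_cos.comp hφ)

end RotSurface

/-! ### Surfaces whose curvature vanishes somewhere -/

namespace UnitProfile

variable {x z c s κ : ℝ → ℝ}

/-- Along a profile whose curvature vanishes somewhere, the bounds of the model of scale `1`
hold. -/
lemma critical_bounds (h : UnitProfile univ x z c s κ) {t₁ : ℝ} (h1 : κ t₁ = 0) (t : ℝ) :
    1 ≤ z t ∧ z t ≤ criticalHeight ∧ s t ^ 2 ≤ 12 * |κ t| ^ 3 := by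
  have key : ∀ {x c κ : ℝ → ℝ}, UnitProfile univ x z c s κ → κ t₁ = 0 → κ t < 0 →
      1 ≤ z t ∧ z t ≤ criticalHeight ∧ s t ^ 2 ≤ 12 * |κ t| ^ 3 := by
    intro x c κ h h1 ht
    rcases h.eq_model_of_curv_neg ht with ⟨a, b, -, hab⟩ | ⟨-, b, hb, hab⟩
    · exact absurd h1 (hab t₁).1.ne
    · obtain ⟨hκ, hz, -, hs⟩ := hab t hb.le
      refine ⟨hz ▸ one_le_height le_rfl _, hz ▸ height_le_maxHeight le_rfl _, ?_⟩
      have hy := one_add_le_sin_unitAngle_pow (neg_one_le_cos_div le_rfl (tangentAngle 1 (t + b)))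
        (cos_div_le_one le_rfl _)
      rw [hκ, hs, abs_neg, abs_of_nonneg (angularSpeed_nonneg le_rfl _), neg_sq, Real.sin_sq,
        angularSpeed]
      rw [div_one] at hy ⊢
      nlinarith [Real.cos_le_one (tangentAngle 1 (t + b)),
        Real.neg_one_le_cos (tangentAngle 1 (t + b))]
  rcases lt_trichotomy (κ t) 0 with ht | ht | ht
  · exact key h h1 ht
  · obtain ⟨hs, hz, -⟩ := h.of_curv_eq_zero isOpen_univ (mem_univ t) ht
    rw [hs, hz, ht]
    exact ⟨le_rfl, one_lt_criticalHeight.le, by norm_num⟩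
  · have := key h.reflect (by simp [h1]) (neg_neg_of_pos ht)
    rwa [abs_neg] at this

end UnitProfile

namespace RotSurface

/-- The complete, non-embedded surfaces of class `C^3` with `|A| = 1` whose largest radius is the
critical height. -/
def criticalSurfaces : Set RotSurface :=
  {S | S.IsOfClass 3 ∧ S.IsComplete ∧ S.HasUnitShape ∧ ¬ IsEmbeddedSurface S.carrier ∧
    S.HasMaxRadius criticalHeight}

/-- A zero of the curvature excludes the scales `a > 1`, so every hump is one of scale `1`, whose
height, self-intersection and order of contact with the cylinder are known. -/
lemma mem_criticalSurfaces {S : RotSurface} {c s κ : ℝ → ℝ} (hI : S.I = univ)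
    (h : UnitProfile univ S.x S.z c s κ) {t₀ t₁ : ℝ} (h0 : κ t₀ ≠ 0) (h1 : κ t₁ = 0) :
    S ∈ criticalSurfaces := by
  have hb := h.critical_bounds h1
  have key : ∀ {S : RotSurface} {c κ : ℝ → ℝ}, S.I = univ → UnitProfile univ S.x S.z c s κ →
      κ t₁ = 0 → κ t₀ < 0 → ¬ IsEmbeddedSurface S.carrier ∧ ∃ t, S.z t = criticalHeight := by
    intro S c κ hI h h1 h0
    rcases h.eq_model_of_curv_neg h0 with ⟨a, b, -, hab⟩ | ⟨-, b, -, hab⟩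
    · exact absurd h1 (hab t₁).1.ne
    · refine ⟨not_isEmbeddedSurface_of_hump le_rfl hI h fun t ht => (hab t ht).2, -b, ?_⟩
      have hz := (hab (-b) (by simp [(halfPeriod_pos le_rfl).le])).2.1
      rwa [neg_add_cancel, height_zero le_rfl] at hz
  obtain ⟨hemb, t, ht⟩ : ¬ IsEmbeddedSurface S.carrier ∧ ∃ t, S.z t = criticalHeight := by
    rcases lt_or_gt_of_ne h0 with h0 | h0
    · exact key hI h h1 h0
    · have := key (S := S.mirror) hI h.reflect (by simp [h1]) (neg_neg_of_pos h0)
      rwa [mirror_carrier] at this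
  obtain ⟨hx3, hz3⟩ := h.contDiff_three (fun t => (hb t).1) fun t => (hb t).2.2
  refine ⟨isOfClass_of_unitProfile hI h (by norm_num) (by exact_mod_cast hx3)
    (by exact_mod_cast hz3), isComplete_of_unitProfile hI h, hasUnitShape_of_unitProfile h, hemb,
    ⟨t, by simp [hI], ht⟩, ?_⟩
  rintro _ ⟨r, -, rfl⟩
  exact (hb r).2.1

/-! ### Congruences preserve the axis -/

lemma mem_carrier_ofProfile {x z : ℝ → ℝ} {p : E3} :
    p ∈ (ofProfile x z).carrier ↔
      ∃ t φ, p = !₂[x t, z t * Real.sin φ, z t * Real.cos φ] := by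
  constructor
  · rintro ⟨⟨t, _⟩, ⟨-, φ, hp⟩, rfl⟩
    exact ⟨t, φ, hp⟩
  · rintro ⟨t, φ, rfl⟩
    exact ⟨(t, _), ⟨mem_univ _, φ, rfl⟩, rfl⟩

lemma inner_coords_map (A : E3 ≃ₗᵢ[ℝ] E3) (p q : E3) :
    A p 0 * A q 0 + A p 1 * A q 1 + A p 2 * A q 2 = p 0 * q 0 + p 1 * q 1 + p 2 * q 2 := by
  have := A.inner_map_map p q
  simp only [PiLp.inner_apply, Fin.sum_univ_three, RCLike.inner_apply, conj_trivial] at this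
  linarith

/-- A linear isometry that preserves the direction of the axis acts separately on the axial
coordinate and on the radius. -/
lemma coords_map_of_axis (A : E3 ≃ₗᵢ[ℝ] E3) {f : E3} (hf : A !₂[1, 0, 0] = f) (hf1 : f 1 = 0)
    (hf2 : f 2 = 0) : f 0 ^ 2 = 1 ∧ ∀ p : E3, A p 0 = f 0 * p 0 ∧
      A p 1 ^ 2 + A p 2 ^ 2 = p 1 ^ 2 + p 2 ^ 2 := by
  have hff := inner_coords_map A !₂[1, 0, 0] !₂[1, 0, 0]
  rw [hf, hf1, hf2] at hff
  simp at hff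
  have he : f 0 ^ 2 = 1 := by linarith
  refine ⟨he, fun p => ?_⟩
  have h1 := inner_coords_map A p !₂[1, 0, 0]
  have h2 := inner_coords_map A p p
  rw [hf, hf1, hf2] at h1
  simp at h1
  have h3 : A p 0 = f 0 * p 0 := by linear_combination f 0 * h1 - A p 0 * he
  refine ⟨h3, ?_⟩
  rw [h3] at h2
  linear_combination h2 - p 0 ^ 2 * he

/-- A rigid motion that maps a surface of unbounded axial extent into another one with the same
axis, both of bounded radius, cannot decrease the largest radius; if it keeps it, the motion
preserves the axis. -/
lemma radius_le_of_mapsTo {x z x' z' : ℝ → ℝ} {l l' : ℝ} (R : E3 ≃ᵃⁱ[ℝ] E3)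
    (hR : ∀ p ∈ (ofProfile x z).carrier, R p ∈ (ofProfile x' z').carrier)
    (hx : ∀ C, ∃ t, C < |x t|) (hz : ∀ t, 0 ≤ z t ∧ z t ≤ l) (hz' : ∀ t, 0 ≤ z' t ∧ z' t ≤ l')
    (hl : ∃ t, z t = l) :
    l ≤ l' ∧ (l = l' → ∃ e o : ℝ, e ^ 2 = 1 ∧ ∀ p : E3, R p 0 = e * p 0 + o ∧
      R p 1 ^ 2 + R p 2 ^ 2 = p 1 ^ 2 + p 2 ^ 2) := by
  obtain ⟨A, hA⟩ : ∃ A, A = R.linearIsometryEquiv := ⟨_, rfl⟩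
  obtain ⟨o, ho⟩ : ∃ o, o = R 0 := ⟨_, rfl⟩
  have hRA : ∀ p, R p = A p + o := fun p => by
    have := R.map_vadd 0 p
    rw [hA, ho]
    simpa using this
  have hl0 : 0 ≤ l := (hz 0).1.trans (hz 0).2
  have hl0' : 0 ≤ l' := (hz' 0).1.trans (hz' 0).2
  have hrad : ∀ t φ, R !₂[x t, z t * Real.sin φ, z t * Real.cos φ] 1 ^ 2 +
      R !₂[x t, z t * Real.sin φ, z t * Real.cos φ] 2 ^ 2 ≤ l' ^ 2 := by
    intro t φ
    obtain ⟨t', φ', he⟩ := mem_carrier_ofProfile.1 (hR _ (mem_carrier_ofProfile.2 ⟨t, φ, rfl⟩))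
    rw [he]
    simp only [Matrix.cons_val]
    have e1 := Real.sin_sq_add_cos_sq φ'
    have e2 : z' t' ^ 2 ≤ l' ^ 2 := pow_le_pow_left₀ (hz' t').1 (hz' t').2 2
    linear_combination e2 + z' t' ^ 2 * e1
  have hinner := inner_coords_map A
  obtain ⟨f, hf⟩ : ∃ f, f = A !₂[1, 0, 0] := ⟨_, rfl⟩
  obtain ⟨g, hg⟩ : ∃ g, g = A !₂[0, 0, 1] := ⟨_, rfl⟩
  have hpt : ∀ a b, A !₂[a, 0, b] = a • f + b • g := by
    intro a b
    rw [hf, hg, ← map_smul, ← map_smul, ← map_add]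
    congr 1
    ext i; fin_cases i <;> simp
  have hcoord : ∀ a b (i : Fin 3), R !₂[a, 0, b] i = a * f i + b * g i + o i := fun a b i => by
    rw [hRA, hpt]; simp
  have hff := hinner !₂[1, 0, 0] !₂[1, 0, 0]
  have hgg := hinner !₂[0, 0, 1] !₂[0, 0, 1]
  have hfg := hinner !₂[1, 0, 0] !₂[0, 0, 1]
  rw [← hf] at hff hfg
  rw [← hg] at hgg hfg
  simp at hff hgg hfg
  have hrad' : ∀ t, ∀ i : Fin 3, i ≠ 0 → |x t * f i + z t * g i + o i| ≤ l' := by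
    intro t i hi
    have := hrad t 0
    rw [Real.sin_zero, Real.cos_zero, mul_zero, mul_one, hcoord, hcoord] at this
    refine abs_le_of_sq_le_sq (le_trans ?_ this) hl0'
    fin_cases i
    · exact absurd rfl hi
    · simp only [Fin.mk_one, le_add_iff_nonneg_right]; positivity
    · simp only [Fin.reduceFinMk, le_add_iff_nonneg_left]; positivity
  have hg1 : ∀ i : Fin 3, |g i| ≤ 1 := by
    intro i
    rw [← sq_le_one_iff_abs_le_one]
    fin_cases i
    · change g 0 ^ 2 ≤ 1; nlinarith [sq_nonneg (g 1), sq_nonneg (g 2)]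
    · change g 1 ^ 2 ≤ 1; nlinarith [sq_nonneg (g 0), sq_nonneg (g 2)]
    · change g 2 ^ 2 ≤ 1; nlinarith [sq_nonneg (g 0), sq_nonneg (g 1)]
  -- the axial direction is preserved, since the image stays at bounded distance from the axis
  have hf0 : ∀ i : Fin 3, i ≠ 0 → f i = 0 := by
    intro i hi
    by_contra hne
    have hpos : 0 < |f i| := abs_pos.2 hne
    obtain ⟨t, ht⟩ := hx ((l' + l + |o i|) / |f i|)
    rw [div_lt_iff₀ hpos, ← abs_mul] at ht
    have h1 := hrad' t i hi
    have h2 : |z t * g i| ≤ l := by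
      rw [abs_mul, abs_of_nonneg (hz t).1]
      nlinarith [hg1 i, (hz t).1, (hz t).2, abs_nonneg (g i)]
    have h3 : x t * f i = (x t * f i + z t * g i + o i) - z t * g i - o i := by ring
    have h4 := abs_sub (x t * f i + z t * g i + o i - z t * g i) (o i)
    have h5 := abs_sub (x t * f i + z t * g i + o i) (z t * g i)
    rw [← h3] at h4
    linarith
  have hf1 := hf0 1 (by decide)
  have hf2 := hf0 2 (by decide)
  rw [hf1, hf2] at hff hfg
  have he : f 0 ^ 2 = 1 := by linarith
  have hg0 : g 0 = 0 := by
    rcases mul_eq_zero.1 (show f 0 * g 0 = 0 by linarith) with h | h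
    · rw [h] at he; norm_num at he
    · exact h
  rw [hg0] at hgg
  obtain ⟨t, ht⟩ := hl
  have hp := hrad t 0
  have hm := hrad t Real.pi
  rw [Real.sin_zero, Real.cos_zero, mul_zero, ht, hcoord, hcoord, hf1, hf2] at hp
  rw [Real.sin_pi, Real.cos_pi, mul_zero, ht, hcoord, hcoord, hf1, hf2] at hm
  -- opposite points of a largest circle see the displacement of the axis with opposite signs
  have hsum : l ^ 2 + (o 1 ^ 2 + o 2 ^ 2) ≤ l' ^ 2 := by
    linear_combination (hp + hm) / 2 - l ^ 2 * hgg
  refine ⟨abs_le_of_sq_le_sq' (by nlinarith [sq_nonneg (o 1), sq_nonneg (o 2)]) hl0' |>.2, ?_⟩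
  rintro rfl
  have ho1 : o 1 = 0 := by nlinarith [sq_nonneg (o 1), sq_nonneg (o 2)]
  have ho2 : o 2 = 0 := by nlinarith [sq_nonneg (o 1), sq_nonneg (o 2)]
  obtain ⟨-, hA⟩ := coords_map_of_axis A hf.symm hf1 hf2
  refine ⟨f 0, o 0, he, fun p => ?_⟩
  rw [hRA]
  simp only [PiLp.add_apply, ho1, ho2, add_zero]
  exact ⟨by rw [(hA p).1], (hA p).2⟩

lemma radius_eq_of_congruent {x z x' z' : ℝ → ℝ} {l l' : ℝ}
    (h : (ofProfile x z).Congruent (ofProfile x' z'))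
    (hx : ∀ C, ∃ t, C < |x t|) (hz : ∀ t, 0 ≤ z t ∧ z t ≤ l) (hl : ∃ t, z t = l)
    (hx' : ∀ C, ∃ t, C < |x' t|) (hz' : ∀ t, 0 ≤ z' t ∧ z' t ≤ l') (hl' : ∃ t, z' t = l') :
    l = l' := by
  obtain ⟨R, h1, h2⟩ := h.exists_carrier
  exact le_antisymm (radius_le_of_mapsTo R h1 hx hz hz' hl).1
    (radius_le_of_mapsTo R.symm h2 hx' hz' hz hl').1

lemma not_congruent_periodic {l m : ℝ} (hl : criticalHeight < l) (hm : criticalHeight < m)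
    (hne : l ≠ m) : ¬ (periodic l).Congruent (periodic m) := by
  intro h
  have key : ∀ {l : ℝ}, criticalHeight < l → (∀ C, ∃ t, C < |axial (scaleOf l) t|) ∧
      (∀ t, 0 ≤ height (scaleOf l) t ∧ height (scaleOf l) t ≤ l) ∧
      ∃ t, height (scaleOf l) t = l := by
    intro l hl
    have ha := (one_lt_scaleOf hl).le
    have hmax := maxHeight_scaleOf hl
    exact ⟨exists_lt_abs_axial ha, fun t => ⟨zero_le_one.trans (one_le_height ha t),
      (height_le_maxHeight ha t).trans_eq hmax⟩, 0, (height_zero ha).trans hmax⟩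
  obtain ⟨h1, h2, h3⟩ := key hl
  obtain ⟨h4, h5, h6⟩ := key hm
  exact hne (radius_eq_of_congruent h h1 h2 h3 h4 h5 h6)

/-- The axial coordinates of the circles of radius `l` on a surface about the `x`-axis. Where such
circles coincide, they count once. -/
def circleCoords (S : RotSurface) (l : ℝ) : Set ℝ :=
  {a | ∃ p ∈ S.carrier, p 0 = a ∧ p 1 ^ 2 + p 2 ^ 2 = l ^ 2}

lemma ncard_circleCoords_eq_of_congruent {x z x' z' : ℝ → ℝ} {l : ℝ}
    (h : (ofProfile x z).Congruent (ofProfile x' z'))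
    (hx : ∀ C, ∃ t, C < |x t|) (hz : ∀ t, 0 ≤ z t ∧ z t ≤ l) (hl : ∃ t, z t = l)
    (hz' : ∀ t, 0 ≤ z' t ∧ z' t ≤ l) :
    ((ofProfile x z).circleCoords l).ncard = ((ofProfile x' z').circleCoords l).ncard := by
  obtain ⟨R, h1, h2⟩ := h.exists_carrier
  obtain ⟨e, o, he, hR⟩ := (radius_le_of_mapsTo R h1 hx hz hz' hl).2 rfl
  have he0 : e ≠ 0 := by rintro rfl; norm_num at he
  have himage : (ofProfile x' z').circleCoords l =
      (fun a => e * a + o) '' (ofProfile x z).circleCoords l := by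
    ext a
    constructor
    · rintro ⟨p, hp, rfl, hpl⟩
      have hRp := hR (R.symm p)
      rw [AffineIsometryEquiv.apply_symm_apply] at hRp
      exact ⟨_, ⟨_, h2 p hp, rfl, hRp.2 ▸ hpl⟩, hRp.1.symm⟩
    · rintro ⟨_, ⟨p, hp, rfl, hpl⟩, rfl⟩
      exact ⟨_, h1 p hp, (hR p).1, (hR p).2.trans hpl⟩
  rw [himage, ncard_image_of_injective _ fun a a' haa => ?_]
  exact mul_left_cancel₀ he0 (add_right_cancel haa)

/-! ### Surfaces with finitely many humps -/

/-- The parameter `t`, clamped to the range of `n + 1` consecutive humps of the critical profile. -/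
noncomputable def humpTime (n : ℕ) (t : ℝ) : ℝ :=
  max (-halfPeriod 1) (min (halfPeriod 1 + n * (2 * halfPeriod 1)) t)

/-- The axial coordinate of the profile with `n + 1` humps between two half lines. -/
noncomputable def humpAxial (n : ℕ) (t : ℝ) : ℝ := axial 1 (humpTime n t) + humpTime n t - t

/-- The height of the profile with `n + 1` humps between two half lines. -/
noncomputable def humpHeight (n : ℕ) (t : ℝ) : ℝ := height 1 (humpTime n t)

/-- The surface with `n + 1` humps of the critical profile, between two half cylinders. -/
noncomputable def humpSurface (n : ℕ) : RotSurface := ofProfile (humpAxial n) (humpHeight n)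

lemma humpTime_of_mem {n : ℕ} {t : ℝ} (h1 : -halfPeriod 1 ≤ t)
    (h2 : t ≤ halfPeriod 1 + n * (2 * halfPeriod 1)) : humpTime n t = t := by
  rw [humpTime, min_eq_right h2, max_eq_right h1]

lemma tangentAngle_one_neg_halfPeriod : tangentAngle 1 (-halfPeriod 1) = -Real.pi := by
  rw [tangentAngle_neg le_rfl, tangentAngle_halfPeriod le_rfl]

lemma humpSurface_mem (n : ℕ) : humpSurface n ∈ criticalSurfaces := by
  have hL := halfPeriod_pos (a := 1) le_rfl
  have hn : 0 ≤ (n : ℝ) * (2 * halfPeriod 1) := by positivity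
  have hpq : -halfPeriod 1 ≤ halfPeriod 1 + n * (2 * halfPeriod 1) := by linarith
  have hcosp : Real.cos (tangentAngle 1 (-halfPeriod 1)) = -1 := by
    rw [tangentAngle_one_neg_halfPeriod, Real.cos_neg, Real.cos_pi]
  have hcosq : Real.cos (tangentAngle 1 (halfPeriod 1 + n * (2 * halfPeriod 1))) = -1 := by
    rw [tangentAngle_add_mul_period le_rfl, tangentAngle_halfPeriod le_rfl,
      Real.cos_add_nat_mul_two_pi, Real.cos_pi]
  have hspeed : ∀ σ, Real.cos σ = -1 → -angularSpeed 1 σ = 0 := fun σ hσ => by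
    rw [angularSpeed, hσ, div_one, unitAngle_neg_one, Real.sin_zero, neg_zero]
  have h := (unitProfile_model le_rfl).clamp hpq (hspeed _ hcosp) (hspeed _ hcosq) hcosp hcosq
  refine mem_criticalSurfaces (S := humpSurface n) rfl h (t₀ := 0) (t₁ := -halfPeriod 1) ?_ ?_
  · change -angularSpeed 1 (tangentAngle 1 (humpTime n 0)) ≠ 0
    rw [humpTime_of_mem (by linarith) (by linarith), tangentAngle_zero le_rfl]
    have := angularSpeed_pos_of_abs_lt (a := 1) le_rfl (σ := 0) (by simpa using Real.pi_pos)
    linarith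
  · change -angularSpeed 1 (tangentAngle 1 (humpTime n (-halfPeriod 1))) = 0
    rw [humpTime_of_mem le_rfl hpq]
    exact hspeed _ hcosp

/-- The largest circles of the surface with `n + 1` humps lie at the tops of the humps. -/
lemma ncard_circleCoords_humpSurface (n : ℕ) :
    ((humpSurface n).circleCoords criticalHeight).ncard = n + 1 := by
  have hL := halfPeriod_pos (a := 1) le_rfl
  have hpi := Real.pi_pos
  have hn : 0 ≤ (n : ℝ) * (2 * halfPeriod 1) := by positivity
  have hset : (humpSurface n).circleCoords criticalHeight =
      (fun k : ℕ => (k : ℝ) * (2 * axial 1 (halfPeriod 1))) '' (Finset.range (n + 1) : Set ℕ) := by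
    ext a
    constructor
    · rintro ⟨p, hp, rfl, hpl⟩
      obtain ⟨t, φ, rfl⟩ := mem_carrier_ofProfile.1 hp
      simp only [Matrix.cons_val] at hpl ⊢
      have hsq : humpHeight n t ^ 2 = criticalHeight ^ 2 := by
        rw [← hpl]
        linear_combination -(humpHeight n t ^ 2) * Real.sin_sq_add_cos_sq φ
      have hh : height 1 (humpTime n t) = maxHeight 1 :=
        (pow_left_inj₀ (zero_le_one.trans (one_le_height le_rfl _))
          (zero_le_one.trans one_lt_criticalHeight.le) two_ne_zero).1 hsq
      obtain ⟨k, hk⟩ := (Real.cos_eq_one_iff _).1 (cos_tangentAngle_of_height_eq le_rfl hh)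
      have h1 : -halfPeriod 1 ≤ humpTime n t := le_max_left _ _
      have h2 : humpTime n t ≤ halfPeriod 1 + n * (2 * halfPeriod 1) :=
        max_le (by linarith) (min_le_left _ _)
      have h3 := (strictMono_tangentAngle le_rfl).monotone h1
      have h4 := (strictMono_tangentAngle le_rfl).monotone h2
      rw [tangentAngle_one_neg_halfPeriod, ← hk] at h3
      rw [tangentAngle_add_mul_period le_rfl, tangentAngle_halfPeriod le_rfl, ← hk] at h4
      have h5 : (-1 : ℝ) < k := by nlinarith
      have h6 : (k : ℝ) < n + 1 := by nlinarith
      have h5' : (-1 : ℤ) < k := by exact_mod_cast h5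
      obtain ⟨j, rfl⟩ := Int.eq_ofNat_of_zero_le (show 0 ≤ k by lia)
      have h6' : j < n + 1 := by exact_mod_cast h6
      have hjn : (j : ℝ) ≤ n := by exact_mod_cast Nat.lt_succ_iff.1 h6'
      have ht : humpTime n t = j * (2 * halfPeriod 1) := by
        refine (strictMono_tangentAngle (a := 1) le_rfl).injective ?_
        have := tangentAngle_add_mul_period (a := 1) le_rfl 0 j
        rw [zero_add, tangentAngle_zero le_rfl, zero_add] at this
        rw [this, ← hk]
        simp
      -- the clamping is not active at the top of a hump
      have ht' : t = humpTime n t := by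
        have hj1 : 0 ≤ (j : ℝ) * (2 * halfPeriod 1) := by positivity
        have hj2 : (j : ℝ) * (2 * halfPeriod 1) ≤ n * (2 * halfPeriod 1) := by gcongr
        have hlt : -halfPeriod 1 < humpTime n t := by linarith
        have hmin : humpTime n t = min (halfPeriod 1 + n * (2 * halfPeriod 1)) t := by
          rcases max_choice (-halfPeriod 1)
            (min (halfPeriod 1 + n * (2 * halfPeriod 1)) t) with h | h
          · exact absurd h hlt.ne'
          · exact h
        rcases min_choice (halfPeriod 1 + n * (2 * halfPeriod 1)) t with h | h
        · rw [h] at hmin; linarith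
        · rw [h] at hmin; exact hmin.symm
      refine ⟨j, by simpa using h6', ?_⟩
      rw [humpAxial, ← ht', add_sub_cancel_right, ht', ht, axial_mul_period le_rfl]
    · rintro ⟨k, hk, rfl⟩
      have hkn : (k : ℝ) ≤ n := by
        exact_mod_cast Nat.lt_succ_iff.1 (Finset.mem_range.1 (Finset.mem_coe.1 hk))
      have hk1 : 0 ≤ (k : ℝ) * (2 * halfPeriod 1) := by positivity
      have hk2 : (k : ℝ) * (2 * halfPeriod 1) ≤ n * (2 * halfPeriod 1) := by gcongr
      have ht := humpTime_of_mem (n := n) (t := k * (2 * halfPeriod 1)) (by linarith) (by linarith)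
      refine ⟨_, mem_carrier_ofProfile.2 ⟨k * (2 * halfPeriod 1), 0, rfl⟩, ?_, ?_⟩
      · simp only [Matrix.cons_val]
        rw [humpAxial, ht, add_sub_cancel_right, axial_mul_period le_rfl]
      · simp only [Matrix.cons_val]
        rw [humpHeight, ht, height, show tangentAngle 1 (k * (2 * halfPeriod 1)) =
          k * (2 * Real.pi) by simpa [tangentAngle_zero] using
            tangentAngle_add_mul_period (a := 1) le_rfl 0 k, Real.cos_nat_mul_two_pi,
          Real.sin_zero, Real.cos_zero, criticalHeight, maxHeight]
        ring
  rw [hset, ncard_image_of_injective, ncard_coe_finset, Finset.card_range]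
  intro k k' hkk
  have := mul_right_cancel₀ (mul_ne_zero two_ne_zero (axial_halfPeriod_neg (a := 1) le_rfl).ne) hkk
  exact_mod_cast this

lemma exists_lt_abs_humpAxial (n : ℕ) (C : ℝ) : ∃ t, C < |humpAxial n t| := by
  have hL := halfPeriod_pos (a := 1) le_rfl
  have hn : 0 ≤ (n : ℝ) * (2 * halfPeriod 1) := by positivity
  set q := halfPeriod 1 + n * (2 * halfPeriod 1) with hq
  refine ⟨q + |axial 1 q| + |C| + 1, ?_⟩
  have ht : humpTime n (q + |axial 1 q| + |C| + 1) = q := by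
    rw [humpTime, min_eq_left, max_eq_right]
    · linarith
    · linarith [abs_nonneg (axial 1 q), abs_nonneg C]
  rw [humpAxial, ht]
  refine lt_of_lt_of_le ?_ (neg_le_abs _)
  linarith [le_abs_self C, le_abs_self (axial 1 q)]

lemma not_congruent_humpSurface {n m : ℕ} (hne : n ≠ m) :
    ¬ (humpSurface n).Congruent (humpSurface m) := by
  intro h
  have hz : ∀ (n : ℕ) t, 0 ≤ humpHeight n t ∧ humpHeight n t ≤ criticalHeight := fun n t =>
    ⟨zero_le_one.trans (one_le_height le_rfl _), height_le_maxHeight le_rfl _⟩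
  obtain ⟨t, -, ht⟩ := (humpSurface_mem n).2.2.2.2.1
  have := ncard_circleCoords_eq_of_congruent h (exists_lt_abs_humpAxial n) (hz n) ⟨t, ht⟩ (hz m)
  have h1 := ncard_circleCoords_humpSurface n
  have h2 := ncard_circleCoords_humpSurface m
  rw [humpSurface] at h1 h2
  rw [h1, h2] at this
  lia

/-! ### The classification -/

/-- A surface over the whole line whose curvature is negative somewhere is one of the periodic
surfaces or critical. -/
lemma congruent_periodic_or_mem {S : RotSurface} {c s κ : ℝ → ℝ} (hI : S.I = univ)
    (h : UnitProfile univ S.x S.z c s κ) {t₀ : ℝ} (h0 : κ t₀ < 0) :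
    (∃ l, criticalHeight < l ∧ S.Congruent (periodic l)) ∨ S ∈ criticalSurfaces := by
  rcases h.eq_model_of_curv_neg h0 with ⟨a, b, ha, hab⟩ | ⟨-, b, -, hab⟩
  · refine Or.inl ⟨maxHeight a, criticalHeight_lt_maxHeight ha, ?_⟩
    rw [periodic, scaleOf_maxHeight (by linarith)]
    refine congruent_of_shift hI rfl b (S.x 0 - axial a (0 + b)) (fun t => (hab t).2.1) fun t => ?_
    have : S.x t - axial a (t + b) = S.x 0 - axial a (0 + b) :=
      eq_of_hasDerivAt_zero (f := fun t => S.x t - axial a (t + b)) fun r _ =>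
        ((h.deriv_x r (mem_univ _)).sub
          ((hasDerivAt_axial ha.le (r + b)).comp_add_const r b)).congr_deriv
          (by rw [(hab r).2.2, sub_self])
    change S.x t = axial a (t + b) + _
    linarith
  · refine Or.inr (mem_criticalSurfaces hI h h0.ne (t₁ := halfPeriod 1 - b) ?_)
    have hL := halfPeriod_pos (a := 1) le_rfl
    rw [(hab _ (by rw [sub_add_cancel, abs_of_pos hL])).1, sub_add_cancel,
      tangentAngle_halfPeriod le_rfl, angularSpeed, Real.cos_pi, div_one, unitAngle_neg_one,
      Real.sin_zero, neg_zero]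

lemma classification {S : RotSurface} (hS : S.IsOfClass 2) (hcomp : S.IsComplete)
    (hA : S.HasUnitShape) :
    S.IsRoundSphere (√2) ∨ S.IsCylinder 1 ∨
      (∃ l, criticalHeight < l ∧ S.Congruent (periodic l)) ∨
      ∃ S' ∈ criticalSurfaces, S.Congruent S' := by
  by_cases hI : S.I = univ
  swap
  · exact Or.inl (isRoundSphere_of_ne_univ hS hcomp hA hI)
  right
  obtain ⟨c, s, κ, h⟩ := hS.exists_unitProfile hA
  rw [hI, interior_univ] at h
  by_cases h0 : ∀ t, κ t = 0
  · exact Or.inl (isCylinder_of_curv_eq_zero hI h h0)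
  right
  push Not at h0
  obtain ⟨t₀, h0⟩ := h0
  rcases lt_or_gt_of_ne h0 with h0 | h0
  · exact (congruent_periodic_or_mem hI h h0).imp_right fun hm => ⟨S, hm, congruent_refl S⟩
  · refine (congruent_periodic_or_mem (S := S.mirror) hI h.reflect
      (neg_neg_of_pos h0)).imp ?_ fun hm => ⟨_, hm, mirror_congruent_iff.1 (congruent_refl _)⟩
    rintro ⟨l, hl, hc⟩
    exact ⟨l, hl, mirror_congruent_iff.1 hc⟩

end RotSurface

theorem theorem1p1 :
    ∃ (l₀ : ℝ) (F₁ : ℝ → RotSurface) (F₂ : Set RotSurface), 1 < l₀ ∧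
      -- the one-parameter family `F₁ l`, for `l > l₀`
      (∀ l, l₀ < l →
        (F₁ l).IsOfClass (⊤ : ℕ∞) ∧ (F₁ l).IsComplete ∧ (F₁ l).HasUnitShape ∧
        (F₁ l).IsPeriodic ∧ ¬ IsEmbeddedSurface (F₁ l).carrier ∧ (F₁ l).HasMaxRadius l) ∧
      ContinuousOn (fun q : ℝ × (ℝ × ℝ) => (F₁ q.1).map q.2) (Set.Ioi l₀ ×ˢ Set.univ) ∧
      (∀ l m, l₀ < l → l₀ < m → l ≠ m → ¬ (F₁ l).Congruent (F₁ m)) ∧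
      -- the infinite family `F₂`
      (∀ S ∈ F₂,
        S.IsOfClass 3 ∧ S.IsComplete ∧ S.HasUnitShape ∧
        ¬ IsEmbeddedSurface S.carrier ∧ S.HasMaxRadius l₀) ∧
      (∃ s ⊆ F₂, s.Infinite ∧ s.Pairwise fun S S' => ¬ S.Congruent S') ∧
      -- the classification
      (∀ S : RotSurface, S.IsOfClass 2 → S.IsComplete → S.HasUnitShape →
        S.IsRoundSphere (Real.sqrt 2) ∨ S.IsCylinder 1 ∨
        (∃ l, l₀ < l ∧ S.Congruent (F₁ l)) ∨ ∃ S' ∈ F₂, S.Congruent S') := by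
  refine ⟨criticalHeight, RotSurface.periodic, RotSurface.criticalSurfaces, one_lt_criticalHeight,
    fun l hl => ?_, RotSurface.continuousOn_periodic_map,
    fun l m hl hm => RotSurface.not_congruent_periodic hl hm, fun S hS => hS,
    ⟨range RotSurface.humpSurface, ?_, ?_, ?_⟩, fun S => RotSurface.classification⟩
  · have h := unitProfile_model (one_lt_scaleOf hl).le
    exact ⟨RotSurface.isOfClass_periodic hl,
      RotSurface.isComplete_of_unitProfile (S := RotSurface.periodic l) rfl h,
      RotSurface.hasUnitShape_of_unitProfile (S := RotSurface.periodic l) h,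
      RotSurface.isPeriodic_periodic hl, RotSurface.not_isEmbeddedSurface_periodic hl,
      RotSurface.hasMaxRadius_periodic hl⟩
  · rintro _ ⟨n, rfl⟩
    exact RotSurface.humpSurface_mem n
  · refine infinite_range_of_injective fun n m hnm => ?_
    by_contra hne
    exact RotSurface.not_congruent_humpSurface hne (hnm ▸ RotSurface.congruent_refl _)
  · rintro _ ⟨n, rfl⟩ _ ⟨m, rfl⟩ hne
    exact RotSurface.not_congruent_humpSurface fun he => hne (by rw [he])
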